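/- Let $(M,J)$ be an almost complex surface (a smooth $4$-manifold with a smooth almost complex structure), and let $g$ and $g_1$ be two almost K\"ahler metrics on $(M,J)$: Riemannian metrics compatible with $J$ whose fundamental forms $\omega=g(J\cdot,\cdot)$ and $\omega_1=g_1(J\cdot,\cdot)$ are closed. Let $f$ be a smooth real function with $\omega_1^2=e^f\omega^2$, and put $u=\tfrac12\operatorname{tr}_g g_1$. On an open set let $\theta^i$ and $\tilde\theta^i$ ($i=1,2$) be local unitary coframes for $g$ and $g_1$ (so $g=\theta^i\otimes\overline{\theta^i}+\overline{\theta^i}\otimes\theta^i$ with $\theta^i$ of type $(1,0)$, and similarly for $g_1$), and write $\tilde\theta^i=a^i_j\theta^j$, $\theta^j=b^j_i\tilde\theta^i$. Let $\theta^i_j$ be the connection forms, in this coframe, of the second canonical connection of $g$ (the connection preserving $g$ and $J$ whose torsion has no $(1,1)$ part), with torsion and curvature $$\Theta^i=d\theta^i+\theta^i_j\wedge\theta^j,\qquad \Psi^i_j=d\theta^i_j+\theta^i_k\wedge\theta^k_j ,$$ and define $N^i_{\bar j\bar k}=-N^i_{\bar k\bar j}$, $R^j_{ik\bar l}$ and the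 Hermitian scalar curvature $R$ by $$(\Theta^i)^{(0,2)}=N^i_{\bar j\bar k}\,\overline{\theta^j}\wedge\overline{\theta^k},\qquad (\Psi^j_i)^{(1,1)}=R^j_{ik\bar l}\,\theta^k\wedge\overline{\theta^l},\qquad R=R^i_{ik\bar k},$$ with repeated indices summed over $1,2$. Let $\Delta_g=\operatorname{tr}_g\nabla d$ and $\Delta_{g_1}=\operatorname{tr}_{g_1}\nabla^{1}d$ be the Laplacians on functions of the Levi-Civita connections $\nabla$ of $g$ and $\nabla^{1}$ of $g_1$. Then $u>0$, and at every point of the open set the expression in parentheses below is real and $$\Delta_{g_1}\log u\ \ge\ \frac1u\Big(\Delta_g f-2R+8\,N^l_{\bar p\bar i}\,\overline{N^p_{\bar l\bar i}}+2\,\overline{a^p_i}\,a^p_j\,b^k_q\,\overline{b^l_q}\;\mathcal R_{i\bar jk\bar l}\Big),\qquad \mathcal R_{i\bar jk\bar l}=R^j_{ik\bar l}+4N^r_{\bar l\bar j}\,\overline{N^i_{\bar r\bar k}} .$$ -/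

import Mathlib

open Bundle Manifold
open scoped Manifold ContDiff

noncomputable section

/-- The model space of a real four-dimensional manifold. -/
abbrev E4 : Type := EuclideanSpace ℝ (Fin 4)

/-- The standard basis of the model space. -/
def stdVec (i : Fin 4) : E4 := EuclideanSpace.single i 1

section Manifold4

variable (M : Type*) [TopologicalSpace M] [ChartedSpace E4 M] [IsManifold (𝓡 4) ∞ M]

/-- A smooth almost complex structure on a (real) four-manifold. -/
structure AlmostComplexStructure where
  /-- The endomorphism of each tangent space. -/
  toFun : ∀ x : M, TangentSpace (𝓡 4) x →L[ℝ] TangentSpace (𝓡 4) x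
  sq : ∀ (x : M) (v : TangentSpace (𝓡 4) x), toFun x (toFun x v) = -v
  smooth : ContMDiff (𝓡 4) ((𝓡 4).prod 𝓘(ℝ, E4 →L[ℝ] E4)) ∞
    (fun x => TotalSpace.mk' (E4 →L[ℝ] E4)
      (E := fun x : M => TangentSpace (𝓡 4) x →L[ℝ] TangentSpace (𝓡 4) x) x (toFun x))

variable {M}

/-- The differential of the inverse of the preferred chart at `x`, at the point `z` of the model
space. -/
def chartInvDeriv (x : M) (z : E4) :
    E4 →L[ℝ] TangentSpace (𝓡 4) ((extChartAt (𝓡 4) x).symm z) :=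
  mfderiv 𝓘(ℝ, E4) (𝓡 4) (extChartAt (𝓡 4) x).symm z

/-- The expression of a differential form in the preferred chart at `x` (its pullback under the
inverse of the chart). -/
def chartForm {F : Type*} [NormedAddCommGroup F] [NormedSpace ℝ F] {k : ℕ}
    (α : ∀ x : M, TangentSpace (𝓡 4) x [⋀^Fin k]→L[ℝ] F) (x : M) (z : E4) :
    E4 [⋀^Fin k]→L[ℝ] F :=
  (α ((extChartAt (𝓡 4) x).symm z)).compContinuousLinearMap (chartInvDeriv x z)

/-- The exterior derivative of a differential form on `M`, at `x`, computed in the preferred chart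
at `x`; in Mathlib the tangent space at `x` is the model space, by means of this very chart. -/
def extD {F : Type*} [NormedAddCommGroup F] [NormedSpace ℝ F] {k : ℕ}
    (α : ∀ x : M, TangentSpace (𝓡 4) x [⋀^Fin k]→L[ℝ] F) (x : M) :
    TangentSpace (𝓡 4) x [⋀^Fin (k + 1)]→L[ℝ] F :=
  extDeriv (chartForm α x) (extChartAt (𝓡 4) x x)

/-- The exterior derivative of a complex-valued one-form, as a function of two tangent vectors:
`dα(X, Y) = X (α Y) - Y (α X) - α [X, Y]`. -/
def extD₁ (α : ∀ x : M, TangentSpace (𝓡 4) x →L[ℝ] ℂ) (x : M)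
    (v w : TangentSpace (𝓡 4) x) : ℂ :=
  extD (fun y => ContinuousAlternatingMap.ofSubsingleton ℝ (TangentSpace (𝓡 4) y) ℂ (0 : Fin 1)
    (α y)) x ![v, w]

/-- The wedge product of two complex-valued one-forms:
`(α ∧ β)(v, w) = α v * β w - α w * β v`. -/
def wedge₁ (α β : ∀ x : M, TangentSpace (𝓡 4) x →L[ℝ] ℂ) (x : M)
    (v w : TangentSpace (𝓡 4) x) : ℂ :=
  α x v * β x w - α x w * β x v

/-- The four-form `η ∧ η`, for a two-form `η`. -/
def wedgeSq (η : ∀ x : M, TangentSpace (𝓡 4) x [⋀^Fin 2]→L[ℝ] ℝ) (x : M)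
    (v : Fin 4 → TangentSpace (𝓡 4) x) : ℝ :=
  2 * (η x ![v 0, v 1] * η x ![v 2, v 3] - η x ![v 0, v 2] * η x ![v 1, v 3]
    + η x ![v 0, v 3] * η x ![v 1, v 2])

/-- An almost Kähler structure with a given almost complex structure `J`: a `J`-invariant
Riemannian metric `g` whose fundamental form
`form = g(J·, ·)` is closed. -/
structure AlmostKahlerMetric (J : AlmostComplexStructure M) where
  g : ContMDiffRiemannianMetric (𝓡 4) ∞ E4 (fun x : M => TangentSpace (𝓡 4) x)
  form : ∀ x : M, TangentSpace (𝓡 4) x [⋀^Fin 2]→L[ℝ] ℝ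
  compatible : ∀ (x : M) (v w : TangentSpace (𝓡 4) x),
    g.inner x (J.toFun x v) (J.toFun x w) = g.inner x v w
  form_apply : ∀ (x : M) (v w : TangentSpace (𝓡 4) x),
    form x ![v, w] = g.inner x (J.toFun x v) w
  closed : ∀ x : M, extD form x = 0

/-! ### The Laplacian and the trace -/

section Laplacian

variable (g : ContMDiffRiemannianMetric (𝓡 4) ∞ E4 (fun x : M => TangentSpace (𝓡 4) x))

/-- The matrix `g_{ij}` of the metric in the preferred chart at `x`, as a function on the model
space. -/
def metricMatrix (x : M) (z : E4) : Matrix (Fin 4) (Fin 4) ℝ :=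
  Matrix.of fun i j => g.inner ((extChartAt (𝓡 4) x).symm z)
    (chartInvDeriv x z (stdVec i)) (chartInvDeriv x z (stdVec j))

/-- The Christoffel symbols `Γ^k_{ij}` of the Levi-Civita connection, in the preferred chart at
`x`. -/
def christoffel (x : M) (z : E4) (k i j : Fin 4) : ℝ :=
  (1 / 2) * ∑ l, (metricMatrix g x z)⁻¹ k l *
    (fderiv ℝ (fun y => metricMatrix g x y j l) z (stdVec i)
      + fderiv ℝ (fun y => metricMatrix g x y i l) z (stdVec j)
      - fderiv ℝ (fun y => metricMatrix g x y i j) z (stdVec l))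

/-- The Laplacian `Δ_g h = tr_g (∇ dh)` of a function with respect to the Levi-Civita connection:
`g^{ij} (∂_i ∂_j h - Γ^k_{ij} ∂_k h)`, in the preferred chart at the point. -/
def laplacian (h : M → ℝ) (x : M) : ℝ :=
  let H : E4 → ℝ := fun z => h ((extChartAt (𝓡 4) x).symm z)
  let p : E4 := extChartAt (𝓡 4) x x
  ∑ i, ∑ j, (metricMatrix g x p)⁻¹ i j *
    (fderiv ℝ (fun z => fderiv ℝ H z (stdVec j)) p (stdVec i)
      - ∑ k, christoffel g x p k i j * fderiv ℝ H p (stdVec k))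

/-- The matrix of the metric at `x` in the standard basis of the tangent space at `x`. -/
def gramMatrix (x : M) : Matrix (Fin 4) (Fin 4) ℝ :=
  Matrix.of fun i j => g.inner x (stdVec i : E4) (stdVec j : E4)

/-- The trace `tr_g g₁ = g^{ij} (g₁)_{ij}`. -/
def metricTrace
    (g₁ : ContMDiffRiemannianMetric (𝓡 4) ∞ E4 (fun x : M => TangentSpace (𝓡 4) x)) (x : M) : ℝ :=
  ((gramMatrix g x)⁻¹ * gramMatrix g₁ x).trace

end Laplacian

/-! ### Unitary frames and the second canonical connection -/

variable {J : AlmostComplexStructure M}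

/-- A local unitary frame `e₁, e₂` of `T'M` on `U` with its smooth dual coframe `θ¹, θ²`. The
complex vector field `e_k` is recorded through the real one `X_k` with `e_k = (X_k - i J X_k) / 2`.
-/
structure LocalUnitaryFrame (K : AlmostKahlerMetric J) (U : Set M) where
  θ : Fin 2 → ∀ x : M, TangentSpace (𝓡 4) x →L[ℝ] ℂ
  X : Fin 2 → ∀ x : M, TangentSpace (𝓡 4) x
  smooth : ∀ i, ContMDiffOn (𝓡 4) ((𝓡 4).prod 𝓘(ℝ, E4 →L[ℝ] ℂ)) ∞
    (fun x => TotalSpace.mk' (E4 →L[ℝ] ℂ)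
      (E := fun x : M => TangentSpace (𝓡 4) x →L[ℝ] Bundle.Trivial M ℂ x) x (θ i x)) U
  /-- Each `θ^i` is of type (1,0). -/
  type_one_zero : ∀ i, ∀ x ∈ U, ∀ v, θ i x (J.toFun x v) = Complex.I * θ i x v
  /-- The frame is dual to the coframe. -/
  dual : ∀ i j, ∀ x ∈ U, θ i x (X j x) = if i = j then 1 else 0
  /-- `g = θ^i ⊗ conj θ^i + conj θ^i ⊗ θ^i`. -/
  unitary : ∀ x ∈ U, ∀ v w, (K.g.inner x v w : ℂ) =
    ∑ i, (θ i x v * (starRingEnd ℂ) (θ i x w) + (starRingEnd ℂ) (θ i x v) * θ i x w)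

/-- The value of (the complex bilinear extension of) a two-form `β` on the complex vectors
`(v - s J v) / 2` and `(w - t J w) / 2`. -/
def evalType (J : AlmostComplexStructure M) (x : M)
    (β : TangentSpace (𝓡 4) x → TangentSpace (𝓡 4) x → ℂ) (s t : ℂ)
    (v w : TangentSpace (𝓡 4) x) : ℂ :=
  (1 / 4) * (β v w - t * β v (J.toFun x w) - s * β (J.toFun x v) w
    + s * t * β (J.toFun x v) (J.toFun x w))

/-- The curvature `Ψ^i_j = dϑ^i_j + ϑ^i_k ∧ ϑ^k_j` of a connection with the connection forms
`ϑ i j = ϑ^i_j`. -/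
def curvatureForm (ϑ : Fin 2 → Fin 2 → ∀ x : M, TangentSpace (𝓡 4) x →L[ℝ] ℂ) (i j : Fin 2) (x : M)
    (v w : TangentSpace (𝓡 4) x) : ℂ :=
  extD₁ (ϑ i j) x v w + ∑ k, wedge₁ (ϑ i k) (ϑ k j) x v w

namespace LocalUnitaryFrame

variable {K : AlmostKahlerMetric J} {U : Set M} (e : LocalUnitaryFrame K U)

/-- The component `β(e_k, conj e_l)`. -/
def comp11 (x : M) (β : TangentSpace (𝓡 4) x → TangentSpace (𝓡 4) x → ℂ) (k l : Fin 2) : ℂ :=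
  evalType J x β Complex.I (-Complex.I) (e.X k x) (e.X l x)

/-- The component `β(conj e_k, conj e_l)`. -/
def comp02 (x : M) (β : TangentSpace (𝓡 4) x → TangentSpace (𝓡 4) x → ℂ) (k l : Fin 2) : ℂ :=
  evalType J x β (-Complex.I) (-Complex.I) (e.X k x) (e.X l x)

/-- The torsion `Θ^i = dθ^i + ϑ^i_j ∧ θ^j` of the connection with the connection forms
`ϑ i j = ϑ^i_j`, that is, `∇ e_j = ϑ^i_j ⊗ e_i`. -/
def torsion (ϑ : Fin 2 → Fin 2 → ∀ x : M, TangentSpace (𝓡 4) x →L[ℝ] ℂ) (i : Fin 2) (x : M)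
    (v w : TangentSpace (𝓡 4) x) : ℂ :=
  extD₁ (e.θ i) x v w + ∑ j, wedge₁ (ϑ i j) (e.θ j) x v w

/-- The forms `ϑ` are the connection forms, in the given unitary frame, of the second canonical
connection: the connection that preserves the metric and `J` (the matrix `ϑ` is skew-Hermitian)
and whose torsion has no (1,1) part. -/
structure IsSecondCanonical (ϑ : Fin 2 → Fin 2 → ∀ x : M, TangentSpace (𝓡 4) x →L[ℝ] ℂ) :
    Prop where
  skew : ∀ i j, ∀ x ∈ U, ∀ v, ϑ i j x v + (starRingEnd ℂ) (ϑ j i x v) = 0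
  torsion11 : ∀ i k l, ∀ x ∈ U, e.comp11 x (e.torsion ϑ i x) k l = 0

/-- The connection forms `ϑ^i_j` of the second canonical connection: the two conditions of
`IsSecondCanonical` amount to
`ϑ^i_j = dθ^i(e_j, conj e_l) conj θ^l - conj (dθ^j(e_i, conj e_l)) θ^l`. -/
def connForm (i j : Fin 2) (x : M) : TangentSpace (𝓡 4) x →L[ℝ] ℂ :=
  ∑ l, (e.comp11 x (extD₁ (e.θ i) x) j l •
      ((Complex.conjCLE : ℂ →L[ℝ] ℂ).comp (e.θ l x))
    - (starRingEnd ℂ) (e.comp11 x (extD₁ (e.θ j) x) i l) • e.θ l x)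

theorem connForm_apply (i j : Fin 2) (x : M) (v : TangentSpace (𝓡 4) x) :
    e.connForm i j x v = ∑ l, (e.comp11 x (extD₁ (e.θ i) x) j l * (starRingEnd ℂ) (e.θ l x v)
      - (starRingEnd ℂ) (e.comp11 x (extD₁ (e.θ j) x) i l) * e.θ l x v) := by
  simp [connForm]

theorem comp11_torsion (ϑ : Fin 2 → Fin 2 → ∀ x : M, TangentSpace (𝓡 4) x →L[ℝ] ℂ)
    (i k l : Fin 2) (x : M) (hx : x ∈ U) :
    e.comp11 x (e.torsion ϑ i x) k l = e.comp11 x (extD₁ (e.θ i) x) k l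
      - (1 / 2) * (ϑ i k x (e.X l x) + Complex.I * ϑ i k x (J.toFun x (e.X l x))) := by
  have h1 := fun j m => e.type_one_zero j x hx (e.X m x)
  have h2 := fun j m => e.dual j m x hx
  simp only [comp11, evalType, torsion, wedge₁, Fin.sum_univ_two, h1, h2]
  fin_cases k <;> fin_cases l <;> simp <;> ring_nf <;> simp [Complex.I_sq] <;> ring

theorem connForm_isSecondCanonical : e.IsSecondCanonical e.connForm where
  skew i j x _ v := by
    simp only [connForm_apply, Fin.sum_univ_two, map_add, map_sub, map_mul, Complex.conj_conj]
    ring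
  torsion11 i k l x hx := by
    rw [comp11_torsion e _ i k l x hx]
    have h1 := fun j m => e.type_one_zero j x hx (e.X m x)
    have h2 := fun j m => e.dual j m x hx
    simp only [connForm_apply, Fin.sum_univ_two, h1, h2]
    fin_cases l <;> simp <;> ring_nf <;> simp [Complex.I_sq]

theorem eq_sum_frame (x : M) (hx : x ∈ U) (v : TangentSpace (𝓡 4) x) :
    v = ∑ k, ((e.θ k x v).re • e.X k x + (e.θ k x v).im • J.toFun x (e.X k x)) := by
  rw [← sub_eq_zero]
  set w := v - ∑ k, ((e.θ k x v).re • e.X k x + (e.θ k x v).im • J.toFun x (e.X k x)) with hw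
  have h0 : ∀ i, e.θ i x w = 0 := by
    intro i
    have h1 := fun j m => e.type_one_zero j x hx (e.X m x)
    have h2 := fun j m => e.dual j m x hx
    simp only [hw, map_sub, map_add, map_smul, Fin.sum_univ_two, h1, h2]
    rw [← Complex.re_add_im (e.θ i x v)]
    fin_cases i <;> simp
  by_contra hne
  have hp := K.g.pos x w hne
  have hu := e.unitary x hx w w
  simp only [h0, map_zero, mul_zero, add_zero, Finset.sum_const_zero] at hu
  rw [Complex.ofReal_eq_zero] at hu
  exact hp.ne' hu

/-- The second canonical connection is unique. -/
theorem IsSecondCanonical.eq_connForm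
    {ϑ : Fin 2 → Fin 2 → ∀ x : M, TangentSpace (𝓡 4) x →L[ℝ] ℂ} (h : e.IsSecondCanonical ϑ)
    (i j : Fin 2) (x : M) (hx : x ∈ U) : ϑ i j x = e.connForm i j x := by
  have key : ∀ i j l, ϑ i j x (e.X l x) + Complex.I * ϑ i j x (J.toFun x (e.X l x))
      = e.connForm i j x (e.X l x) + Complex.I * e.connForm i j x (J.toFun x (e.X l x)) := by
    intro i j l
    have h1 := h.torsion11 i j l x hx
    have h2 := e.connForm_isSecondCanonical.torsion11 i j l x hx
    rw [comp11_torsion e _ i j l x hx] at h1 h2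
    linear_combination 2 * h2 - 2 * h1
  have hs := fun i j v => h.skew i j x hx v
  have hs' := fun i j v => e.connForm_isSecondCanonical.skew i j x hx v
  have key2 : ∀ l, ϑ i j x (e.X l x) - Complex.I * ϑ i j x (J.toFun x (e.X l x))
      = e.connForm i j x (e.X l x) - Complex.I * e.connForm i j x (J.toFun x (e.X l x)) := by
    intro l
    have h3 := congrArg (starRingEnd ℂ) (key j i l)
    simp only [map_add, map_mul, Complex.conj_I] at h3
    linear_combination -h3 + hs i j (e.X l x) - hs' i j (e.X l x)
      - Complex.I * hs i j (J.toFun x (e.X l x)) + Complex.I * hs' i j (J.toFun x (e.X l x))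
  have hX : ∀ l, ϑ i j x (e.X l x) = e.connForm i j x (e.X l x) := fun l => by
    linear_combination (1 / 2) * key i j l + (1 / 2) * key2 l
  have hJX : ∀ l, ϑ i j x (J.toFun x (e.X l x)) = e.connForm i j x (J.toFun x (e.X l x)) :=
    fun l => by
      have := key i j l
      rw [hX l] at this
      exact mul_left_cancel₀ Complex.I_ne_zero (add_left_cancel this)
  ext v
  rw [e.eq_sum_frame x hx v]
  simp only [map_sum, map_add, map_smul, hX, hJX]

/-- The components `N^i_{conj j conj k}` of the (0,2) part of the torsion of the second canonical
connection, `(Θ^i)^{(0,2)} = N^i_{conj j conj k} conj θ^j ∧ conj θ^k` (summed over all `j`, `k`,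
with `N` skew in `j`, `k`). -/
def nijenhuis (i j k : Fin 2) (x : M) : ℂ :=
  (1 / 2) * e.comp02 x (e.torsion e.connForm i x) j k

/-- The components `R^j_{i k conj l}` of the curvature of the second canonical connection,
`(Ψ^j_i)^{(1,1)} = R^j_{i k conj l} θ^k ∧ conj θ^l`. -/
def curv (j i k l : Fin 2) (x : M) : ℂ :=
  e.comp11 x (curvatureForm e.connForm j i x) k l

/-- The Hermitian scalar curvature `R = R_{k conj k}`, where `R_{k conj l} = R^i_{i k conj l}`. -/
def scalarCurv (x : M) : ℂ := ∑ k, ∑ i, e.curv i i k k x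

/-- The tensor `𝓡_{i conj j k conj l} = R^j_{i k conj l}
  + 4 N^r_{conj l conj j} conj (N^i_{conj r conj k})`. -/
def curvTerm (i j k l : Fin 2) (x : M) : ℂ :=
  e.curv j i k l x
    + 4 * ∑ r, e.nijenhuis r l j x * (starRingEnd ℂ) (e.nijenhuis i r k x)

/-- The matrix `a^i_j = θ'^i(e_j)` with `θ'^i = a^i_j θ^j`, for two frames `e` and `e'`
of the same bundle `T'M`. -/
def transition {K' : AlmostKahlerMetric J} (e' : LocalUnitaryFrame K' U) (i j : Fin 2) (x : M) :
    ℂ :=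
  e'.θ i x (e.X j x)

end LocalUnitaryFrame

end Manifold4

end

/-!
# A differential inequality for two almost Kähler metrics

The argument is the Chern-Lu computation for the identity map from `(M, g)` to `(M, g₁)`, for the second
canonical connections. Let `θ`, `θ'` be unitary coframes with `θ' = a θ`, and let `ϑ`, `ϑ'` be their
connection forms. The form `β = da - a ϑ + ϑ' a` is the covariant derivative of the identity. The torsions
of both connections have type (0,2): they have no (1,1) part by definition, and no (2,0) part because the
fundamental forms are closed (`UnitaryGerm.torsion`). Comparing the structure equations of the coframes
gives that `β` has type (1,0) (`UnitaryPair.coeffDeriv_type`) and that the Nijenhuis tensors `n`, `n'`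
satisfy `n' conj (det a) = a n` (`UnitaryPair.germN_change`).

Since `u = Σ |a_ij|²` and `e^f = |det a|²`, the (1,0) parts of `du` and `df` are `Σ conj (a_ij) β_ij` and
`tr (a⁻¹ β)`. Their exterior derivatives contain the curvatures of both connections, and in the first case
also `-|β|²` (`extOne_delNorm`, `extOne_delLogDet`). For an almost Kähler metric the Laplacian of a function
`h` is `-2` times the trace of `d ∂h`, where `∂h` is the (1,0) part of `dh`
(`LocalUnitaryFrame.laplacian_eq`); closedness of the fundamental form is what removes the first order
terms. So `Δ₁ u` contains the curvature of `g₁` traced over the form indices, and `Δ f` contains it traced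
over the fibre indices. The first Bianchi identity converts one into the other, at the cost of a quadratic
expression in `n'` (`UnitaryGerm.trace_curv`), which an algebraic identity for two by two matrices turns
into the quadratic terms in `n` (`nijenhuis_quadratic`). The result (`UnitaryPair.bochner`) is that the
expression in the theorem equals `Δ₁ u - 2 |β|²`; in particular it is real. Finally
`Δ₁ log u = Δ₁ u / u - 2 |∂u|² / u²`, and `|∂u|² ≤ u |β|²` by the Cauchy-Schwarz inequality.

All local computations are made for germs of coframes at a point of a normed space (`UnitaryGerm`,
`UnitaryPair`), where the almost complex structure enters only through the frame fields `X_k` and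
`Y_k = J X_k`; a preferred chart of the manifold transports the geometric objects there.
-/

noncomputable section

open Filter Topology

local notation "conj" => starRingEnd ℂ

/-! ### Charts and naturality of the exterior derivative -/

section Charts

variable {M : Type*} [TopologicalSpace M] [ChartedSpace E4 M] [IsManifold (𝓡 4) ∞ M]

/-- In Mathlib the tangent space at `x` is the model space by means of the preferred chart
at `x`, so the differential of that chart at its centre is the identity. -/
theorem chartInvDeriv_self (x : M) :
    chartInvDeriv x (extChartAt (𝓡 4) x x) = ContinuousLinearMap.id ℝ E4 := by
  have : IsManifold (𝓡 4) 1 M := IsManifold.of_le (n := ∞) (by simp)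
  have := mfderivWithin_range_extChartAt_symm (I := 𝓡 4) (x := x)
  rw [ModelWithCorners.range_eq_univ, mfderivWithin_univ] at this
  exact this

theorem mdifferentiableAt_chart_symm (x : M) {z : E4} (hz : z ∈ (extChartAt (𝓡 4) x).target) :
    MDifferentiableAt 𝓘(ℝ, E4) (𝓡 4) (extChartAt (𝓡 4) x).symm z := by
  have : IsManifold (𝓡 4) 1 M := IsManifold.of_le (n := ∞) (by simp)
  have := mdifferentiableWithinAt_extChartAt_symm (I := 𝓡 4) hz
  rwa [ModelWithCorners.range_eq_univ, mdifferentiableWithinAt_univ] at this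

theorem chartInvDeriv_isInvertible (x : M) {z : E4} (hz : z ∈ (extChartAt (𝓡 4) x).target) :
    (chartInvDeriv x z : E4 →L[ℝ] E4).IsInvertible := by
  have : IsManifold (𝓡 4) 1 M := IsManifold.of_le (n := ∞) (by simp)
  have := isInvertible_mfderivWithin_extChartAt_symm (I := 𝓡 4) hz
  rw [ModelWithCorners.range_eq_univ, mfderivWithin_univ] at this
  exact this

omit [IsManifold (𝓡 4) ∞ M] in
theorem chart_eventually_target (x : M) :
    ∀ᶠ z in 𝓝 (extChartAt (𝓡 4) x x), z ∈ (extChartAt (𝓡 4) x).target :=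
  extChartAt_target_mem_nhds (I := 𝓡 4) x

/-- The differentials of the inverses of two charts differ by that of the transition map. -/
theorem chartInvDeriv_eq_comp (x y : M) {z : E4} (hz : z ∈ (extChartAt (𝓡 4) x).target)
    (hy : (extChartAt (𝓡 4) x).symm z ∈ (extChartAt (𝓡 4) y).source) :
    (chartInvDeriv x z : E4 →L[ℝ] E4) =
      (chartInvDeriv y (extChartAt (𝓡 4) y ((extChartAt (𝓡 4) x).symm z)) : E4 →L[ℝ] E4).comp
        (fderiv ℝ (extChartAt (𝓡 4) y ∘ (extChartAt (𝓡 4) x).symm) z) := by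
  have : IsManifold (𝓡 4) 1 M := IsManifold.of_le (n := ∞) (by simp)
  have h1 := mdifferentiableAt_chart_symm x hz
  have h2 : MDifferentiableAt (𝓡 4) 𝓘(ℝ, E4) (extChartAt (𝓡 4) y) ((extChartAt (𝓡 4) x).symm z) :=
    mdifferentiableAt_extChartAt (by rwa [extChartAt_source] at hy)
  have h3 := mfderiv_comp z h2 h1
  rw [mfderiv_eq_fderiv] at h3
  rw [h3]
  have h4 := mfderivWithin_extChartAt_symm_comp_mfderiv_extChartAt' (I := 𝓡 4) hy
  rw [ModelWithCorners.range_eq_univ, mfderivWithin_univ] at h4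
  ext1 v
  exact (congrArg (fun L => L (mfderiv 𝓘(ℝ, E4) (𝓡 4) (extChartAt (𝓡 4) x).symm z v)) h4).symm

/-- Naturality of the exterior derivative: the form `extD α`, which is computed at each point in
the preferred chart there, is represented in a fixed chart by the exterior derivative of the
representative of `α`. -/
theorem extD_chart {F : Type*} [NormedAddCommGroup F] [NormedSpace ℝ F] {k : ℕ}
    (α : ∀ x : M, TangentSpace (𝓡 4) x [⋀^Fin k]→L[ℝ] F) (x : M) {z : E4}
    (hz : z ∈ (extChartAt (𝓡 4) x).target)
    (hα : DifferentiableAt ℝ (chartForm α ((extChartAt (𝓡 4) x).symm z))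
      (extChartAt (𝓡 4) ((extChartAt (𝓡 4) x).symm z) ((extChartAt (𝓡 4) x).symm z))) :
    extDeriv (chartForm α x) z =
      (extD α ((extChartAt (𝓡 4) x).symm z)).compContinuousLinearMap (chartInvDeriv x z) := by
  set y := (extChartAt (𝓡 4) x).symm z with hy
  set τ : E4 → E4 := extChartAt (𝓡 4) y ∘ (extChartAt (𝓡 4) x).symm with hτ
  have hyx : y ∈ (extChartAt (𝓡 4) x).source := (extChartAt (𝓡 4) x).map_target hz
  have hcont : ContinuousAt (extChartAt (𝓡 4) x).symm z :=
    (mdifferentiableAt_chart_symm x hz).continuousAt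
  have hev : ∀ᶠ z' in 𝓝 z, z' ∈ (extChartAt (𝓡 4) x).target ∧
      (extChartAt (𝓡 4) x).symm z' ∈ (extChartAt (𝓡 4) y).source := by
    refine Filter.Eventually.and ((isOpen_extChartAt_target (I := 𝓡 4) x).mem_nhds hz) ?_
    exact hcont (extChartAt_source_mem_nhds (I := 𝓡 4) y)
  have hEq : chartForm α x =ᶠ[𝓝 z]
      fun z' => (chartForm α y (τ z')).compContinuousLinearMap (fderiv ℝ τ z') := by
    filter_upwards [hev] with z' hz'
    ext v
    have h1 := chartInvDeriv_eq_comp x y hz'.1 hz'.2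
    have h2 : (extChartAt (𝓡 4) y).symm (τ z') = (extChartAt (𝓡 4) x).symm z' :=
      (extChartAt (𝓡 4) y).left_inv hz'.2
    -- all tangent spaces are `E4` by definition, so that `α` may be rewritten as a plain function
    let α' : M → E4 [⋀^Fin k]→L[ℝ] F := α
    change α' ((extChartAt (𝓡 4) x).symm z') (fun i => (chartInvDeriv x z' : E4 →L[ℝ] E4) (v i)) =
      α' ((extChartAt (𝓡 4) y).symm (τ z'))
        (fun i => (chartInvDeriv y (τ z') : E4 →L[ℝ] E4) (fderiv ℝ τ z' (v i)))
    rw [h2, h1]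
    rfl
  have hsm : ContDiffAt ℝ ∞ τ z := by
    have h1 : ContMDiffAt 𝓘(ℝ, E4) (𝓡 4) ∞ (extChartAt (𝓡 4) x).symm z :=
      (contMDiffOn_extChartAt_symm (n := ∞) x).contMDiffAt
        ((isOpen_extChartAt_target (I := 𝓡 4) x).mem_nhds hz)
    have h2 : ContMDiffAt (𝓡 4) 𝓘(ℝ, E4) ∞ (extChartAt (𝓡 4) y) y := contMDiffAt_extChartAt
    exact (h2.comp z h1).contDiffAt
  rw [hEq.extDeriv_eq, extDeriv_pullback (f := τ) (r := ∞) hα hsm (by simp; exact WithTop.coe_le_coe.2 le_top)]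
  have h5 := chartInvDeriv_eq_comp x y hz (mem_extChartAt_source (I := 𝓡 4) y)
  rw [← hy, chartInvDeriv_self] at h5
  have h6 : (chartInvDeriv x z : E4 →L[ℝ] E4) = fderiv ℝ τ z := h5
  ext v
  change extDeriv (chartForm α y) (τ z) (fun i => fderiv ℝ τ z (v i)) =
    extDeriv (chartForm α y) (extChartAt (𝓡 4) y y) (fun i => (chartInvDeriv x z : E4 →L[ℝ] E4) (v i))
  rw [h6]
  rfl

/-- The expression of a complex-valued one-form in the preferred chart at `x`. -/
def chartOneForm (α : ∀ x : M, TangentSpace (𝓡 4) x →L[ℝ] ℂ) (x : M) (z : E4) : E4 →L[ℝ] ℂ :=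
  (α ((extChartAt (𝓡 4) x).symm z)).comp (chartInvDeriv x z)

theorem chartOneForm_self (α : ∀ x : M, TangentSpace (𝓡 4) x →L[ℝ] ℂ) (x : M) :
    chartOneForm α x (extChartAt (𝓡 4) x x) = α x := by
  ext v
  let α' : M → E4 →L[ℝ] ℂ := α
  change α' ((extChartAt (𝓡 4) x).symm (extChartAt (𝓡 4) x x))
    ((chartInvDeriv x (extChartAt (𝓡 4) x x) : E4 →L[ℝ] E4) v) = α' x v
  rw [chartInvDeriv_self, extChartAt_to_inv]
  rfl

theorem contDiffAt_chartOneForm {α : ∀ x : M, TangentSpace (𝓡 4) x →L[ℝ] ℂ} {x : M}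
    (hα : ContMDiffAt (𝓡 4) ((𝓡 4).prod 𝓘(ℝ, E4 →L[ℝ] ℂ)) ∞
      (fun x => TotalSpace.mk' (E4 →L[ℝ] ℂ)
        (E := fun x : M => TangentSpace (𝓡 4) x →L[ℝ] Bundle.Trivial M ℂ x) x (α x)) x) :
    ContDiffAt ℝ ∞ (chartOneForm α x) (extChartAt (𝓡 4) x x) := by
  have : IsManifold (𝓡 4) 1 M := IsManifold.of_le (n := ∞) (by simp)
  have h1 := ((contMDiffAt_hom_bundle _).1 hα).2
  have h2 : ContMDiffAt 𝓘(ℝ, E4) (𝓡 4) ∞ (extChartAt (𝓡 4) x).symm (extChartAt (𝓡 4) x x) :=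
    (contMDiffOn_extChartAt_symm (n := ∞) x).contMDiffAt (extChartAt_target_mem_nhds (I := 𝓡 4) x)
  have h3 : ContDiffAt ℝ ∞ _ (extChartAt (𝓡 4) x x) :=
    (ContMDiffAt.comp_of_eq (g := fun y : M => ContinuousLinearMap.inCoordinates E4
        (fun x : M => TangentSpace (𝓡 4) x) ℂ (Bundle.Trivial M ℂ) x y x y (α y)) h1 h2
      (extChartAt_to_inv x)).contDiffAt
  refine h3.congr_of_eventuallyEq ?_
  filter_upwards [chart_eventually_target x] with z hz
  have hy : (extChartAt (𝓡 4) x).symm z ∈ (chartAt E4 x).source := by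
    rw [← extChartAt_source (𝓡 4)]; exact (extChartAt (𝓡 4) x).map_target hz
  have h4 := TangentBundle.symmL_trivializationAt (I := 𝓡 4) hy
  rw [ModelWithCorners.range_eq_univ, mfderivWithin_univ, (extChartAt (𝓡 4) x).right_inv hz] at h4
  simp only [Function.comp, ContinuousLinearMap.inCoordinates, h4]
  ext v
  simp [chartOneForm, chartInvDeriv]

end Charts

/-! ### One-forms on a normed space -/

section Calculus

variable {E : Type*} [NormedAddCommGroup E] [NormedSpace ℝ E]

/-- The exterior derivative of a complex-valued one-form on a normed space, as a function of two
vectors. -/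
def extOne (α : E → E →L[ℝ] ℂ) (z v w : E) : ℂ := fderiv ℝ α z v w - fderiv ℝ α z w v

theorem extOne_congr {α β : E → E →L[ℝ] ℂ} {z : E} (h : α =ᶠ[𝓝 z] β) (v w : E) :
    extOne α z v w = extOne β z v w := by
  simp only [extOne, h.fderiv_eq]

theorem fderiv_oneForm_apply {α : E → E →L[ℝ] ℂ} {z : E} (h : DifferentiableAt ℝ α z) (v w : E) :
    fderiv ℝ (fun y => α y w) z v = fderiv ℝ α z v w := by
  rw [fderiv_clm_apply h (differentiableAt_const w)]
  simp

theorem extOne_add {α β : E → E →L[ℝ] ℂ} {z : E} (hα : DifferentiableAt ℝ α z)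
    (hβ : DifferentiableAt ℝ β z) (v w : E) :
    extOne (fun y => α y + β y) z v w = extOne α z v w + extOne β z v w := by
  simp only [extOne, fderiv_fun_add hα hβ, add_apply]
  ring

theorem extOne_sub {α β : E → E →L[ℝ] ℂ} {z : E} (hα : DifferentiableAt ℝ α z)
    (hβ : DifferentiableAt ℝ β z) (v w : E) :
    extOne (fun y => α y - β y) z v w = extOne α z v w - extOne β z v w := by
  simp only [extOne, fderiv_fun_sub hα hβ, sub_apply]
  ring

theorem extOne_smul {f : E → ℂ} {α : E → E →L[ℝ] ℂ} {z : E} (hf : DifferentiableAt ℝ f z)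
    (hα : DifferentiableAt ℝ α z) (v w : E) :
    extOne (fun y => f y • α y) z v w =
      fderiv ℝ f z v * α z w - fderiv ℝ f z w * α z v + f z * extOne α z v w := by
  simp only [extOne, fderiv_fun_smul hf hα, add_apply,
    smul_apply, ContinuousLinearMap.smulRight_apply, smul_eq_mul]
  ring

theorem extOne_fderiv {f : E → ℂ} {z : E} (hf : ContDiffAt ℝ ∞ f z) (v w : E) :
    extOne (fun y => fderiv ℝ f y) z v w = 0 := by
  have := hf.isSymmSndFDerivAt (by simp; exact WithTop.coe_le_coe.2 le_top)
  exact sub_eq_zero.2 (this v w)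

theorem fderiv_conj {f : E → ℂ} {z : E} (hf : DifferentiableAt ℝ f z) (v : E) :
    fderiv ℝ (fun y => (starRingEnd ℂ) (f y)) z v = (starRingEnd ℂ) (fderiv ℝ f z v) := by
  have := ((Complex.conjCLE : ℂ →L[ℝ] ℂ).hasFDerivAt.comp z hf.hasFDerivAt).fderiv
  exact congrArg (fun L => L v) this

theorem contDiffAt_fderiv {F : Type*} [NormedAddCommGroup F] [NormedSpace ℝ F] {f : E → F} {z : E}
    (hf : ContDiffAt ℝ ∞ f z) : ContDiffAt ℝ ∞ (fun y => fderiv ℝ f y) z :=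
  hf.fderiv_right (by simp)

theorem ContDiffAt.diffAt {F : Type*} [NormedAddCommGroup F] [NormedSpace ℝ F] {f : E → F} {z : E}
    (hf : ContDiffAt ℝ ∞ f z) : DifferentiableAt ℝ f z :=
  hf.differentiableAt (by simp)

theorem ContDiffAt.eventually_infty {F : Type*} [NormedAddCommGroup F] [NormedSpace ℝ F]
    {f : E → F} {z : E} (hf : ContDiffAt ℝ ∞ f z) : ∀ᶠ y in 𝓝 z, DifferentiableAt ℝ f y := by
  have h1 : ContDiffAt ℝ 1 f z := hf.of_le (WithTop.coe_le_coe.2 le_top)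
  filter_upwards [h1.eventually (by simp)] with y hy
  exact hy.differentiableAt (by simp)

theorem contDiffAt_conj {f : E → ℂ} {z : E} (hf : ContDiffAt ℝ ∞ f z) :
    ContDiffAt ℝ ∞ (fun y => (starRingEnd ℂ) (f y)) z :=
  (Complex.conjCLE : ℂ →L[ℝ] ℂ).contDiff.contDiffAt.comp z hf

/-- The exterior derivative of a one-form is closed: the cyclic sum of the derivatives of
`dα(v, w)` vanishes. -/
theorem cyclic_fderiv_extOne {α : E → E →L[ℝ] ℂ} {z : E} (hα : ContDiffAt ℝ ∞ α z) (u v w : E) :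
    fderiv ℝ (fun y => extOne α y v w) z u + fderiv ℝ (fun y => extOne α y w u) z v
      + fderiv ℝ (fun y => extOne α y u v) z w = 0 := by
  have hd : DifferentiableAt ℝ (fderiv ℝ α) z := (contDiffAt_fderiv hα).diffAt
  have key : ∀ a b c : E, fderiv ℝ (fun y => extOne α y a b) z c =
      fderiv ℝ (fderiv ℝ α) z c a b - fderiv ℝ (fderiv ℝ α) z c b a := by
    intro a b c
    have h0 : ∀ a : E, DifferentiableAt ℝ (fun y => fderiv ℝ α y a) z :=
      fun a => hd.clm_apply (differentiableAt_const a)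
    have h1 : ∀ a b : E, DifferentiableAt ℝ (fun y => fderiv ℝ α y a b) z :=
      fun a b => (h0 a).clm_apply (differentiableAt_const b)
    have h2 : ∀ a b : E, fderiv ℝ (fun y => fderiv ℝ α y a b) z c =
        fderiv ℝ (fderiv ℝ α) z c a b := by
      intro a b
      rw [fderiv_oneForm_apply (h0 a), fderiv_clm_apply hd (differentiableAt_const a)]
      simp
    simp only [extOne]
    rw [fderiv_fun_sub (h1 a b) (h1 b a), sub_apply, h2, h2]
  have hs : ∀ a b, fderiv ℝ (fderiv ℝ α) z a b = fderiv ℝ (fderiv ℝ α) z b a :=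
    fun a b => hα.isSymmSndFDerivAt (by simp; exact WithTop.coe_le_coe.2 le_top) a b
  rw [key, key, key, hs v u, hs w u, hs w v]
  ring

theorem extDeriv_ofSubsingleton {α : E → E →L[ℝ] ℂ} {z : E} (hα : DifferentiableAt ℝ α z)
    (v w : E) :
    extDeriv (fun y => ContinuousAlternatingMap.ofSubsingleton ℝ E ℂ (0 : Fin 1) (α y)) z ![v, w] =
      extOne α z v w := by
  have hd : DifferentiableAt ℝ
      (fun y => ContinuousAlternatingMap.ofSubsingleton ℝ E ℂ (0 : Fin 1) (α y)) z :=
    ((ContinuousAlternatingMap.ofSubsingletonLIE (𝕜 := ℝ) (E := E) (F := ℂ)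
      (0 : Fin 1)).toContinuousLinearEquiv.differentiableAt).comp z hα
  rw [extDeriv_apply hd]
  simp [Fin.sum_univ_two, extOne, Fin.removeNth, fderiv_oneForm_apply hα]
  rfl

end Calculus

section ChartForms

variable {M : Type*} [TopologicalSpace M] [ChartedSpace E4 M] [IsManifold (𝓡 4) ∞ M]

omit [IsManifold (𝓡 4) ∞ M] in
theorem extD₁_self {α : ∀ x : M, TangentSpace (𝓡 4) x →L[ℝ] ℂ} {x : M}
    (hα : DifferentiableAt ℝ (chartOneForm α x) (extChartAt (𝓡 4) x x)) (v w : E4) :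
    extD₁ α x v w = extOne (chartOneForm α x) (extChartAt (𝓡 4) x x) v w :=
  extDeriv_ofSubsingleton hα v w

theorem extD₁_chart {α : ∀ x : M, TangentSpace (𝓡 4) x →L[ℝ] ℂ} {x : M} {z : E4}
    (hz : z ∈ (extChartAt (𝓡 4) x).target)
    (hα : DifferentiableAt ℝ (chartOneForm α ((extChartAt (𝓡 4) x).symm z))
      (extChartAt (𝓡 4) ((extChartAt (𝓡 4) x).symm z) ((extChartAt (𝓡 4) x).symm z)))
    (hx : DifferentiableAt ℝ (chartOneForm α x) z) (v w : E4) :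
    extD₁ α ((extChartAt (𝓡 4) x).symm z) (chartInvDeriv x z v) (chartInvDeriv x z w) =
      extOne (chartOneForm α x) z v w := by
  rw [← extDeriv_ofSubsingleton hx]
  have hd := ((ContinuousAlternatingMap.ofSubsingletonLIE (𝕜 := ℝ) (E := E4) (F := ℂ)
      (0 : Fin 1)).toContinuousLinearEquiv.differentiableAt).comp _ hα
  have := extD_chart (fun y => ContinuousAlternatingMap.ofSubsingleton ℝ (TangentSpace (𝓡 4) y) ℂ
    (0 : Fin 1) (α y)) x hz hd
  have h2 := congrArg (fun L => L ![v, w]) this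
  refine Eq.trans ?_ h2.symm
  refine congrArg (extD _ _) ?_
  ext i
  fin_cases i <;> rfl

end ChartForms

/-! ### Germs of unitary coframes -/

section Germs

variable {E : Type*} [NormedAddCommGroup E] [NormedSpace ℝ E]

/-- The germ at `p` of a unitary coframe `θ` of an almost Kähler structure on a vector space: `X k`
and `Y k = J (X k)` are the vector fields with `θ^i(X_k) = δ^i_k`, `θ^i(Y_k) = i δ^i_k`, and `closed`
says that the fundamental form `i Σ θ^i ∧ conj θ^i` is closed. The almost complex structure
is recorded only through the frame. -/
structure UnitaryGerm (p : E) (θ : Fin 2 → E → E →L[ℝ] ℂ) (X Y : Fin 2 → E → E) : Prop where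
  smooth : ∀ i, ContDiffAt ℝ ∞ (θ i) p
  smooth_X : ∀ i, ContDiffAt ℝ ∞ (X i) p
  smooth_Y : ∀ i, ContDiffAt ℝ ∞ (Y i) p
  dual_X : ∀ᶠ z in 𝓝 p, ∀ i j, θ i z (X j z) = if i = j then 1 else 0
  dual_Y : ∀ᶠ z in 𝓝 p, ∀ i j, θ i z (Y j z) = if i = j then Complex.I else 0
  complete : ∀ᶠ z in 𝓝 p, ∀ v, v = ∑ k, ((θ k z v).re • X k z + (θ k z v).im • Y k z)
  closed : ∀ᶠ z in 𝓝 p, ∀ u v w, ∑ i,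
    ((extOne (θ i) z u v * conj (θ i z w) - conj (extOne (θ i) z u v) * θ i z w)
    + (extOne (θ i) z v w * conj (θ i z u) - conj (extOne (θ i) z v w) * θ i z u)
    + (extOne (θ i) z w u * conj (θ i z v) - conj (extOne (θ i) z w u) * θ i z v)) = 0

set_option synthInstance.maxHeartbeats 200000 in
theorem differentiableAt_tensor {r m : E → E →L[ℝ] ℝ} {z : E} (hr : DifferentiableAt ℝ r z)
    (hm : DifferentiableAt ℝ m z) :
    DifferentiableAt ℝ
      (fun y => ((ContinuousLinearMap.lsmul ℝ ℝ (E := E →L[ℝ] ℝ)).flip (m y)).comp (r y)) z := by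
  refine DifferentiableAt.clm_comp ?_ hr
  exact ((ContinuousLinearMap.lsmul ℝ ℝ (E := E →L[ℝ] ℝ)).flip.differentiableAt).comp z hm

/-- The two-form `2 Re θ ∧ Im θ = i θ ∧ conj θ`. -/
def reWedgeIm (θ : E →L[ℝ] ℂ) : E [⋀^Fin 2]→L[ℝ] ℝ :=
  (2 : ℝ) • ContinuousAlternatingMap.alternatizeUncurryFinCLM ℝ E ℝ
    (((ContinuousAlternatingMap.ofSubsingletonLIE (𝕜 := ℝ) (E := E) (F := ℝ)
      (0 : Fin 1)).toContinuousLinearEquiv : (E →L[ℝ] ℝ) →L[ℝ] E [⋀^Fin 1]→L[ℝ] ℝ).comp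
      (((ContinuousLinearMap.lsmul ℝ ℝ (E := E →L[ℝ] ℝ)).flip (Complex.imCLM.comp θ)).comp
        (Complex.reCLM.comp θ)))

theorem reWedgeIm_apply (θ : E →L[ℝ] ℂ) (v : Fin 2 → E) :
    reWedgeIm θ v = 2 * ((θ (v 0)).re * (θ (v 1)).im - (θ (v 1)).re * (θ (v 0)).im) := by
  simp [reWedgeIm, ContinuousAlternatingMap.alternatizeUncurryFinCLM_apply,
    ContinuousAlternatingMap.alternatizeUncurryFin_apply, Fin.sum_univ_two, Fin.removeNth]
  ring

theorem differentiableAt_reWedgeIm {θ : E → E →L[ℝ] ℂ} {z : E} (h : DifferentiableAt ℝ θ z) :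
    DifferentiableAt ℝ (fun y => reWedgeIm (θ y)) z := by
  have hr : DifferentiableAt ℝ (fun y => Complex.reCLM.comp (θ y)) z :=
    (ContinuousLinearMap.compL ℝ E ℂ ℝ Complex.reCLM).differentiableAt.comp z h
  have hi : DifferentiableAt ℝ (fun y => Complex.imCLM.comp (θ y)) z :=
    (ContinuousLinearMap.compL ℝ E ℂ ℝ Complex.imCLM).differentiableAt.comp z h
  have hs := differentiableAt_tensor hr hi
  refine DifferentiableAt.const_smul ?_ (2 : ℝ)
  refine (ContinuousAlternatingMap.alternatizeUncurryFinCLM ℝ E ℝ).differentiableAt.comp z ?_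
  exact (differentiableAt_const _).clm_comp hs

theorem fderiv_reWedgeIm {θ : E → E →L[ℝ] ℂ} {z : E} (h : DifferentiableAt ℝ θ z) (u : E)
    (v : Fin 2 → E) :
    fderiv ℝ (fun y => reWedgeIm (θ y) v) z u =
      2 * ((fderiv ℝ θ z u (v 0)).re * (θ z (v 1)).im + (θ z (v 0)).re * (fderiv ℝ θ z u (v 1)).im
        - (fderiv ℝ θ z u (v 1)).re * (θ z (v 0)).im
        - (θ z (v 1)).re * (fderiv ℝ θ z u (v 0)).im) := by
  have hc : ∀ w, HasFDerivAt (fun y => θ y w) ((fderiv ℝ θ z).flip w) z := by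
    intro w
    have h1 : DifferentiableAt ℝ (fun y => θ y w) z := h.clm_apply (differentiableAt_const w)
    have h2 := h1.hasFDerivAt
    have h3 : fderiv ℝ (fun y => θ y w) z = (fderiv ℝ θ z).flip w := by
      ext a
      rw [fderiv_oneForm_apply h]; rfl
    rwa [h3] at h2
  have hr := fun w => Complex.reCLM.hasFDerivAt.comp z (hc w)
  have hi := fun w => Complex.imCLM.hasFDerivAt.comp z (hc w)
  have := ((((hr (v 0)).mul (hi (v 1))).sub ((hr (v 1)).mul (hi (v 0)))).const_mul 2).fderiv
  have h2 : (fun y => reWedgeIm (θ y) v) = fun y => 2 * (((Complex.reCLM ∘ fun y => θ y (v 0)) * (Complex.imCLM ∘ fun y => θ y (v 1))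
     - (Complex.reCLM ∘ fun y => θ y (v 1)) * (Complex.imCLM ∘ fun y => θ y (v 0)) : E → ℝ) y) := by
    ext y
    rw [reWedgeIm_apply]
    rfl
  rw [h2]
  refine (congrArg (fun L => L u) this).trans ?_
  simp
  ring

/-- If a two-form equals `i Σ θ^i ∧ conj θ^i` and is closed at `z`, then the coframe satisfies
`Σ (dθ^i ∧ conj θ^i - conj (dθ^i) ∧ θ^i) = 0` there. -/
theorem cyclic_of_closed {θ : Fin 2 → E → E →L[ℝ] ℂ} {z : E}
    (h : ∀ i, DifferentiableAt ℝ (θ i) z) {W : E → E [⋀^Fin 2]→L[ℝ] ℝ}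
    (hW : W =ᶠ[𝓝 z] fun y => ∑ i, reWedgeIm (θ i y)) (hd : extDeriv W z = 0) (u v w : E) :
    ∑ i, ((extOne (θ i) z u v * conj (θ i z w) - conj (extOne (θ i) z u v) * θ i z w)
    + (extOne (θ i) z v w * conj (θ i z u) - conj (extOne (θ i) z v w) * θ i z u)
    + (extOne (θ i) z w u * conj (θ i z v) - conj (extOne (θ i) z w u) * θ i z v)) = 0 := by
  rw [hW.extDeriv_eq] at hd
  have hdi : DifferentiableAt ℝ (fun y => ∑ i, reWedgeIm (θ i y)) z :=
    DifferentiableAt.fun_sum fun i _ => differentiableAt_reWedgeIm (h i)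
  have h1 := congrArg (fun L => L ![u, v, w]) hd
  have hdi' : ∀ (a : Fin 2 → E) (i : Fin 2), DifferentiableAt ℝ (fun y => reWedgeIm (θ i y) a) z :=
    fun a i => (differentiableAt_reWedgeIm (h i)).continuousAlternatingMap_apply_const a
  have key : ∀ (a : Fin 2 → E) (b : E),
      fderiv ℝ (fun y => (∑ i, reWedgeIm (θ i y)) a) z b =
        ∑ i, fderiv ℝ (fun y => reWedgeIm (θ i y) a) z b := by
    intro a b
    have : (fun y => (∑ i, reWedgeIm (θ i y)) a) = fun y => ∑ i, reWedgeIm (θ i y) a := by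
      ext y; simp
    rw [this, fderiv_fun_sum fun i _ => hdi' a i]
    simp
  simp only [extDeriv_apply hdi, key, fderiv_reWedgeIm (h _)] at h1
  simp [Fin.removeNth, Fin.sum_univ_succ, Fin.succAbove] at h1
  apply Complex.ext
  · simp [Fin.sum_univ_two, extOne]
    ring
  · simp [Fin.sum_univ_two, extOne]
    linear_combination -h1

end Germs

/-! ### Unitary frames in a chart -/

section FrameSmooth

variable {E : Type*} [NormedAddCommGroup E] [NormedSpace ℝ E]

theorem isInvertible_coframe {θ : Fin 2 → E →L[ℝ] ℂ} {X Y : Fin 2 → E}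
    (hX : ∀ i j, θ i (X j) = if i = j then 1 else 0)
    (hY : ∀ i j, θ i (Y j) = if i = j then Complex.I else 0)
    (hc : ∀ v, v = ∑ k, ((θ k v).re • X k + (θ k v).im • Y k)) :
    (ContinuousLinearMap.pi θ).IsInvertible := by
  refine ⟨ContinuousLinearEquiv.equivOfInverse (ContinuousLinearMap.pi θ)
    (∑ k, ((Complex.reCLM.comp (ContinuousLinearMap.proj k)).smulRight (X k)
      + (Complex.imCLM.comp (ContinuousLinearMap.proj k)).smulRight (Y k))) ?_ ?_, rfl⟩
  · intro v
    conv_rhs => rw [hc v]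
    simp
  · intro c
    ext i
    simp only [ContinuousLinearMap.coe_pi', Fin.sum_univ_two, add_apply, map_add,
      ContinuousLinearMap.smulRight_apply, map_smul, hX, hY, ContinuousLinearMap.comp_apply,
      ContinuousLinearMap.proj_apply, Complex.reCLM_apply, Complex.imCLM_apply]
    rw [← Complex.re_add_im (c i)]
    fin_cases i <;> simp

/-- The frame dual to a smooth coframe is smooth. -/
theorem contDiffAt_dual_frame [CompleteSpace E] {p : E} {θ : Fin 2 → E → E →L[ℝ] ℂ}
    {X Y : Fin 2 → E → E} (hθ : ∀ i, ContDiffAt ℝ ∞ (θ i) p)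
    (hX : ∀ᶠ z in 𝓝 p, ∀ i j, θ i z (X j z) = if i = j then 1 else 0)
    (hY : ∀ᶠ z in 𝓝 p, ∀ i j, θ i z (Y j z) = if i = j then Complex.I else 0)
    (hc : ∀ᶠ z in 𝓝 p, ∀ v, v = ∑ k, ((θ k z v).re • X k z + (θ k z v).im • Y k z))
    (V : E → E) (c : Fin 2 → ℂ) (hV : ∀ᶠ z in 𝓝 p, ∀ i, θ i z (V z) = c i) :
    ContDiffAt ℝ ∞ V p := by
  have hpi : ContDiffAt ℝ ∞ (fun z => ContinuousLinearMap.pi fun i => θ i z) p := by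
    have h1 : ∀ z, (ContinuousLinearMap.pi fun i => θ i z) =
        (ContinuousLinearMap.single ℝ (fun _ : Fin 2 => ℂ) 0).comp (θ 0 z)
          + (ContinuousLinearMap.single ℝ (fun _ : Fin 2 => ℂ) 1).comp (θ 1 z) := by
      intro z
      ext v i
      fin_cases i <;> simp
    simp only [h1]
    exact (contDiffAt_const.clm_comp (hθ 0)).add (contDiffAt_const.clm_comp (hθ 1))
  have hinv := (isInvertible_coframe hX.self_of_nhds hY.self_of_nhds
    hc.self_of_nhds).contDiffAt_map_inverse (n := ∞)
  have h2 := (hinv.comp p hpi).clm_apply (contDiffAt_const (c := c))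
  refine h2.congr_of_eventuallyEq ?_
  filter_upwards [hX, hY, hc, hV] with z h1 h2 h3 h4
  have hi := isInvertible_coframe h1 h2 h3
  have h5 : ContinuousLinearMap.pi (fun i => θ i z) (V z) = c := by ext i; exact h4 i
  obtain ⟨T, hT⟩ := hi
  simp only [Function.comp]
  rw [← hT] at h5 ⊢
  rw [ContinuousLinearMap.inverse_equiv, ← h5]
  simp

end FrameSmooth

section ChartGerm

variable {M : Type*} [TopologicalSpace M] [ChartedSpace E4 M] [IsManifold (𝓡 4) ∞ M]
variable {J : AlmostComplexStructure M} {K : AlmostKahlerMetric J} {U : Set M}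

/-- The expression of a vector field in the preferred chart at `x`. -/
def chartVec (x : M) (V : ∀ y : M, TangentSpace (𝓡 4) y) (z : E4) : E4 :=
  (chartInvDeriv x z : E4 →L[ℝ] E4).inverse (V ((extChartAt (𝓡 4) x).symm z) : E4)

theorem chartInvDeriv_chartVec (x : M) (V : ∀ y : M, TangentSpace (𝓡 4) y) {z : E4}
    (hz : z ∈ (extChartAt (𝓡 4) x).target) :
    chartInvDeriv x z (chartVec x V z) = V ((extChartAt (𝓡 4) x).symm z) :=
  (chartInvDeriv_isInvertible x hz).self_apply_inverse _

theorem chartVec_self (x : M) (V : ∀ y : M, TangentSpace (𝓡 4) y) :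
    chartVec x V (extChartAt (𝓡 4) x x) = V x := by
  let V' : M → E4 := V
  have h : ∀ L : E4 →L[ℝ] E4, L = ContinuousLinearMap.id ℝ E4 → ∀ w, L.inverse w = w := by
    rintro L rfl w
    rw [ContinuousLinearMap.inverse_id]
    rfl
  exact (h _ (chartInvDeriv_self x) _).trans (congrArg V' (extChartAt_to_inv x))

omit [IsManifold (𝓡 4) ∞ M] in
theorem chart_eventually_mem (x : M) (hU : IsOpen U) (hx : x ∈ U) :
    ∀ᶠ z in 𝓝 (extChartAt (𝓡 4) x x), z ∈ (extChartAt (𝓡 4) x).target ∧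
      (extChartAt (𝓡 4) x).symm z ∈ U := by
  refine (chart_eventually_target x).and ?_
  have h := continuousAt_extChartAt_symm (I := 𝓡 4) x
  refine h ?_
  rw [extChartAt_to_inv]
  exact hU.mem_nhds hx

namespace LocalUnitaryFrame

variable (e : LocalUnitaryFrame K U)

/-- The coframe in the preferred chart at `x`. -/
def chartθ (x : M) (i : Fin 2) : E4 → E4 →L[ℝ] ℂ := chartOneForm (e.θ i) x

/-- The frame fields `X_k` in the preferred chart at `x`. -/
def chartX (x : M) (k : Fin 2) : E4 → E4 := chartVec x (e.X k)

/-- The frame fields `J X_k` in the preferred chart at `x`. -/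
def chartY (x : M) (k : Fin 2) : E4 → E4 := chartVec x (fun y => J.toFun y (e.X k y))

theorem contDiffAt_chartθ (hU : IsOpen U) {x : M} (hx : x ∈ U) (i : Fin 2) :
    ContDiffAt ℝ ∞ (e.chartθ x i) (extChartAt (𝓡 4) x x) :=
  contDiffAt_chartOneForm ((e.smooth i).contMDiffAt (hU.mem_nhds hx))

theorem chartθ_apply (x : M) (i : Fin 2) (z v : E4) :
    e.chartθ x i z v = e.θ i ((extChartAt (𝓡 4) x).symm z) (chartInvDeriv x z v) := rfl

theorem form_apply_eq {y : M} (hy : y ∈ U) (v w : TangentSpace (𝓡 4) y) :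
    K.form y ![v, w] =
      ∑ i, 2 * ((e.θ i y v).re * (e.θ i y w).im - (e.θ i y w).re * (e.θ i y v).im) := by
  rw [K.form_apply]
  have := congrArg Complex.re (e.unitary y hy (J.toFun y v) w)
  rw [Complex.ofReal_re] at this
  rw [this]
  simp [e.type_one_zero _ y hy, Fin.sum_univ_two]
  ring

theorem chartForm_form (x : M) {z : E4} (hy : (extChartAt (𝓡 4) x).symm z ∈ U) :
    chartForm K.form x z = ∑ i, reWedgeIm (e.chartθ x i z) := by
  ext v
  have h1 : (fun i => chartInvDeriv x z (v i)) =
      ![chartInvDeriv x z (v 0), chartInvDeriv x z (v 1)] := by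
    ext i; fin_cases i <;> rfl
  have h2 : chartForm K.form x z v =
      K.form ((extChartAt (𝓡 4) x).symm z) (fun i => chartInvDeriv x z (v i)) := rfl
  rw [h2, h1, e.form_apply_eq hy]
  simp [reWedgeIm_apply, chartθ_apply]

theorem unitaryGerm (hU : IsOpen U) {x : M} (hx : x ∈ U) :
    UnitaryGerm (extChartAt (𝓡 4) x x) (e.chartθ x) (e.chartX x) (e.chartY x) := by
  have hev := chart_eventually_mem x hU hx
  have hθ := e.contDiffAt_chartθ hU hx
  have hX : ∀ᶠ z in 𝓝 (extChartAt (𝓡 4) x x), ∀ i j,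
      e.chartθ x i z (e.chartX x j z) = if i = j then 1 else 0 := by
    filter_upwards [hev] with z hz i j
    rw [chartθ_apply, chartX, chartInvDeriv_chartVec x _ hz.1]
    exact e.dual i j _ hz.2
  have hY : ∀ᶠ z in 𝓝 (extChartAt (𝓡 4) x x), ∀ i j,
      e.chartθ x i z (e.chartY x j z) = if i = j then Complex.I else 0 := by
    filter_upwards [hev] with z hz i j
    rw [chartθ_apply, chartY, chartInvDeriv_chartVec x _ hz.1, e.type_one_zero i _ hz.2,
      e.dual i j _ hz.2]
    simp
  have hc : ∀ᶠ z in 𝓝 (extChartAt (𝓡 4) x x), ∀ v, v = ∑ k,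
      ((e.chartθ x k z v).re • e.chartX x k z + (e.chartθ x k z v).im • e.chartY x k z) := by
    filter_upwards [hev] with z hz v
    apply (chartInvDeriv_isInvertible x hz.1).injective
    have h := e.eq_sum_frame _ hz.2 (chartInvDeriv x z v)
    refine h.trans ?_
    rw [map_sum]
    refine Finset.sum_congr rfl fun k _ => ?_
    rw [map_add, map_smul, map_smul]
    have h1 := chartInvDeriv_chartVec x (e.X k) hz.1
    have h2 := chartInvDeriv_chartVec x (fun y => J.toFun y (e.X k y)) hz.1
    exact congrArg₂ (· + ·) (congrArg _ h1.symm) (congrArg _ h2.symm)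
  refine ⟨hθ, fun k => ?_, fun k => ?_, hX, hY, hc, ?_⟩
  · exact contDiffAt_dual_frame hθ hX hY hc _ (fun i => if i = k then 1 else 0)
      (hX.mono fun z h i => h i k)
  · exact contDiffAt_dual_frame hθ hX hY hc _ (fun i => if i = k then Complex.I else 0)
      (hY.mono fun z h i => h i k)
  · filter_upwards [hev, hev.eventually_nhds, (hθ 0).eventually_infty, (hθ 1).eventually_infty]
      with z hz hz' h0 h1
    refine cyclic_of_closed (W := chartForm K.form x)
      (fun i => by fin_cases i <;> assumption) ?_ ?_
    · filter_upwards [hz'] with z' hz''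
      exact e.chartForm_form x hz''.2
    · rw [extD_chart K.form x hz.1, K.closed]
      · rfl
      · have hz2 := hz.2
        generalize (extChartAt (𝓡 4) x).symm z = y at hz2
        have hev' := chart_eventually_mem y hU hz2
        have : chartForm K.form y =ᶠ[𝓝 (extChartAt (𝓡 4) y y)]
            fun z => ∑ i, reWedgeIm (e.chartθ y i z) := by
          filter_upwards [hev'] with z hz
          exact e.chartForm_form y hz.2
        refine DifferentiableAt.congr_of_eventuallyEq ?_ this
        exact DifferentiableAt.fun_sum fun i _ =>
          differentiableAt_reWedgeIm (e.contDiffAt_chartθ hU hz2 i).diffAt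

end LocalUnitaryFrame

end ChartGerm

/-! ### The Laplacian in a frame -/

section Contraction

theorem sum_coord_smul_stdVec (v : E4) : ∑ i, v i • stdVec i = v := by
  ext j
  simp [stdVec, Fin.sum_univ_four]
  fin_cases j <;> simp

theorem sum_coord_mul {T : E4 → ℝ} (h : IsLinearMap ℝ T) (v : E4) :
    ∑ i, v i * T (stdVec i) = T v := by
  conv_rhs => rw [← sum_coord_smul_stdVec v]
  change _ = h.mk' T _
  rw [map_sum]
  simp

variable {ι : Type*} [Fintype ι]

/-- The contraction of a bilinear form with `½ Σ F_a ⊗ F_a`, computed in the standard basis. -/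
theorem sum_sum_contraction {T : E4 → E4 → ℝ} (h1 : ∀ w, IsLinearMap ℝ fun v => T v w)
    (h2 : ∀ v, IsLinearMap ℝ (T v)) (F : ι → E4) :
    ∑ i, ∑ j, (1 / 2 * ∑ a, F a i * F a j) * T (stdVec i) (stdVec j) =
      1 / 2 * ∑ a, T (F a) (F a) := by
  have h : ∀ a, T (F a) (F a) = ∑ i, ∑ j, F a i * F a j * T (stdVec i) (stdVec j) := by
    intro a
    rw [← sum_coord_mul (h1 (F a)) (F a)]
    refine Finset.sum_congr rfl fun i _ => ?_
    rw [← sum_coord_mul (h2 (stdVec i)) (F a), Finset.mul_sum]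
    exact Finset.sum_congr rfl fun j _ => by ring
  simp only [h]
  rw [Finset.sum_comm, Finset.mul_sum]
  have : ∀ a, ∑ i, ∑ j, F a i * F a j * T (stdVec i) (stdVec j) =
      ∑ j, ∑ i, F a i * F a j * T (stdVec i) (stdVec j) := fun a => Finset.sum_comm
  simp only [this]
  simp only [Finset.mul_sum, Finset.sum_mul]
  rw [Finset.sum_comm' (t' := Finset.univ) (s' := fun _ => Finset.univ) (by simp)]
  rw [Finset.sum_comm]
  conv_rhs => rw [Finset.sum_comm]
  refine Finset.sum_congr rfl fun j _ => ?_
  conv_rhs => rw [Finset.sum_comm]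
  refine Finset.sum_congr rfl fun i _ => Finset.sum_congr rfl fun a _ => by ring

end Contraction

section FrameLaplacian

variable {M : Type*} [TopologicalSpace M] [ChartedSpace E4 M] [IsManifold (𝓡 4) ∞ M]
variable {ι : Type*} [Fintype ι] [DecidableEq ι]

/-- The inverse of the metric `2 Σ φ_a ⊗ φ_a` is `½ Σ F_a ⊗ F_a`, for the dual frame `F`. -/
theorem inv_of_frame {φ : ι → E4 →L[ℝ] ℝ} {F : ι → E4} {G : Matrix (Fin 4) (Fin 4) ℝ}
    (hG : ∀ i j, G i j = 2 * ∑ a, φ a (stdVec i) * φ a (stdVec j))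
    (hd : ∀ a b, φ a (F b) = if a = b then 1 else 0) (hc : ∀ v, ∑ a, φ a v • F a = v) :
    G⁻¹ = Matrix.of fun i j => 1 / 2 * ∑ a, F a i * F a j := by
  refine Matrix.inv_eq_right_inv ?_
  ext i k
  rw [Matrix.mul_apply]
  have h1 : ∀ a b, ∑ j, F a j * φ b (stdVec j) = if b = a then 1 else 0 := by
    intro a b
    rw [← hd b a]
    exact sum_coord_mul (T := φ b) ⟨map_add _, map_smul _⟩ (F a)
  have h2 : ∑ j, G i j * (1 / 2 * ∑ a, F a j * F a k) =
      ∑ b, ∑ a, φ b (stdVec i) * F a k * ∑ j, F a j * φ b (stdVec j) := by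
    simp only [hG, Finset.mul_sum, Finset.sum_mul]
    rw [Finset.sum_comm]
    have : ∀ b : ι, ∑ a : ι, ∑ j : Fin 4, φ b (stdVec i) * F a k * (F a j * φ b (stdVec j)) =
        ∑ j : Fin 4, ∑ a : ι, φ b (stdVec i) * F a k * (F a j * φ b (stdVec j)) :=
      fun b => Finset.sum_comm
    rw [Finset.sum_comm]
    simp only [this]
    conv_rhs => rw [Finset.sum_comm]
    refine Finset.sum_congr rfl fun j _ => ?_
    rw [Finset.sum_comm]
    refine Finset.sum_congr rfl fun b _ => Finset.sum_congr rfl fun a _ => by ring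
  simp only [Matrix.of_apply, h2, h1]
  have h3 := congrArg (fun v : E4 => v k) (hc (stdVec i))
  simp only [mul_ite, mul_one, mul_zero, Finset.sum_ite_eq, Finset.mem_univ, if_true]
  have h4 : ∑ b, φ b (stdVec i) * F b k = (stdVec i : E4) k := by
    rw [← h3]; simp
  rw [h4]
  simp [stdVec, Matrix.one_apply, eq_comm]

/-- The derivative of the metric `2 Σ φ_a ⊗ φ_a`. -/
def metricDeriv (φ : ι → E4 → E4 →L[ℝ] ℝ) (p u v w : E4) : ℝ :=
  2 * ∑ a, (fderiv ℝ (φ a) p u v * φ a p w + φ a p v * fderiv ℝ (φ a) p u w)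

omit [DecidableEq ι] in
theorem metricDeriv_isLinearMap (φ : ι → E4 → E4 →L[ℝ] ℝ) (p a b : E4) :
    IsLinearMap ℝ (fun u => metricDeriv φ p u a b) ∧ IsLinearMap ℝ (fun u => metricDeriv φ p a u b) ∧
      IsLinearMap ℝ (fun u => metricDeriv φ p a b u) := by
  refine ⟨⟨fun u v => ?_, fun c u => ?_⟩, ⟨fun u v => ?_, fun c u => ?_⟩,
    ⟨fun u v => ?_, fun c u => ?_⟩⟩ <;>
  · simp only [metricDeriv, map_add, map_smul, add_apply, smul_apply, smul_eq_mul, Finset.mul_sum,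
      ← Finset.sum_add_distrib]
    exact Finset.sum_congr rfl fun i _ => by ring

omit [DecidableEq ι] in
theorem fderiv_metricMatrix {g : ContMDiffRiemannianMetric (𝓡 4) ∞ E4
      (fun x : M => TangentSpace (𝓡 4) x)} {x : M} {φ : ι → E4 → E4 →L[ℝ] ℝ} {p : E4}
    (hφ : ∀ a, DifferentiableAt ℝ (φ a) p)
    (hG : ∀ᶠ z in 𝓝 p, ∀ i j, metricMatrix g x z i j =
      2 * ∑ a, φ a z (stdVec i) * φ a z (stdVec j)) (i j : Fin 4) (u : E4) :
    fderiv ℝ (fun z => metricMatrix g x z i j) p u =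
      metricDeriv φ p u (stdVec i) (stdVec j) := by
  have h1 : (fun z => metricMatrix g x z i j) =ᶠ[𝓝 p]
      fun z => 2 * ∑ a, φ a z (stdVec i) * φ a z (stdVec j) := hG.mono fun z hz => hz i j
  have hs : ∀ a w, HasFDerivAt (fun z => φ a z w) ((fderiv ℝ (φ a) p).flip w) p := by
    intro a w
    have h2 := ((hφ a).clm_apply (differentiableAt_const w)).hasFDerivAt
    have h3 : fderiv ℝ (fun z => φ a z w) p = (fderiv ℝ (φ a) p).flip w := by
      rw [fderiv_clm_apply (hφ a) (differentiableAt_const w)]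
      ext b
      simp
    rwa [h3] at h2
  have h4 := (HasFDerivAt.fun_sum (u := Finset.univ) fun a _ =>
    (hs a (stdVec i)).mul (hs a (stdVec j))).const_mul 2
  rw [h1.fderiv_eq]
  refine (congrArg (fun L => L u) h4.fderiv).trans ?_
  simp only [metricDeriv, smul_apply, sum_apply, add_apply, ContinuousLinearMap.flip_apply,
    smul_eq_mul]
  congr 1
  exact Finset.sum_congr rfl fun a _ => by ring

/-- The Laplacian of a metric `2 Σ φ_a ⊗ φ_a` in terms of the frame `F` at `p` dual to `φ`. Only the
derivatives of the coframe enter, so that `F` is needed at the point only. -/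
theorem laplacian_frame {g : ContMDiffRiemannianMetric (𝓡 4) ∞ E4
      (fun x : M => TangentSpace (𝓡 4) x)} {x : M} {φ : ι → E4 → E4 →L[ℝ] ℝ} {F : ι → E4}
    {p : E4} (hp : p = extChartAt (𝓡 4) x x)
    (hφ : ∀ a, DifferentiableAt ℝ (φ a) p)
    (hG : ∀ᶠ z in 𝓝 p, ∀ i j, metricMatrix g x z i j =
      2 * ∑ a, φ a z (stdVec i) * φ a z (stdVec j))
    (hd : ∀ a b, φ a p (F b) = if a = b then 1 else 0) (hc : ∀ v, ∑ a, φ a p v • F a = v)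
    {h : M → ℝ} {H : E4 → ℝ} (hH : H = fun z => h ((extChartAt (𝓡 4) x).symm z))
    (hHs : ContDiffAt ℝ ∞ H p) :
    laplacian g h x = 1 / 2 * ∑ a, fderiv ℝ (fderiv ℝ H) p (F a) (F a)
      - 1 / 2 * ∑ b, fderiv ℝ H p (F b) * ∑ a, (fderiv ℝ (φ b) p (F a) (F a)
        + fderiv ℝ (φ a) p (F a) (F b) - fderiv ℝ (φ a) p (F b) (F a)) := by
  have hinv := inv_of_frame (G := metricMatrix g x p) hG.self_of_nhds hd hc
  have hdH : DifferentiableAt ℝ (fderiv ℝ H) p := (contDiffAt_fderiv hHs).diffAt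
  have h2 : ∀ u v, fderiv ℝ (fun z => fderiv ℝ H z v) p u = fderiv ℝ (fderiv ℝ H) p u v := by
    intro u v
    rw [fderiv_clm_apply hdH (differentiableAt_const v)]
    simp
  have hm1 := fun a b => (metricDeriv_isLinearMap φ p a b).1
  have hm2 := fun a b => (metricDeriv_isLinearMap φ p a b).2.1
  have hm3 := fun a b => (metricDeriv_isLinearMap φ p a b).2.2
  have hchr : ∀ i j, ∑ k, christoffel g x p k i j * fderiv ℝ H p (stdVec k) =
      1 / 4 * ∑ b, fderiv ℝ H p (F b) * (metricDeriv φ p (stdVec i) (stdVec j) (F b)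
        + metricDeriv φ p (stdVec j) (stdVec i) (F b)
        - metricDeriv φ p (F b) (stdVec i) (stdVec j)) := by
    intro i j
    have hT := sum_sum_contraction (T := fun u w => fderiv ℝ H p u *
      (metricDeriv φ p (stdVec i) (stdVec j) w + metricDeriv φ p (stdVec j) (stdVec i) w
        - metricDeriv φ p w (stdVec i) (stdVec j))) ?_ ?_ F
    · simp only [christoffel, fderiv_metricMatrix hφ hG, hinv, Matrix.of_apply]
      rw [show (1 / 4 : ℝ) = 1 / 2 * (1 / 2) by norm_num, mul_assoc, ← hT, Finset.mul_sum]
      refine Finset.sum_congr rfl fun k _ => ?_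
      rw [Finset.mul_sum, Finset.mul_sum, Finset.sum_mul]
      exact Finset.sum_congr rfl fun l _ => by ring
    · intro w
      constructor
      · intro a b; simp only [map_add]; ring
      · intro c a; simp only [map_smul, smul_eq_mul]; ring
    · intro v
      constructor
      · intro a b
        simp only [(hm1 _ _).map_add, (hm3 _ _).map_add]
        ring
      · intro c a
        simp only [(hm1 _ _).map_smul, (hm3 _ _).map_smul, smul_eq_mul]
        ring
  have hlap : laplacian g h x = ∑ i, ∑ j, (1 / 2 * ∑ a, F a i * F a j) *
      (fderiv ℝ (fderiv ℝ H) p (stdVec i) (stdVec j) -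
        1 / 4 * ∑ b, fderiv ℝ H p (F b) * (metricDeriv φ p (stdVec i) (stdVec j) (F b)
        + metricDeriv φ p (stdVec j) (stdVec i) (F b)
        - metricDeriv φ p (F b) (stdVec i) (stdVec j))) := by
    simp only [laplacian, ← hp, ← hH, h2, hchr, hinv, Matrix.of_apply]
  have hT2 := sum_sum_contraction (T := fun u v => fderiv ℝ (fderiv ℝ H) p u v -
        1 / 4 * ∑ b, fderiv ℝ H p (F b) * (metricDeriv φ p u v (F b)
        + metricDeriv φ p v u (F b) - metricDeriv φ p (F b) u v)) ?_ ?_ F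
  · rw [hlap, hT2, Finset.sum_sub_distrib, mul_sub]
    congr 1
    have h5 : ∀ a b, metricDeriv φ p (F a) (F a) (F b) =
        2 * (fderiv ℝ (φ b) p (F a) (F a) + fderiv ℝ (φ a) p (F a) (F b)) := by
      intro a b
      simp [metricDeriv, hd, Finset.sum_add_distrib]
    have h6 : ∀ a b, metricDeriv φ p (F b) (F a) (F a) = 4 * fderiv ℝ (φ a) p (F b) (F a) := by
      intro a b
      simp [metricDeriv, hd, Finset.sum_add_distrib]
      ring
    simp only [h5, h6, Finset.mul_sum]
    rw [Finset.sum_comm]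
    refine Finset.sum_congr rfl fun b _ => Finset.sum_congr rfl fun a _ => by ring
  · intro w
    constructor
    · intro u v
      simp only [map_add, add_apply, (hm1 _ _).map_add, (hm2 _ _).map_add,
        mul_add, mul_sub, Finset.sum_add_distrib, Finset.sum_sub_distrib]
      ring
    · intro c u
      simp only [map_smul, smul_apply, (hm1 _ _).map_smul, (hm2 _ _).map_smul,
        smul_eq_mul, mul_left_comm _ c, mul_add, mul_sub, Finset.sum_add_distrib,
        Finset.sum_sub_distrib, ← Finset.mul_sum]
  · intro w
    constructor
    · intro u v
      simp only [map_add, (hm1 _ _).map_add, (hm2 _ _).map_add, (hm3 _ _).map_add,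
        mul_add, mul_sub, Finset.sum_add_distrib, Finset.sum_sub_distrib]
      ring
    · intro c u
      simp only [map_smul, (hm1 _ _).map_smul, (hm2 _ _).map_smul, (hm3 _ _).map_smul,
        smul_eq_mul, mul_left_comm _ c, mul_add, mul_sub, Finset.sum_add_distrib,
        Finset.sum_sub_distrib, ← Finset.mul_sum]

end FrameLaplacian

/-! ### The Laplacian as the trace of `d ∂` -/

section TypeComponents

variable {E : Type*} [NormedAddCommGroup E] [NormedSpace ℝ E]

/-- The value of (the complex linear extension of) `α` at `(v - s v') / 2`. -/
def evalOne (s : ℂ) (α : E → ℂ) (v v' : E) : ℂ := (1 / 2) * (α v - s * α v')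

/-- The value of (the complex bilinear extension of) `β` at `((v - s v') / 2, (w - t w') / 2)`. -/
def evalTwo (s t : ℂ) (β : E → E → ℂ) (v v' w w' : E) : ℂ :=
  (1 / 4) * (β v w - t * β v w' - s * β v' w + s * t * β v' w')

/-- The value of (the complex bilinear extension of) `β` at `(e_k, conj e_l)`, where
`e_k = (X_k - i Y_k) / 2`. -/
def eval11 (X Y : Fin 2 → E) (β : E → E → ℂ) (k l : Fin 2) : ℂ :=
  evalTwo Complex.I (-Complex.I) β (X k) (Y k) (X l) (Y l)

theorem extOne_self (α : E → E →L[ℝ] ℂ) (z v : E) : extOne α z v v = 0 := sub_self _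

theorem extOne_swap (α : E → E →L[ℝ] ℂ) (z v w : E) : extOne α z v w = -extOne α z w v := by
  simp only [extOne]; ring

theorem eval11_diag (X Y : Fin 2 → E) (α : E → E →L[ℝ] ℂ) (z : E) (k : Fin 2) :
    eval11 X Y (extOne α z) k k = Complex.I / 2 * extOne α z (X k) (Y k) := by
  rw [eval11, evalTwo, extOne_self, extOne_self, extOne_swap α z (Y k)]
  ring

/-- A one-form of type (1,0) in terms of the coframe. -/
theorem oneForm_eq_sum {θ : Fin 2 → E →L[ℝ] ℂ} {X Y : Fin 2 → E}
    (hc : ∀ v, v = ∑ k, ((θ k v).re • X k + (θ k v).im • Y k)) {η : E →L[ℝ] ℂ}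
    (hη : ∀ k, η (Y k) = Complex.I * η (X k)) (v : E) :
    η v = ∑ k, η (X k) * θ k v := by
  conv_lhs => rw [hc v]
  simp only [map_sum, map_add, map_smul, hη, Complex.real_smul]
  refine Finset.sum_congr rfl fun k _ => ?_
  conv_rhs => rw [← Complex.re_add_im (θ k v)]
  ring

theorem fderiv_re_comp {θ : E → E →L[ℝ] ℂ} {p : E} (h : DifferentiableAt ℝ θ p) :
    DifferentiableAt ℝ (fun z => Complex.reCLM.comp (θ z)) p ∧
    ∀ u v, fderiv ℝ (fun z => Complex.reCLM.comp (θ z)) p u v = (fderiv ℝ θ p u v).re := by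
  have hd : DifferentiableAt ℝ (fun z => Complex.reCLM.comp (θ z)) p :=
    (differentiableAt_const _).clm_comp h
  refine ⟨hd, fun u v => ?_⟩
  rw [fderiv_clm_comp (differentiableAt_const _) h]
  simp

theorem fderiv_im_comp {θ : E → E →L[ℝ] ℂ} {p : E} (h : DifferentiableAt ℝ θ p) :
    DifferentiableAt ℝ (fun z => Complex.imCLM.comp (θ z)) p ∧
    ∀ u v, fderiv ℝ (fun z => Complex.imCLM.comp (θ z)) p u v = (fderiv ℝ θ p u v).im := by
  have hd : DifferentiableAt ℝ (fun z => Complex.imCLM.comp (θ z)) p :=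
    (differentiableAt_const _).clm_comp h
  refine ⟨hd, fun u v => ?_⟩
  rw [fderiv_clm_comp (differentiableAt_const _) h]
  simp

variable {p : E} {θ : Fin 2 → E → E →L[ℝ] ℂ} {X Y : Fin 2 → E → E}

/-- The exterior derivative of a (1,0) form `Σ h_k θ^k`. -/
theorem UnitaryGerm.extOne_of_type (G : UnitaryGerm p θ X Y) {η : E → E →L[ℝ] ℂ}
    (hη : ContDiffAt ℝ ∞ η p)
    (hty : ∀ᶠ z in 𝓝 p, ∀ k, η z (Y k z) = Complex.I * η z (X k z)) (v w : E) :
    extOne η p v w = ∑ k, (fderiv ℝ (fun z => η z (X k z)) p v * θ k p w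
      - fderiv ℝ (fun z => η z (X k z)) p w * θ k p v + η p (X k p) * extOne (θ k) p v w) := by
  have h1 : η =ᶠ[𝓝 p] fun z => η z (X 0 z) • θ 0 z + η z (X 1 z) • θ 1 z := by
    filter_upwards [G.complete, hty] with z hc hz
    ext v
    rw [oneForm_eq_sum hc hz v]
    simp [Fin.sum_univ_two]
  have hh : ∀ k, DifferentiableAt ℝ (fun z => η z (X k z)) p :=
    fun k => hη.diffAt.clm_apply (G.smooth_X k).diffAt
  rw [extOne_congr h1, extOne_add ((hh 0).fun_smul (G.smooth 0).diffAt)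
    ((hh 1).fun_smul (G.smooth 1).diffAt), extOne_smul (hh 0) (G.smooth 0).diffAt,
    extOne_smul (hh 1) (G.smooth 1).diffAt, Fin.sum_univ_two]

/-- The Hessian, in linear coordinates, of a function whose differential is `η + conj η`. -/
theorem UnitaryGerm.fderiv_fderiv_of_type (G : UnitaryGerm p θ X Y) {η : E → E →L[ℝ] ℂ}
    (hη : ContDiffAt ℝ ∞ η p)
    (hty : ∀ᶠ z in 𝓝 p, ∀ k, η z (Y k z) = Complex.I * η z (X k z)) {H : E → ℝ}
    (hH : ContDiffAt ℝ ∞ H p)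
    (hdec : ∀ᶠ z in 𝓝 p, ∀ v, (fderiv ℝ H z v : ℂ) = η z v + conj (η z v)) (v w : E) :
    fderiv ℝ (fderiv ℝ H) p v w = ∑ k, 2 * (fderiv ℝ (fun z => η z (X k z)) p v * θ k p w
      + η p (X k p) * fderiv ℝ (θ k) p v w).re := by
  have hh : ∀ k, DifferentiableAt ℝ (fun z => η z (X k z)) p :=
    fun k => hη.diffAt.clm_apply (G.smooth_X k).diffAt
  have h1 : (fun z => fderiv ℝ H z w) =ᶠ[𝓝 p] fun z =>
      2 * Complex.reCLM (η z (X 0 z) * θ 0 z w + η z (X 1 z) * θ 1 z w) := by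
    filter_upwards [G.complete, hty, hdec] with z hc hz hd
    have h2 := congrArg Complex.re (hd w)
    rw [oneForm_eq_sum hc hz w] at h2
    simp only [Fin.sum_univ_two, Complex.ofReal_re, Complex.add_re, Complex.conj_re] at h2
    rw [h2, Complex.reCLM_apply, Complex.add_re]
    ring
  have hdH : DifferentiableAt ℝ (fderiv ℝ H) p := (contDiffAt_fderiv hH).diffAt
  have h3 : fderiv ℝ (fun z => fderiv ℝ H z w) p v = fderiv ℝ (fderiv ℝ H) p v w := by
    rw [fderiv_clm_apply hdH (differentiableAt_const w)]
    simp
  have ht : ∀ k, DifferentiableAt ℝ (fun z => θ k z w) p :=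
    fun k => (G.smooth k).diffAt.clm_apply (differentiableAt_const w)
  have h4 := (Complex.reCLM.hasFDerivAt.comp p
    (((hh 0).hasFDerivAt.mul (ht 0).hasFDerivAt).add
      ((hh 1).hasFDerivAt.mul (ht 1).hasFDerivAt))).const_mul 2
  rw [← h3, h1.fderiv_eq]
  refine (congrArg (fun L => L v) h4.fderiv).trans ?_
  simp only [smul_apply, ContinuousLinearMap.comp_apply, add_apply, smul_eq_mul,
    fderiv_oneForm_apply (G.smooth _).diffAt, Complex.reCLM_apply, Fin.sum_univ_two,
    Complex.add_re, Complex.mul_re]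
  ring

/-- The exterior derivative of the (1,0) part of an exact real one-form is imaginary. -/
theorem extOne_re_eq_zero {η : E → E →L[ℝ] ℂ} (hη : ContDiffAt ℝ ∞ η p) {H : E → ℝ}
    (hH : ContDiffAt ℝ ∞ H p)
    (hdec : ∀ᶠ z in 𝓝 p, ∀ v, (fderiv ℝ H z v : ℂ) = η z v + conj (η z v)) (v w : E) :
    (extOne η p v w).re = 0 := by
  have h1 : fderiv ℝ H =ᶠ[𝓝 p] fun z => (2 : ℝ) • Complex.reCLM.comp (η z) := by
    filter_upwards [hdec] with z hd
    ext v
    have h2 := congrArg Complex.re (hd v)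
    simp at h2
    simp [h2]
    ring
  have h2 := fderiv_re_comp hη.diffAt
  have h3 : ∀ v w, fderiv ℝ (fderiv ℝ H) p v w = 2 * (fderiv ℝ η p v w).re := by
    intro v w
    rw [h1.fderiv_eq, fderiv_fun_const_smul h2.1]
    simp [h2.2]
  have h4 : fderiv ℝ (fderiv ℝ H) p v w = fderiv ℝ (fderiv ℝ H) p w v :=
    hH.isSymmSndFDerivAt (by simp; exact WithTop.coe_le_coe.2 le_top) v w
  rw [h3, h3] at h4
  simp only [extOne, Complex.sub_re]
  linarith

end TypeComponents

section ManifoldLaplacian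

variable {M : Type*} [TopologicalSpace M] [ChartedSpace E4 M] [IsManifold (𝓡 4) ∞ M]
variable {J : AlmostComplexStructure M} {K : AlmostKahlerMetric J} {U : Set M}

namespace LocalUnitaryFrame

variable (e : LocalUnitaryFrame K U)

theorem metricMatrix_eq (x : M) {z : E4} (hz : (extChartAt (𝓡 4) x).symm z ∈ U) (i j : Fin 4) :
    metricMatrix K.g x z i j = ∑ k, 2 * ((e.chartθ x k z (stdVec i)).re *
      (e.chartθ x k z (stdVec j)).re + (e.chartθ x k z (stdVec i)).im *
      (e.chartθ x k z (stdVec j)).im) := by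
  have h := congrArg Complex.re
    (e.unitary _ hz (chartInvDeriv x z (stdVec i)) (chartInvDeriv x z (stdVec j)))
  rw [Complex.ofReal_re] at h
  refine h.trans ?_
  simp only [← chartθ_apply, Fin.sum_univ_two, Complex.add_re, Complex.mul_re, Complex.conj_re,
    Complex.conj_im]
  ring

/-- On functions, the Levi-Civita Laplacian of an almost Kähler metric is the trace of
`-2 d(∂h)`, where `∂h = η` is the (1,0) part of `dh`. -/
theorem laplacian_eq (hU : IsOpen U) {x : M} (hx : x ∈ U) {h : M → ℝ} {H : E4 → ℝ}
    (hHe : H = fun z => h ((extChartAt (𝓡 4) x).symm z))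
    (hH : ContDiffAt ℝ ∞ H (extChartAt (𝓡 4) x x)) {η : E4 → E4 →L[ℝ] ℂ}
    (hη : ContDiffAt ℝ ∞ η (extChartAt (𝓡 4) x x))
    (hty : ∀ᶠ z in 𝓝 (extChartAt (𝓡 4) x x), ∀ k,
      η z (e.chartY x k z) = Complex.I * η z (e.chartX x k z))
    (hdec : ∀ᶠ z in 𝓝 (extChartAt (𝓡 4) x x), ∀ v,
      (fderiv ℝ H z v : ℂ) = η z v + (starRingEnd ℂ) (η z v)) :
    (laplacian K.g h x : ℂ) = -2 * ∑ q, eval11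
      (fun k => e.chartX x k (extChartAt (𝓡 4) x x)) (fun k => e.chartY x k (extChartAt (𝓡 4) x x))
      (extOne η (extChartAt (𝓡 4) x x)) q q := by
  have G := e.unitaryGerm hU hx
  have hm := (chart_eventually_mem x hU hx).mono fun z hz => e.metricMatrix_eq x hz.2
  set p := extChartAt (𝓡 4) x x with hp
  set θ := e.chartθ x
  set X := e.chartX x
  set Y := e.chartY x
  have hX := G.dual_X.self_of_nhds
  have hY := G.dual_Y.self_of_nhds
  have hr := fun k => fderiv_re_comp (G.smooth k).diffAt
  have hi := fun k => fderiv_im_comp (G.smooth k).diffAt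
  have key := laplacian_frame (g := K.g) (x := x) (p := p) hp
    (φ := ![fun z => Complex.reCLM.comp (θ 0 z), fun z => Complex.imCLM.comp (θ 0 z),
      fun z => Complex.reCLM.comp (θ 1 z), fun z => Complex.imCLM.comp (θ 1 z)])
    (F := ![X 0 p, Y 0 p, X 1 p, Y 1 p]) ?_ ?_ ?_ ?_ hHe hH
  · have hdH : ∀ k, fderiv ℝ H p (X k p) = 2 * (η p (X k p)).re ∧
        fderiv ℝ H p (Y k p) = -2 * (η p (X k p)).im := by
      intro k
      have h1 := congrArg Complex.re (hdec.self_of_nhds (X k p))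
      have h2 := congrArg Complex.re (hdec.self_of_nhds (Y k p))
      rw [hty.self_of_nhds k] at h2
      simp at h1 h2
      constructor <;> linarith
    have hc0 := fun u v w => congrArg Complex.im (G.closed.self_of_nhds u v w)
    apply Complex.ext
    · simp only [eval11_diag, G.extOne_of_type hη hty]
      simp only [Fin.sum_univ_four, Matrix.cons_val_zero, Matrix.cons_val_one, Matrix.cons_val] at key
      rw [Complex.ofReal_re, key]
      simp only [(hr _).2, (hi _).2, G.fderiv_fderiv_of_type hη hty hH hdec, (hdH _).1, (hdH _).2,
        hX, hY, Fin.sum_univ_two]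
      have c1 := hc0 (X 0 p) (Y 0 p) (X 1 p)
      have c2 := hc0 (X 0 p) (Y 0 p) (Y 1 p)
      have c3 := hc0 (X 1 p) (Y 1 p) (X 0 p)
      have c4 := hc0 (X 1 p) (Y 1 p) (Y 0 p)
      simp [Fin.sum_univ_two, hX, hY, extOne] at c1 c2 c3 c4 ⊢
      linear_combination -(η p (X 1 p)).re / 2 * c1 + (η p (X 1 p)).im / 2 * c2
        - (η p (X 0 p)).re / 2 * c3 + (η p (X 0 p)).im / 2 * c4
    · rw [Complex.ofReal_im]
      have h1 := extOne_re_eq_zero hη hH hdec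
      simp [eval11_diag, h1]
  · intro a
    fin_cases a
    exacts [(hr 0).1, (hi 0).1, (hr 1).1, (hi 1).1]
  · filter_upwards [hm] with z hz i j
    rw [hz]
    simp [Fin.sum_univ_four, Fin.sum_univ_two]
    ring
  · intro a b
    fin_cases a <;> fin_cases b <;> simp [hX, hY]
  · intro v
    conv_rhs => rw [G.complete.self_of_nhds v]
    simp [Fin.sum_univ_four, Fin.sum_univ_two]
    abel

end LocalUnitaryFrame

end ManifoldLaplacian

/-! ### Components of alternating forms -/

section Evaluation

variable {E : Type*}

/-- The value of (the complex trilinear extension of) `T` at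
`((u - s u') / 2, (v - t v') / 2, (w - r w') / 2)`. -/
def evalThree (s t r : ℂ) (T : E → E → E → ℂ) (u u' v v' w w' : E) : ℂ :=
  (1 / 2) * (evalTwo s t (fun a b => T a b w) u u' v v'
    - r * evalTwo s t (fun a b => T a b w') u u' v v')

theorem evalTwo_add (s t : ℂ) (β γ : E → E → ℂ) (v v' w w' : E) :
    evalTwo s t (fun a b => β a b + γ a b) v v' w w' =
      evalTwo s t β v v' w w' + evalTwo s t γ v v' w w' := by
  simp only [evalTwo]; ring

theorem evalTwo_sub (s t : ℂ) (β γ : E → E → ℂ) (v v' w w' : E) :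
    evalTwo s t (fun a b => β a b - γ a b) v v' w w' =
      evalTwo s t β v v' w w' - evalTwo s t γ v v' w w' := by
  simp only [evalTwo]; ring

theorem evalTwo_mul (s t c : ℂ) (β : E → E → ℂ) (v v' w w' : E) :
    evalTwo s t (fun a b => c * β a b) v v' w w' = c * evalTwo s t β v v' w w' := by
  simp only [evalTwo]; ring

theorem evalTwo_sum {ι : Type*} (S : Finset ι) (s t : ℂ) (β : ι → E → E → ℂ) (v v' w w' : E) :
    evalTwo s t (fun a b => ∑ i ∈ S, β i a b) v v' w w' =
      ∑ i ∈ S, evalTwo s t (β i) v v' w w' := by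
  simp only [evalTwo, Finset.mul_sum, ← Finset.sum_sub_distrib, ← Finset.sum_add_distrib]

theorem evalTwo_wedge (s t : ℂ) (α α' : E → ℂ) (v v' w w' : E) :
    evalTwo s t (fun a b => α a * α' b - α b * α' a) v v' w w' =
      evalOne s α v v' * evalOne t α' w w' - evalOne t α w w' * evalOne s α' v v' := by
  simp only [evalTwo, evalOne]; ring

theorem evalOne_conj (s : ℂ) (α : E → ℂ) (v v' : E) :
    evalOne s (fun a => conj (α a)) v v' = conj (evalOne (conj s) α v v') := by
  simp [evalOne, Complex.conj_ofNat]

theorem evalTwo_conj (s t : ℂ) (β : E → E → ℂ) (v v' w w' : E) :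
    evalTwo s t (fun a b => conj (β a b)) v v' w w' =
      conj (evalTwo (conj s) (conj t) β v v' w w') := by
  simp [evalTwo, Complex.conj_ofNat]

theorem evalThree_add (s t r : ℂ) (T S : E → E → E → ℂ) (u u' v v' w w' : E) :
    evalThree s t r (fun a b c => T a b c + S a b c) u u' v v' w w' =
      evalThree s t r T u u' v v' w w' + evalThree s t r S u u' v v' w w' := by
  simp only [evalThree, evalTwo]; ring

theorem evalThree_sub (s t r : ℂ) (T S : E → E → E → ℂ) (u u' v v' w w' : E) :
    evalThree s t r (fun a b c => T a b c - S a b c) u u' v v' w w' =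
      evalThree s t r T u u' v v' w w' - evalThree s t r S u u' v v' w w' := by
  simp only [evalThree, evalTwo]; ring

theorem evalThree_mul (s t r c : ℂ) (T : E → E → E → ℂ) (u u' v v' w w' : E) :
    evalThree s t r (fun a b d => c * T a b d) u u' v v' w w' =
      c * evalThree s t r T u u' v v' w w' := by
  simp only [evalThree, evalTwo]; ring

theorem evalThree_sum {ι : Type*} (S : Finset ι) (s t r : ℂ) (T : ι → E → E → E → ℂ)
    (u u' v v' w w' : E) :
    evalThree s t r (fun a b c => ∑ i ∈ S, T i a b c) u u' v v' w w' =
      ∑ i ∈ S, evalThree s t r (T i) u u' v v' w w' := by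
  simp only [evalThree, evalTwo_sum, Finset.mul_sum, ← Finset.sum_sub_distrib]

end Evaluation

section AlternatingForms

variable {E : Type*} [NormedAddCommGroup E] [NormedSpace ℝ E]

/-- The value of (the complex bilinear extension of) `β` at `(conj e_k, conj e_l)`. -/
def eval02 (X Y : Fin 2 → E) (β : E → E → ℂ) (k l : Fin 2) : ℂ :=
  evalTwo (-Complex.I) (-Complex.I) β (X k) (Y k) (X l) (Y l)

/-- The value of (the complex bilinear extension of) `β` at `(e_k, e_l)`. -/
def eval20 (X Y : Fin 2 → E) (β : E → E → ℂ) (k l : Fin 2) : ℂ :=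
  evalTwo Complex.I Complex.I β (X k) (Y k) (X l) (Y l)

/-- Alternating real-bilinear complex-valued forms. -/
structure IsAltForm (β : E → E → ℂ) : Prop where
  add_left : ∀ u v w, β (u + v) w = β u w + β v w
  smul_left : ∀ (c : ℝ) v w, β (c • v) w = c * β v w
  swap : ∀ v w, β v w = -β w v

namespace IsAltForm

variable {β γ : E → E → ℂ}

theorem self (h : IsAltForm β) (v : E) : β v v = 0 := by
  linear_combination (1 / 2) * h.swap v v

theorem add_right (h : IsAltForm β) (u v w : E) : β w (u + v) = β w u + β w v := by
  rw [h.swap, h.add_left, h.swap w u, h.swap w v]; ring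

theorem smul_right (h : IsAltForm β) (c : ℝ) (v w : E) : β w (c • v) = c * β w v := by
  rw [h.swap, h.smul_left, h.swap w v]; ring

theorem add (h : IsAltForm β) (h' : IsAltForm γ) : IsAltForm fun v w => β v w + γ v w where
  add_left u v w := by rw [h.add_left, h'.add_left]; ring
  smul_left c v w := by rw [h.smul_left, h'.smul_left]; ring
  swap v w := by rw [h.swap, h'.swap]; ring

theorem const_mul (h : IsAltForm β) (c : ℂ) : IsAltForm fun v w => c * β v w where
  add_left u v w := by rw [h.add_left]; ring
  smul_left a v w := by rw [h.smul_left]; ring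
  swap v w := by rw [h.swap]; ring

theorem sum {ι : Type*} {s : Finset ι} {β : ι → E → E → ℂ} (h : ∀ i, IsAltForm (β i)) :
    IsAltForm fun v w => ∑ i ∈ s, β i v w where
  add_left u v w := by simp only [(h _).add_left, Finset.sum_add_distrib]
  smul_left a v w := by simp only [(h _).smul_left, Finset.mul_sum]
  swap v w := by
    rw [← Finset.sum_neg_distrib]
    exact Finset.sum_congr rfl fun i _ => (h i).swap v w

theorem wedge (α α' : E →L[ℝ] ℂ) : IsAltForm fun v w => α v * α' w - α w * α' v where
  add_left u v w := by simp only [map_add]; ring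
  smul_left a v w := by simp only [map_smul, Complex.real_smul]; ring
  swap v w := by ring

theorem wedge_conj (α α' : E →L[ℝ] ℂ) :
    IsAltForm fun v w => conj (α v) * conj (α' w) - conj (α w) * conj (α' v) where
  add_left u v w := by simp only [map_add]; ring
  smul_left a v w := by simp only [map_smul, Complex.real_smul, map_mul, Complex.conj_ofReal]; ring
  swap v w := by ring

theorem extOne (α : E → E →L[ℝ] ℂ) (z : E) : IsAltForm (extOne α z) where
  add_left u v w := by simp only [_root_.extOne, map_add, add_apply]; ring
  smul_left a v w := by
    simp only [_root_.extOne, map_smul, smul_apply, Complex.real_smul]; ring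
  swap v w := extOne_swap α z v w

/-- An alternating form vanishes if its components of all types vanish. -/
theorem eq_zero (h : IsAltForm β) {θ : Fin 2 → E →L[ℝ] ℂ} {X Y : Fin 2 → E}
    (hc : ∀ v, v = ∑ k, ((θ k v).re • X k + (θ k v).im • Y k))
    (h20 : eval20 X Y β 0 1 = 0) (h02 : eval02 X Y β 0 1 = 0)
    (h11 : ∀ k l, eval11 X Y β k l = 0) (v w : E) : β v w = 0 := by
  have h1 := h11 0 0
  have h2 := h11 1 1
  have h3 := h11 0 1
  have h4 := h11 1 0
  simp only [eval20, eval02, eval11, evalTwo] at h20 h02 h1 h2 h3 h4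
  rw [h.self, h.self, h.swap (Y 0) (X 0)] at h1
  rw [h.self, h.self, h.swap (Y 1) (X 1)] at h2
  rw [h.swap (X 1) (X 0), h.swap (X 1) (Y 0), h.swap (Y 1) (X 0), h.swap (Y 1) (Y 0)] at h4
  have hI := Complex.I_mul_I
  have e1 : β (X 0) (Y 0) = 0 := by
    linear_combination (-2 * Complex.I) * h1 + β (X 0) (Y 0) * hI
  have e2 : β (X 1) (Y 1) = 0 := by
    linear_combination (-2 * Complex.I) * h2 + β (X 1) (Y 1) * hI
  have e3 : β (X 0) (X 1) = 0 := by
    linear_combination h20 + h02 + h3 - h4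
  have e4 : β (Y 0) (Y 1) = 0 := by
    linear_combination h3 - h4 - h20 - h02 + β (Y 0) (Y 1) * hI
  have e5 : β (X 0) (Y 1) = 0 := by
    linear_combination Complex.I * (h20 - h02 - h3 - h4) + β (X 0) (Y 1) * hI
  have e6 : β (Y 0) (X 1) = 0 := by
    linear_combination Complex.I * (h20 - h02 + h3 + h4) + β (Y 0) (X 1) * hI
  have e7 : β (Y 0) (X 0) = 0 := by rw [h.swap, e1, neg_zero]
  have e8 : β (Y 1) (X 1) = 0 := by rw [h.swap, e2, neg_zero]
  have e9 : β (X 1) (X 0) = 0 := by rw [h.swap, e3, neg_zero]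
  have e10 : β (Y 1) (Y 0) = 0 := by rw [h.swap, e4, neg_zero]
  have e11 : β (Y 1) (X 0) = 0 := by rw [h.swap, e5, neg_zero]
  have e12 : β (X 1) (Y 0) = 0 := by rw [h.swap, e6, neg_zero]
  rw [hc v, hc w]
  simp only [Fin.sum_univ_two, h.add_left, h.add_right, h.smul_left, h.smul_right, h.self, e1, e2,
    e3, e4, e5, e6, e7, e8, e9, e10, e11, e12]
  simp

end IsAltForm

theorem IsAltForm.evalTwo_swap {β : E → E → ℂ} (h : IsAltForm β) (s t : ℂ) (v v' w w' : E) :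
    evalTwo s t β v v' w w' = -evalTwo t s β w w' v v' := by
  simp only [evalTwo]
  rw [h.swap v w, h.swap v w', h.swap v' w, h.swap v' w']
  ring

/-- The value of the three-form `β ∧ α` on three vectors, in terms of the values of `β` and `α`. -/
theorem IsAltForm.evalThree_wedge {β : E → E → ℂ} (h : IsAltForm β) (s t r : ℂ) (α : E → ℂ)
    (u u' v v' w w' : E) :
    evalThree s t r (fun a b c => β a b * α c + β b c * α a + β c a * α b) u u' v v' w w' =
      evalTwo s t β u u' v v' * evalOne r α w w' + evalTwo t r β v v' w w' * evalOne s α u u'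
        - evalTwo s r β u u' w w' * evalOne t α v v' := by
  simp only [evalThree, evalTwo, evalOne]
  rw [h.swap w u, h.swap w u', h.swap w' u, h.swap w' u']
  ring

theorem evalOne_coframe {θ : Fin 2 → E →L[ℝ] ℂ} {X Y : Fin 2 → E}
    (hX : ∀ i j, θ i (X j) = if i = j then 1 else 0)
    (hY : ∀ i j, θ i (Y j) = if i = j then Complex.I else 0) (i j : Fin 2) :
    evalOne Complex.I (θ i) (X j) (Y j) = (if i = j then 1 else 0) ∧
      evalOne (-Complex.I) (θ i) (X j) (Y j) = 0 := by
  simp only [evalOne, hX, hY]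
  split_ifs
  · constructor
    · linear_combination (-1 / 2 : ℂ) * Complex.I_mul_I
    · linear_combination (1 / 2 : ℂ) * Complex.I_mul_I
  · simp

end AlternatingForms

/-! ### The second canonical connection -/

section GermConnection

variable {E : Type*} [NormedAddCommGroup E] [NormedSpace ℝ E]

/-- The connection forms of the second canonical connection in the coframe `θ`, that is,
`ϑ^i_j = dθ^i(e_j, conj e_l) conj θ^l - conj (dθ^j(e_i, conj e_l)) θ^l`. -/
def germConn (θ : Fin 2 → E → E →L[ℝ] ℂ) (X Y : Fin 2 → E → E) (i j : Fin 2) (z : E) :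
    E →L[ℝ] ℂ :=
  ∑ l, (eval11 (fun k => X k z) (fun k => Y k z) (extOne (θ i) z) j l •
      ((Complex.conjCLE : ℂ →L[ℝ] ℂ).comp (θ l z))
    - conj (eval11 (fun k => X k z) (fun k => Y k z) (extOne (θ j) z) i l) • θ l z)

/-- The torsion forms of the second canonical connection. -/
def germTorsion (θ : Fin 2 → E → E →L[ℝ] ℂ) (X Y : Fin 2 → E → E) (i : Fin 2) (z v w : E) : ℂ :=
  extOne (θ i) z v w + ∑ j, (germConn θ X Y i j z v * θ j z w - germConn θ X Y i j z w * θ j z v)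

/-- The coefficient of `conj θ^0 ∧ conj θ^1` in the torsion; it is `2 N^i` with lower indices `0`
and `1`, since the sum over both orders of the indices counts it twice. -/
def germN (θ : Fin 2 → E → E →L[ℝ] ℂ) (X Y : Fin 2 → E → E) (i : Fin 2) (z : E) : ℂ :=
  eval02 (fun k => X k z) (fun k => Y k z) (germTorsion θ X Y i z) 0 1

/-- The curvature `dϑ^i_j + ϑ^i_k ∧ ϑ^k_j` of the connection forms `ϑ`. -/
def germCurv (ϑ : Fin 2 → Fin 2 → E → E →L[ℝ] ℂ) (i j : Fin 2) (z v w : E) : ℂ :=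
  extOne (ϑ i j) z v w + ∑ k, (ϑ i k z v * ϑ k j z w - ϑ i k z w * ϑ k j z v)

variable {p : E} {θ : Fin 2 → E → E →L[ℝ] ℂ} {X Y : Fin 2 → E → E}

theorem germConn_apply (i j : Fin 2) (z v : E) : germConn θ X Y i j z v =
    ∑ l, (eval11 (fun k => X k z) (fun k => Y k z) (extOne (θ i) z) j l * conj (θ l z v)
    - conj (eval11 (fun k => X k z) (fun k => Y k z) (extOne (θ j) z) i l) * θ l z v) := by
  simp [germConn]

theorem germConn_skew (i j : Fin 2) (z v : E) :
    conj (germConn θ X Y i j z v) = -germConn θ X Y j i z v := by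
  simp only [germConn_apply, Fin.sum_univ_two, map_add, map_sub, map_mul, Complex.conj_conj]
  ring

theorem germConn_evalOne {z : E} (hX : ∀ i j, θ i z (X j z) = if i = j then 1 else 0)
    (hY : ∀ i j, θ i z (Y j z) = if i = j then Complex.I else 0) (i j l : Fin 2) :
    evalOne (-Complex.I) (germConn θ X Y i j z) (X l z) (Y l z) =
        eval11 (fun k => X k z) (fun k => Y k z) (extOne (θ i) z) j l ∧
      evalOne Complex.I (germConn θ X Y i j z) (X l z) (Y l z) =
        -conj (eval11 (fun k => X k z) (fun k => Y k z) (extOne (θ j) z) i l) := by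
  have h : ∀ s v v', evalOne s (germConn θ X Y i j z) v v' =
      ∑ l, (eval11 (fun k => X k z) (fun k => Y k z) (extOne (θ i) z) j l *
        conj (evalOne (conj s) (θ l z) v v')
      - conj (eval11 (fun k => X k z) (fun k => Y k z) (extOne (θ j) z) i l) *
        evalOne s (θ l z) v v') := by
    intro s v v'
    simp only [← evalOne_conj]
    simp only [evalOne, germConn_apply, Fin.sum_univ_two]
    ring
  have h1 := fun a b => (evalOne_coframe (X := fun k => X k z) (Y := fun k => Y k z) hX hY a b).1
  have h2 := fun a b => (evalOne_coframe (X := fun k => X k z) (Y := fun k => Y k z) hX hY a b).2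
  simp only [h, map_neg, Complex.conj_I, neg_neg, h1, h2, Fin.sum_univ_two]
  fin_cases l <;> simp

theorem isAltForm_germTorsion (i : Fin 2) (z : E) : IsAltForm (germTorsion θ X Y i z) :=
  (IsAltForm.extOne _ z).add (IsAltForm.sum fun _ => IsAltForm.wedge _ _)

theorem isAltForm_germCurv (ϑ : Fin 2 → Fin 2 → E → E →L[ℝ] ℂ) (i j : Fin 2) (z : E) :
    IsAltForm (germCurv ϑ i j z) :=
  (IsAltForm.extOne _ z).add (IsAltForm.sum fun _ => IsAltForm.wedge _ _)

/-- The (2,0) components of `dθ^l` are determined by the (1,1) components: this is the (2,1) part of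
the equation `d(i Σ θ^i ∧ conj θ^i) = 0`, and it makes the torsion of the second canonical
connection free of a (2,0) part. -/
theorem eval20_extOne {z : E} (hX : ∀ i j, θ i z (X j z) = if i = j then 1 else 0)
    (hY : ∀ i j, θ i z (Y j z) = if i = j then Complex.I else 0)
    (hcl : ∀ u v w, ∑ i,
    ((extOne (θ i) z u v * conj (θ i z w) - conj (extOne (θ i) z u v) * θ i z w)
    + (extOne (θ i) z v w * conj (θ i z u) - conj (extOne (θ i) z v w) * θ i z u)
    + (extOne (θ i) z w u * conj (θ i z v) - conj (extOne (θ i) z w u) * θ i z v)) = 0)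
    (l : Fin 2) :
    eval20 (fun k => X k z) (fun k => Y k z) (extOne (θ l) z) 0 1 =
      -conj (eval11 (fun k => X k z) (fun k => Y k z) (extOne (θ 0) z) l 1)
      + conj (eval11 (fun k => X k z) (fun k => Y k z) (extOne (θ 1) z) l 0) := by
  have h1 := fun a b => (evalOne_coframe (X := fun k => X k z) (Y := fun k => Y k z) hX hY a b).1
  have h2 := fun a b => (evalOne_coframe (X := fun k => X k z) (Y := fun k => Y k z) hX hY a b).2
  have hT : (fun u v w => ∑ i,
      ((extOne (θ i) z u v * conj (θ i z w) + extOne (θ i) z v w * conj (θ i z u)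
        + extOne (θ i) z w u * conj (θ i z v))
      - (conj (extOne (θ i) z u v) * θ i z w + conj (extOne (θ i) z v w) * θ i z u
        + conj (extOne (θ i) z w u) * θ i z v))) = fun _ _ _ => (0 : ℂ) := by
    ext u v w
    rw [← hcl u v w]
    exact Finset.sum_congr rfl fun i _ => by ring
  have hc : ∀ i, IsAltForm fun v w => conj (extOne (θ i) z v w) := fun i =>
    ⟨fun u v w => by rw [(IsAltForm.extOne (θ i) z).add_left, map_add],
      fun c v w => by rw [(IsAltForm.extOne (θ i) z).smul_left, map_mul, Complex.conj_ofReal],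
      fun v w => by rw [extOne_swap, map_neg]⟩
  have key := congrArg (fun T => evalThree Complex.I Complex.I (-Complex.I) T (X 0 z) (Y 0 z)
    (X 1 z) (Y 1 z) (X l z) (Y l z)) hT
  simp only [evalThree_sum, evalThree_sub,
    (IsAltForm.extOne (θ _) z).evalThree_wedge _ _ _ (fun a => conj (θ _ z a)),
    (hc _).evalThree_wedge, evalOne_conj, evalTwo_conj, map_neg, Complex.conj_I, neg_neg, h1, h2]
    at key
  have h0 : evalThree Complex.I Complex.I (-Complex.I) (fun _ _ _ => (0 : ℂ)) (X 0 z) (Y 0 z)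
    (X 1 z) (Y 1 z) (X l z) (Y l z) = 0 := by simp [evalThree, evalTwo]
  rw [h0] at key
  have hs := fun i => (IsAltForm.extOne (θ i) z).evalTwo_swap (-Complex.I) Complex.I
  simp only [eval20, eval11]
  simp only [hs] at key
  fin_cases l <;> simp at key ⊢ <;> linear_combination key

/-- The torsion of the second canonical connection of an almost Kähler metric is of
type (0,2). -/
theorem UnitaryGerm.torsion (G : UnitaryGerm p θ X Y) : ∀ᶠ z in 𝓝 p, ∀ i v w,
    germTorsion θ X Y i z v w = germN θ X Y i z *
      (conj (θ 0 z v) * conj (θ 1 z w) - conj (θ 0 z w) * conj (θ 1 z v)) := by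
  filter_upwards [G.dual_X, G.dual_Y, G.complete, G.closed] with z hX hY hc hcl i v w
  have h1 := fun a b => (evalOne_coframe (X := fun k => X k z) (Y := fun k => Y k z) hX hY a b).1
  have h2 := fun a b => (evalOne_coframe (X := fun k => X k z) (Y := fun k => Y k z) hX hY a b).2
  have h3 := fun i j l => (germConn_evalOne (θ := θ) hX hY i j l).1
  have h4 := fun i j l => (germConn_evalOne (θ := θ) hX hY i j l).2
  have hw : ∀ s t v v' w w', evalTwo s t (fun a b => conj (θ 0 z a) * conj (θ 1 z b)
      - conj (θ 0 z b) * conj (θ 1 z a)) v v' w w' =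
      conj (evalOne (conj s) (θ 0 z) v v') * conj (evalOne (conj t) (θ 1 z) w w') -
      conj (evalOne (conj t) (θ 0 z) w w') * conj (evalOne (conj s) (θ 1 z) v v') := by
    intro s t v v' w w'
    rw [evalTwo_wedge s t (fun a => conj (θ 0 z a)) (fun a => conj (θ 1 z a))]
    simp only [evalOne_conj]
  have ht : ∀ s t v v' w w', evalTwo s t (germTorsion θ X Y i z) v v' w w' =
      evalTwo s t (extOne (θ i) z) v v' w w' + ∑ j,
        (evalOne s (germConn θ X Y i j z) v v' * evalOne t (θ j z) w w'
        - evalOne t (germConn θ X Y i j z) w w' * evalOne s (θ j z) v v') := by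
    intro s t v v' w w'
    simp only [← evalTwo_wedge, ← evalTwo_sum, ← evalTwo_add]
    rfl
  have hz := IsAltForm.eq_zero (β := fun v w => germTorsion θ X Y i z v w +
      -germN θ X Y i z * (conj (θ 0 z v) * conj (θ 1 z w) - conj (θ 0 z w) * conj (θ 1 z v)))
    ((isAltForm_germTorsion i z).add ((IsAltForm.wedge_conj _ _).const_mul _)) hc ?_ ?_ ?_ v w
  · linear_combination hz
  · simp only [eval20, evalTwo_add, evalTwo_mul, hw, Complex.conj_I, h1, h2, ht, h4]
    have := eval20_extOne hX hY hcl i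
    simp only [eval20] at this
    rw [this]
    simp
  · simp only [eval02, evalTwo_add, evalTwo_mul, hw, Complex.conj_I, map_neg, neg_neg, h1]
    simp [germN, eval02]
  · intro k l
    simp only [eval11, evalTwo_add, evalTwo_mul, hw, Complex.conj_I, map_neg, neg_neg, h1, h2, ht,
      h3, h4]
    fin_cases k <;> simp

theorem UnitaryGerm.smooth_eval (G : UnitaryGerm p θ X Y) (s t : ℂ) (i k l : Fin 2) :
    ContDiffAt ℝ ∞ (fun z => evalTwo s t (extOne (θ i) z) (X k z) (Y k z) (X l z) (Y l z)) p := by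
  have hf := contDiffAt_fderiv (G.smooth i)
  have h : ∀ {V W : E → E}, ContDiffAt ℝ ∞ V p → ContDiffAt ℝ ∞ W p →
      ContDiffAt ℝ ∞ (fun z => extOne (θ i) z (V z) (W z)) p := fun hV hW =>
    ((hf.clm_apply hV).clm_apply hW).sub ((hf.clm_apply hW).clm_apply hV)
  have hX := G.smooth_X
  have hY := G.smooth_Y
  exact contDiffAt_const.mul ((((h (hX k) (hX l)).sub (contDiffAt_const.mul (h (hX k) (hY l)))).sub
    (contDiffAt_const.mul (h (hY k) (hX l)))).add (contDiffAt_const.mul (h (hY k) (hY l))))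

theorem UnitaryGerm.smooth_germConn (G : UnitaryGerm p θ X Y) (i j : Fin 2) :
    ContDiffAt ℝ ∞ (germConn θ X Y i j) p := by
  refine ContDiffAt.sum fun l _ => ContDiffAt.sub ?_ ?_
  · exact (G.smooth_eval _ _ i j l).smul (contDiffAt_const.clm_comp (G.smooth l))
  · exact (contDiffAt_conj (G.smooth_eval _ _ j i l)).smul (G.smooth l)

theorem UnitaryGerm.smooth_germN (G : UnitaryGerm p θ X Y) (i : Fin 2) :
    ContDiffAt ℝ ∞ (germN θ X Y i) p := by
  have h : ∀ {V W : E → E}, ContDiffAt ℝ ∞ V p → ContDiffAt ℝ ∞ W p →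
      ContDiffAt ℝ ∞ (fun z => germTorsion θ X Y i z (V z) (W z)) p := by
    intro V W hV hW
    have hf := contDiffAt_fderiv (G.smooth i)
    refine (((hf.clm_apply hV).clm_apply hW).sub ((hf.clm_apply hW).clm_apply hV)).add ?_
    refine ContDiffAt.sum fun j _ => ?_
    have h1 := G.smooth_germConn i j
    have h2 := G.smooth j
    exact ((h1.clm_apply hV).mul (h2.clm_apply hW)).sub ((h1.clm_apply hW).mul (h2.clm_apply hV))
  have hX := G.smooth_X
  have hY := G.smooth_Y
  exact contDiffAt_const.mul ((((h (hX 0) (hX 1)).sub (contDiffAt_const.mul (h (hX 0) (hY 1)))).sub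
    (contDiffAt_const.mul (h (hY 0) (hX 1)))).add (contDiffAt_const.mul (h (hY 0) (hY 1))))

end GermConnection

/-! ### The first Bianchi identity -/

section DirectionalDerivative

variable {E : Type*} [NormedAddCommGroup E] [NormedSpace ℝ E]

/-- `f` is differentiable at `p` and its derivative in the direction `u` is `d`. -/
structure HasDir (f : E → ℂ) (p u : E) (d : ℂ) : Prop where
  diff : DifferentiableAt ℝ f p
  eq : fderiv ℝ f p u = d

namespace HasDir

variable {f g : E → ℂ} {p u : E} {d d' : ℂ}

theorem of_diff (h : DifferentiableAt ℝ f p) : HasDir f p u (fderiv ℝ f p u) := ⟨h, rfl⟩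

theorem sub (h : HasDir f p u d) (h' : HasDir g p u d') : HasDir (fun z => f z - g z) p u (d - d') :=
  ⟨h.diff.sub h'.diff, by rw [fderiv_fun_sub h.diff h'.diff, sub_apply, h.eq, h'.eq]⟩

theorem mul (h : HasDir f p u d) (h' : HasDir g p u d') :
    HasDir (fun z => f z * g z) p u (d * g p + f p * d') :=
  ⟨h.diff.mul h'.diff, by
    rw [fderiv_fun_mul h.diff h'.diff, add_apply, smul_apply, smul_apply, h.eq, h'.eq]
    simp only [smul_eq_mul]; ring⟩

theorem star (h : HasDir f p u d) :
    HasDir (fun z => (starRingEnd ℂ) (f z)) p u ((starRingEnd ℂ) d) :=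
  ⟨(Complex.conjCLE : ℂ →L[ℝ] ℂ).differentiableAt.comp p h.diff, by
    rw [fderiv_conj h.diff, h.eq]⟩

theorem sum {ι : Type*} {S : Finset ι} {f : ι → E → ℂ} {d : ι → ℂ}
    (h : ∀ i, HasDir (f i) p u (d i)) : HasDir (fun z => ∑ i ∈ S, f i z) p u (∑ i ∈ S, d i) :=
  ⟨DifferentiableAt.fun_sum fun i _ => (h i).diff, by
    rw [fderiv_fun_sum fun i _ => (h i).diff]
    simp [(h _).eq]⟩

theorem apply {α : E → E →L[ℝ] ℂ} (h : DifferentiableAt ℝ α p) (v : E) :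
    HasDir (fun z => α z v) p u (fderiv ℝ α p u v) :=
  ⟨h.clm_apply (differentiableAt_const v), fderiv_oneForm_apply h u v⟩

theorem congr (h : HasDir f p u d) (hg : g =ᶠ[𝓝 p] f) : fderiv ℝ g p u = d := by
  rw [hg.fderiv_eq, h.eq]

end HasDir

end DirectionalDerivative

section Bianchi

variable {E : Type*} [NormedAddCommGroup E] [NormedSpace ℝ E]

variable {p : E} {θ : Fin 2 → E → E →L[ℝ] ℂ} {X Y : Fin 2 → E → E}

theorem extOne_conj_alt (α : E → E →L[ℝ] ℂ) (z : E) :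
    IsAltForm fun v w => conj (extOne α z v w) :=
  ⟨fun u v w => by rw [(IsAltForm.extOne α z).add_left, map_add],
    fun c v w => by rw [(IsAltForm.extOne α z).smul_left, map_mul, Complex.conj_ofReal],
    fun v w => by rw [extOne_swap, map_neg]⟩

/-- The first Bianchi identity, before taking components: the exterior derivative of the structure
equation `dθ^i = n_i conj θ^0 ∧ conj θ^1 - ϑ^i_j ∧ θ^j`. -/
theorem UnitaryGerm.bianchi_cyclic (G : UnitaryGerm p θ X Y) (i : Fin 2) (u v w : E) :
    ((conj (θ 0 p u) * conj (θ 1 p v) - conj (θ 0 p v) * conj (θ 1 p u))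
        * fderiv ℝ (germN θ X Y i) p w
      + (conj (θ 0 p v) * conj (θ 1 p w) - conj (θ 0 p w) * conj (θ 1 p v))
        * fderiv ℝ (germN θ X Y i) p u
      + (conj (θ 0 p w) * conj (θ 1 p u) - conj (θ 0 p u) * conj (θ 1 p w))
        * fderiv ℝ (germN θ X Y i) p v)
    + germN θ X Y i p * ((conj (extOne (θ 0) p u v) * conj (θ 1 p w)
        + conj (extOne (θ 0) p v w) * conj (θ 1 p u) + conj (extOne (θ 0) p w u) * conj (θ 1 p v))
      - (conj (extOne (θ 1) p u v) * conj (θ 0 p w)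
        + conj (extOne (θ 1) p v w) * conj (θ 0 p u) + conj (extOne (θ 1) p w u) * conj (θ 0 p v)))
    - ∑ j, ((extOne (germConn θ X Y i j) p u v * θ j p w + extOne (germConn θ X Y i j) p v w * θ j p u
        + extOne (germConn θ X Y i j) p w u * θ j p v)
      - (extOne (θ j) p u v * germConn θ X Y i j p w + extOne (θ j) p v w * germConn θ X Y i j p u
        + extOne (θ j) p w u * germConn θ X Y i j p v)) = 0 := by
  have hcyc := cyclic_fderiv_extOne (G.smooth i) u v w
  have hθ : ∀ j (u v : E), HasDir (fun z => θ j z v) p u (fderiv ℝ (θ j) p u v) :=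
    fun j u v => HasDir.apply (G.smooth j).diffAt v
  have hϑ : ∀ j (u v : E), HasDir (fun z => germConn θ X Y i j z v) p u
      (fderiv ℝ (germConn θ X Y i j) p u v) :=
    fun j u v => HasDir.apply (G.smooth_germConn i j).diffAt v
  have hn : ∀ u, HasDir (germN θ X Y i) p u (fderiv ℝ (germN θ X Y i) p u) :=
    fun u => HasDir.of_diff (G.smooth_germN i).diffAt
  have key : ∀ u v w : E, fderiv ℝ (fun y => extOne (θ i) y v w) p u = _ := fun u v w =>
    ((hn u).mul (((hθ 0 u v).star.mul (hθ 1 u w).star).sub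
      ((hθ 0 u w).star.mul (hθ 1 u v).star)) |>.sub
      (HasDir.sum (S := Finset.univ) fun j => ((hϑ j u v).mul (hθ j u w)).sub
        ((hϑ j u w).mul (hθ j u v)))).congr (G.torsion.mono fun z hz => by
          have := hz i v w
          simp only [germTorsion] at this
          linear_combination this)
  rw [key, key, key] at hcyc
  simp only [Fin.sum_univ_two, extOne, map_sub] at hcyc ⊢
  linear_combination hcyc

/-- The first Bianchi identity for the (1,1) part of the curvature of the second canonical
connection. -/
theorem UnitaryGerm.bianchi (G : UnitaryGerm p θ X Y) (i l : Fin 2) :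
    eval11 (fun k => X k p) (fun k => Y k p) (germCurv (germConn θ X Y) i 0 p) 1 l
      - eval11 (fun k => X k p) (fun k => Y k p) (germCurv (germConn θ X Y) i 1 p) 0 l =
    germN θ X Y i p * (if l = 1 then conj (germN θ X Y 0 p) else -conj (germN θ X Y 1 p)) := by
  have hX := G.dual_X.self_of_nhds
  have hY := G.dual_Y.self_of_nhds
  have h1 := fun a b => (evalOne_coframe (X := fun k => X k p) (Y := fun k => Y k p) hX hY a b).1
  have h2 := fun a b => (evalOne_coframe (X := fun k => X k p) (Y := fun k => Y k p) hX hY a b).2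
  have h3 := fun i j l => (germConn_evalOne (θ := θ) hX hY i j l).1
  have h4 := fun i j l => (germConn_evalOne (θ := θ) hX hY i j l).2
  have h20 := eval20_extOne hX hY G.closed.self_of_nhds
  have h02 : ∀ r, eval02 (fun k => X k p) (fun k => Y k p) (extOne (θ r) p) 0 1
      = germN θ X Y r p := by
    intro r
    have ht : germTorsion θ X Y r p = fun v w => extOne (θ r) p v w + ∑ j,
      (germConn θ X Y r j p v * θ j p w - germConn θ X Y r j p w * θ j p v) := rfl
    rw [germN, ht]
    simp only [eval02, evalTwo_add, evalTwo_sum, evalTwo_wedge, h2]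
    simp
  have hc : ∀ j k l, eval11 (fun k => X k p) (fun k => Y k p) (germCurv (germConn θ X Y) i j p) k l
      = eval11 (fun k => X k p) (fun k => Y k p) (extOne (germConn θ X Y i j) p) k l + ∑ r,
        (evalOne Complex.I (germConn θ X Y i r p) (X k p) (Y k p) *
          evalOne (-Complex.I) (germConn θ X Y r j p) (X l p) (Y l p)
        - evalOne (-Complex.I) (germConn θ X Y i r p) (X l p) (Y l p) *
          evalOne Complex.I (germConn θ X Y r j p) (X k p) (Y k p)) := by
    intro j k l
    simp only [eval11, ← evalTwo_wedge, ← evalTwo_sum, ← evalTwo_add]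
    rfl
  have hT := funext fun u => funext fun v => funext fun w => G.bianchi_cyclic i u v w
  have key := congrArg (fun T => evalThree Complex.I Complex.I (-Complex.I) T (X 0 p) (Y 0 p)
    (X 1 p) (Y 1 p) (X l p) (Y l p)) hT
  have h0 : evalThree Complex.I Complex.I (-Complex.I) (fun _ _ _ => (0 : ℂ)) (X 0 p) (Y 0 p)
    (X 1 p) (Y 1 p) (X l p) (Y l p) = 0 := by simp [evalThree, evalTwo]
  simp only [evalThree_add, evalThree_sum, evalThree_sub, evalThree_mul,
    (IsAltForm.wedge_conj (θ 0 p) (θ 1 p)).evalThree_wedge _ _ _ (fderiv ℝ (germN θ X Y i) p),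
    (extOne_conj_alt (θ _) p).evalThree_wedge _ _ _ (fun a => conj (θ _ p a)),
    (IsAltForm.extOne (θ _) p).evalThree_wedge, (IsAltForm.extOne (germConn θ X Y i _) p).evalThree_wedge,
    evalTwo_wedge _ _ (fun a => conj (θ 0 p a)) (fun a => conj (θ 1 p a)),
    evalOne_conj, evalTwo_conj, map_neg, Complex.conj_I, neg_neg, h1, h2, h3, h4, h0] at key
  rw [hc, hc]
  simp only [h3, h4]
  simp only [eval02] at h02
  simp only [eval20, eval11] at h20 key ⊢
  simp only [h20, h02] at key
  fin_cases l <;> simp [Fin.sum_univ_two] at key ⊢ <;> linear_combination -key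

theorem germCurv_conj (G : UnitaryGerm p θ X Y) (i j : Fin 2) (v w : E) :
    conj (germCurv (germConn θ X Y) i j p v w) = -germCurv (germConn θ X Y) j i p v w := by
  have h : ∀ u v, conj (fderiv ℝ (germConn θ X Y i j) p u v) =
      -fderiv ℝ (germConn θ X Y j i) p u v := by
    intro u v
    rw [← fderiv_oneForm_apply (G.smooth_germConn i j).diffAt,
      ← fderiv_oneForm_apply (G.smooth_germConn j i).diffAt, ← fderiv_conj
        ((G.smooth_germConn i j).diffAt.clm_apply (differentiableAt_const v))]
    simp only [germConn_skew]
    rw [fderiv_fun_neg]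
    rfl
  simp only [germCurv, extOne, map_add, map_sub, map_mul, h, germConn_skew,
    Fin.sum_univ_two]
  ring

theorem eval11_germCurv_conj (G : UnitaryGerm p θ X Y) (i j k l : Fin 2) :
    conj (eval11 (fun k => X k p) (fun k => Y k p) (germCurv (germConn θ X Y) i j p) k l) =
      eval11 (fun k => X k p) (fun k => Y k p) (germCurv (germConn θ X Y) j i p) l k := by
  have ha := isAltForm_germCurv (germConn θ X Y) j i p
  simp only [eval11]
  rw [ha.evalTwo_swap]
  have := evalTwo_conj (-Complex.I) Complex.I (germCurv (germConn θ X Y) i j p) (X k p) (Y k p)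
    (X l p) (Y l p)
  simp only [map_neg, Complex.conj_I, neg_neg, germCurv_conj G] at this
  rw [← this]
  simp only [evalTwo]
  ring

/-- The two traces of the curvature of the second canonical connection of an almost Kähler metric
differ by a quadratic expression in the Nijenhuis tensor: the Bianchi identity exchanges the index
of the fibre with that of the form, and it is applied before and after complex conjugation. -/
theorem UnitaryGerm.trace_curv (G : UnitaryGerm p θ X Y) (i j : Fin 2) :
    ∑ q, eval11 (fun k => X k p) (fun k => Y k p) (germCurv (germConn θ X Y) j i p) q q =
    ∑ q, eval11 (fun k => X k p) (fun k => Y k p) (germCurv (germConn θ X Y) q q p) i j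
      + 2 * germN θ X Y j p * conj (germN θ X Y i p)
      - (if i = j then ∑ r, germN θ X Y r p * conj (germN θ X Y r p) else 0) := by
  have hb := fun i l => G.bianchi i l
  have hb' := fun i l => congrArg conj (G.bianchi i l)
  simp only [map_sub, map_mul, eval11_germCurv_conj G] at hb'
  have a1 := hb 0 0
  have a2 := hb 0 1
  have a3 := hb 1 0
  have a4 := hb 1 1
  have b1 := hb' 0 0
  have b2 := hb' 0 1
  have b3 := hb' 1 0
  have b4 := hb' 1 1
  simp at a1 a2 a3 a4 b1 b2 b3 b4
  fin_cases i <;> fin_cases j <;> simp [Fin.sum_univ_two]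
  · linear_combination a2 + b3
  · linear_combination a4 - b1
  · linear_combination b4 - a1
  · linear_combination -a2 - b3

end Bianchi

/-! ### The covariant derivative of the transition matrix -/

section TwoMetrics

variable {E : Type*} [NormedAddCommGroup E] [NormedSpace ℝ E]

/-- The germs of two unitary coframes, for two almost Kähler metrics with the same almost complex
structure: the coframes are of type (1,0) with respect to each other's frames. -/
structure UnitaryPair (p : E) (θ : Fin 2 → E → E →L[ℝ] ℂ) (X Y : Fin 2 → E → E)
    (θ' : Fin 2 → E → E →L[ℝ] ℂ) (X' Y' : Fin 2 → E → E) : Prop where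
  fst : UnitaryGerm p θ X Y
  snd : UnitaryGerm p θ' X' Y'
  type_snd : ∀ᶠ z in 𝓝 p, ∀ i k, θ' i z (Y k z) = Complex.I * θ' i z (X k z)
  type_fst : ∀ᶠ z in 𝓝 p, ∀ i k, θ i z (Y' k z) = Complex.I * θ i z (X' k z)

/-- The matrix `a_ij` of the coefficients in `θ'_i = Σ a_ij θ_j`, with `X` the frame dual to `θ`. -/
def coeff (θ' : Fin 2 → E → E →L[ℝ] ℂ) (X : Fin 2 → E → E) (i j : Fin 2) (z : E) : ℂ :=
  θ' i z (X j z)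

/-- The covariant derivative of the identity endomorphism, as a map from `T'M` with the
connection `ϑ` to `T'M` with the connection `ϑ'`: it has the matrix `a` and the covariant
derivative `da - a ϑ + ϑ' a`. -/
def coeffDeriv (a : Fin 2 → Fin 2 → E → ℂ) (ϑ ϑ' : Fin 2 → Fin 2 → E → E →L[ℝ] ℂ) (i j : Fin 2)
    (z : E) : E →L[ℝ] ℂ :=
  fderiv ℝ (a i j) z - ∑ k, a i k z • ϑ k j z + ∑ k, a k j z • ϑ' i k z

/-- The form `Σ conj (a_ij) β_ij`; for the covariant derivative `β` of `a` it is the (1,0) part of the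
differential of `Σ |a_ij|²`. -/
def delNorm (a : Fin 2 → Fin 2 → E → ℂ) (β : Fin 2 → Fin 2 → E → E →L[ℝ] ℂ) (z : E) : E →L[ℝ] ℂ :=
  ∑ i, ∑ j, conj (a i j z) • β i j z

/-- The determinant of the matrix `a`. -/
def coeffDet (a : Fin 2 → Fin 2 → E → ℂ) (z : E) : ℂ := a 0 0 z * a 1 1 z - a 0 1 z * a 1 0 z

/-- The form `tr (a⁻¹ β)`, written with the adjugate of `a`; for the covariant derivative `β` of `a` it
is the (1,0) part of the differential of `log |det a|²`. -/
def delLogDet (a : Fin 2 → Fin 2 → E → ℂ) (β : Fin 2 → Fin 2 → E → E →L[ℝ] ℂ) (z : E) :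
    E →L[ℝ] ℂ :=
  (coeffDet a z)⁻¹ • (a 1 1 z • β 0 0 z - a 0 1 z • β 1 0 z - a 1 0 z • β 0 1 z + a 0 0 z • β 1 1 z)

theorem coeffDeriv_apply (a : Fin 2 → Fin 2 → E → ℂ) (ϑ ϑ' : Fin 2 → Fin 2 → E → E →L[ℝ] ℂ)
    (i j : Fin 2) (z v : E) : coeffDeriv a ϑ ϑ' i j z v =
      fderiv ℝ (a i j) z v - ∑ k, a i k z * ϑ k j z v + ∑ k, a k j z * ϑ' i k z v := by
  simp [coeffDeriv]

theorem delNorm_apply (a : Fin 2 → Fin 2 → E → ℂ) (β : Fin 2 → Fin 2 → E → E →L[ℝ] ℂ) (z v : E) :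
    delNorm a β z v = ∑ i, ∑ j, conj (a i j z) * β i j z v := by
  simp [delNorm]

theorem delLogDet_apply (a : Fin 2 → Fin 2 → E → ℂ) (β : Fin 2 → Fin 2 → E → E →L[ℝ] ℂ) (z v : E) :
    delLogDet a β z v = (coeffDet a z)⁻¹ *
      (a 1 1 z * β 0 0 z v - a 0 1 z * β 1 0 z v - a 1 0 z * β 0 1 z v + a 0 0 z * β 1 1 z v) := by
  simp only [delLogDet, smul_apply, add_apply, sub_apply, smul_eq_mul]

section Smooth

variable {p : E} {a : Fin 2 → Fin 2 → E → ℂ} {ϑ ϑ' β : Fin 2 → Fin 2 → E → E →L[ℝ] ℂ}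

theorem contDiffAt_coeffDeriv (ha : ∀ i j, ContDiffAt ℝ ∞ (a i j) p)
    (h : ∀ i j, ContDiffAt ℝ ∞ (ϑ i j) p) (h' : ∀ i j, ContDiffAt ℝ ∞ (ϑ' i j) p) (i j : Fin 2) :
    ContDiffAt ℝ ∞ (coeffDeriv a ϑ ϑ' i j) p :=
  ((contDiffAt_fderiv (ha i j)).sub (ContDiffAt.sum fun k _ => (ha i k).smul (h k j))).add
    (ContDiffAt.sum fun k _ => (ha k j).smul (h' i k))

theorem contDiffAt_delNorm (ha : ∀ i j, ContDiffAt ℝ ∞ (a i j) p)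
    (hβ : ∀ i j, ContDiffAt ℝ ∞ (β i j) p) : ContDiffAt ℝ ∞ (delNorm a β) p :=
  ContDiffAt.sum fun i _ => ContDiffAt.sum fun j _ => (contDiffAt_conj (ha i j)).smul (hβ i j)

theorem contDiffAt_coeffDet (ha : ∀ i j, ContDiffAt ℝ ∞ (a i j) p) :
    ContDiffAt ℝ ∞ (coeffDet a) p :=
  ((ha 0 0).mul (ha 1 1)).sub ((ha 0 1).mul (ha 1 0))

theorem contDiffAt_delLogDet (ha : ∀ i j, ContDiffAt ℝ ∞ (a i j) p)
    (hβ : ∀ i j, ContDiffAt ℝ ∞ (β i j) p) (hD : coeffDet a p ≠ 0) :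
    ContDiffAt ℝ ∞ (delLogDet a β) p :=
  ((contDiffAt_coeffDet ha).inv hD).smul (((((ha 1 1).smul (hβ 0 0)).sub
    ((ha 0 1).smul (hβ 1 0))).sub ((ha 1 0).smul (hβ 0 1))).add ((ha 0 0).smul (hβ 1 1)))

theorem fderiv_coeffDet {z : E} (ha : ∀ i j, DifferentiableAt ℝ (a i j) z) (v : E) :
    fderiv ℝ (coeffDet a) z v = fderiv ℝ (a 0 0) z v * a 1 1 z + a 0 0 z * fderiv ℝ (a 1 1) z v
      - (fderiv ℝ (a 0 1) z v * a 1 0 z + a 0 1 z * fderiv ℝ (a 1 0) z v) :=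
  (((HasDir.of_diff (ha 0 0)).mul (HasDir.of_diff (ha 1 1))).sub
    ((HasDir.of_diff (ha 0 1)).mul (HasDir.of_diff (ha 1 0)))).eq

/-- The differential of the determinant: `d det a = (det a) (tr (a⁻¹ β) + tr ϑ - tr ϑ')`. -/
theorem fderiv_coeffDet_eq {z : E} (ha : ∀ i j, DifferentiableAt ℝ (a i j) z)
    (hD : coeffDet a z ≠ 0) (v : E) :
    fderiv ℝ (coeffDet a) z v = coeffDet a z * (delLogDet a (coeffDeriv a ϑ ϑ') z v
      + (ϑ 0 0 z v + ϑ 1 1 z v - ϑ' 0 0 z v - ϑ' 1 1 z v)) := by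
  rw [fderiv_coeffDet ha, delLogDet_apply, mul_add, mul_inv_cancel_left₀ hD]
  simp only [coeffDeriv_apply, Fin.sum_univ_two, coeffDet]
  ring

/-- The differential of `log |det a|²`. -/
theorem fderiv_log_det {F : E → ℝ} {z : E} (ha : ∀ i j, DifferentiableAt ℝ (a i j) z)
    (hs : ∀ i j v, conj (ϑ i j z v) = -ϑ j i z v) (hs' : ∀ i j v, conj (ϑ' i j z v) = -ϑ' j i z v)
    (hF : DifferentiableAt ℝ F z)
    (hexp : ∀ᶠ y in 𝓝 z, (Real.exp (F y) : ℂ) = coeffDet a y * conj (coeffDet a y)) (v : E) :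
    (fderiv ℝ F z v : ℂ) = delLogDet a (coeffDeriv a ϑ ϑ') z v
      + conj (delLogDet a (coeffDeriv a ϑ ϑ') z v) := by
  have h0 := hexp.self_of_nhds
  have hne : coeffDet a z * conj (coeffDet a z) ≠ 0 := by
    rw [← h0]; exact_mod_cast (Real.exp_pos _).ne'
  have hD := left_ne_zero_of_mul hne
  have hdD : DifferentiableAt ℝ (coeffDet a) z :=
    ((ha 0 0).mul (ha 1 1)).sub ((ha 0 1).mul (ha 1 0))
  have h1 : HasDir (fun y => coeffDet a y * conj (coeffDet a y)) z v _ :=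
    (HasDir.of_diff hdD).mul (HasDir.of_diff hdD).star
  have h2 := h1.congr hexp
  have h3 := (Complex.ofRealCLM.hasFDerivAt.comp z hF.hasFDerivAt.exp).fderiv
  have h4 : fderiv ℝ (fun y => (Real.exp (F y) : ℂ)) z v = (Real.exp (F z) : ℂ) * fderiv ℝ F z v := by
    refine (congrArg (fun L => L v) h3).trans ?_
    simp
  rw [h4, h0, fderiv_coeffDet_eq (ϑ := ϑ) (ϑ' := ϑ') ha hD] at h2
  refine mul_left_cancel₀ hne (h2.trans ?_)
  simp only [map_mul, map_add, map_sub, hs, hs']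
  ring

/-- The differential of `Σ |a_ij|²`. -/
theorem fderiv_norm {H : E → ℝ} {z : E} (ha : ∀ i j, DifferentiableAt ℝ (a i j) z)
    (hs : ∀ i j v, conj (ϑ i j z v) = -ϑ j i z v) (hs' : ∀ i j v, conj (ϑ' i j z v) = -ϑ' j i z v)
    (hH : DifferentiableAt ℝ H z)
    (hsum : ∀ᶠ y in 𝓝 z, (H y : ℂ) = ∑ i, ∑ j, conj (a i j y) * a i j y) (v : E) :
    (fderiv ℝ H z v : ℂ) = delNorm a (coeffDeriv a ϑ ϑ') z v
      + conj (delNorm a (coeffDeriv a ϑ ϑ') z v) := by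
  have h1 : HasDir (fun y => ∑ i, ∑ j, conj (a i j y) * a i j y) z v _ :=
    HasDir.sum fun i => HasDir.sum fun j => (HasDir.of_diff (ha i j)).star.mul (HasDir.of_diff (ha i j))
  have h2 := h1.congr hsum
  have h3 := (Complex.ofRealCLM.hasFDerivAt.comp z hH.hasFDerivAt).fderiv
  have h4 : fderiv ℝ (fun y => (H y : ℂ)) z v = (fderiv ℝ H z v : ℂ) :=
    (congrArg (fun L => L v) h3).trans (by simp)
  rw [← h4, h2]
  simp only [delNorm_apply, coeffDeriv_apply, Fin.sum_univ_two, map_add, map_sub, map_mul,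
    Complex.conj_conj, hs, hs']
  ring

/-- The exterior derivative of `tr (a⁻¹ β)` is the difference of the traces of the curvatures. -/
theorem extOne_delLogDet (ha : ∀ i j, ContDiffAt ℝ ∞ (a i j) p)
    (h : ∀ i j, ContDiffAt ℝ ∞ (ϑ i j) p) (h' : ∀ i j, ContDiffAt ℝ ∞ (ϑ' i j) p)
    (hD : coeffDet a p ≠ 0) (v w : E) :
    extOne (delLogDet a (coeffDeriv a ϑ ϑ')) p v w =
      ∑ i, germCurv ϑ' i i p v w - ∑ i, germCurv ϑ i i p v w := by
  have hη := contDiffAt_delLogDet ha (contDiffAt_coeffDeriv ha h h') hD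
  have hDs := contDiffAt_coeffDet ha
  set η := delLogDet a (coeffDeriv a ϑ ϑ') with hηd
  -- `μ` is the logarithmic differential of the determinant, so that `d μ = 0`
  set μ : E → E →L[ℝ] ℂ := fun z => η z + (ϑ 0 0 z + ϑ 1 1 z - ϑ' 0 0 z - ϑ' 1 1 z) with hμ
  have d1 := hη.diffAt
  have d2 := (h 0 0).diffAt
  have d3 := (h 1 1).diffAt
  have d4 := (h' 0 0).diffAt
  have d5 := (h' 1 1).diffAt
  have hμd : DifferentiableAt ℝ μ p := d1.fun_add (((d2.fun_add d3).fun_sub d4).fun_sub d5)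
  have hEq : (fun z => coeffDet a z • μ z) =ᶠ[𝓝 p] fun z => fderiv ℝ (coeffDet a) z := by
    filter_upwards [hDs.continuousAt.eventually_ne hD, (ha 0 0).eventually_infty,
      (ha 0 1).eventually_infty, (ha 1 0).eventually_infty, (ha 1 1).eventually_infty]
      with z hz h00 h01 h10 h11
    ext v
    rw [fderiv_coeffDet_eq (ϑ := ϑ) (ϑ' := ϑ')
      (fun i j => by fin_cases i <;> fin_cases j <;> assumption) hz]
    simp only [hμ, hηd, smul_apply, add_apply, sub_apply, smul_eq_mul]
  have h1 := extOne_congr hEq v w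
  rw [extOne_fderiv hDs, extOne_smul hDs.diffAt hμd] at h1
  have h2 := fun v => congrArg (fun L => L v) hEq.self_of_nhds
  simp only [smul_apply, smul_eq_mul] at h2
  rw [← h2, ← h2] at h1
  have h3 : extOne μ p v w = 0 := by
    refine mul_left_cancel₀ hD ?_
    linear_combination h1
  rw [hμ, extOne_add d1 (((d2.fun_add d3).fun_sub d4).fun_sub d5),
    extOne_sub ((d2.fun_add d3).fun_sub d4) d5, extOne_sub (d2.fun_add d3) d4, extOne_add d2 d3] at h3
  simp only [germCurv, Fin.sum_univ_two]
  linear_combination h3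

theorem extOne_coeffDeriv (ha : ∀ i j, ContDiffAt ℝ ∞ (a i j) p)
    (h : ∀ i j, ContDiffAt ℝ ∞ (ϑ i j) p) (h' : ∀ i j, ContDiffAt ℝ ∞ (ϑ' i j) p) (i j : Fin 2)
    (v w : E) :
    extOne (coeffDeriv a ϑ ϑ' i j) p v w =
      - ∑ k, (fderiv ℝ (a i k) p v * ϑ k j p w - fderiv ℝ (a i k) p w * ϑ k j p v
        + a i k p * extOne (ϑ k j) p v w)
      + ∑ k, (fderiv ℝ (a k j) p v * ϑ' i k p w - fderiv ℝ (a k j) p w * ϑ' i k p v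
        + a k j p * extOne (ϑ' i k) p v w) := by
  have e1 : coeffDeriv a ϑ ϑ' i j = fun z => fderiv ℝ (a i j) z - (a i 0 z • ϑ 0 j z
      + a i 1 z • ϑ 1 j z) + (a 0 j z • ϑ' i 0 z + a 1 j z • ϑ' i 1 z) := by
    ext z
    simp [coeffDeriv, Fin.sum_univ_two]
  have d := fun i j => (ha i j).diffAt
  have s := fun i j k => (d i j).fun_smul (h j k).diffAt
  have s' := fun i j k => (d i j).fun_smul (h' k i).diffAt
  have t := (contDiffAt_fderiv (ha i j)).diffAt
  rw [e1, extOne_add (t.fun_sub ((s i 0 j).fun_add (s i 1 j))) ((s' 0 j i).fun_add (s' 1 j i)),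
    extOne_sub t ((s i 0 j).fun_add (s i 1 j)), extOne_fderiv (ha i j),
    extOne_add (s i 0 j) (s i 1 j), extOne_add (s' 0 j i) (s' 1 j i),
    extOne_smul (d _ _) (h _ _).diffAt, extOne_smul (d _ _) (h _ _).diffAt,
    extOne_smul (d _ _) (h' _ _).diffAt, extOne_smul (d _ _) (h' _ _).diffAt]
  simp only [Fin.sum_univ_two]
  ring

/-- The exterior derivative of the (1,0) part of the differential of `Σ |a_ij|²`. -/
theorem extOne_delNorm (ha : ∀ i j, ContDiffAt ℝ ∞ (a i j) p)
    (h : ∀ i j, ContDiffAt ℝ ∞ (ϑ i j) p) (h' : ∀ i j, ContDiffAt ℝ ∞ (ϑ' i j) p)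
    (hs : ∀ i j v, conj (ϑ i j p v) = -ϑ j i p v) (hs' : ∀ i j v, conj (ϑ' i j p v) = -ϑ' j i p v)
    (v w : E) :
    extOne (delNorm a (coeffDeriv a ϑ ϑ')) p v w =
      ∑ i, ∑ j, (conj (coeffDeriv a ϑ ϑ' i j p v) * coeffDeriv a ϑ ϑ' i j p w
        - conj (coeffDeriv a ϑ ϑ' i j p w) * coeffDeriv a ϑ ϑ' i j p v)
      + ∑ i, ∑ j, ∑ k, conj (a i j p) * a k j p * germCurv ϑ' i k p v w
      - ∑ i, ∑ j, ∑ k, conj (a i j p) * a i k p * germCurv ϑ k j p v w := by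
  have hβ := fun i j => (contDiffAt_coeffDeriv ha h h' i j).diffAt
  have hc := fun i j => (contDiffAt_conj (ha i j)).diffAt
  have s := fun i j => (hc i j).fun_smul (hβ i j)
  have e1 : delNorm a (coeffDeriv a ϑ ϑ') = fun z =>
      (conj (a 0 0 z) • coeffDeriv a ϑ ϑ' 0 0 z + conj (a 0 1 z) • coeffDeriv a ϑ ϑ' 0 1 z)
      + (conj (a 1 0 z) • coeffDeriv a ϑ ϑ' 1 0 z + conj (a 1 1 z) • coeffDeriv a ϑ ϑ' 1 1 z) := by
    ext z
    simp [delNorm, Fin.sum_univ_two]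
  rw [e1, extOne_add ((s 0 0).fun_add (s 0 1)) ((s 1 0).fun_add (s 1 1)), extOne_add (s 0 0) (s 0 1),
    extOne_add (s 1 0) (s 1 1), extOne_smul (hc _ _) (hβ _ _), extOne_smul (hc _ _) (hβ _ _),
    extOne_smul (hc _ _) (hβ _ _), extOne_smul (hc _ _) (hβ _ _)]
  simp only [fderiv_conj (ha _ _).diffAt, extOne_coeffDeriv ha h h', germCurv]
  have hd : ∀ i j v, fderiv ℝ (a i j) p v = coeffDeriv a ϑ ϑ' i j p v
      + ∑ k, a i k p * ϑ k j p v - ∑ k, a k j p * ϑ' i k p v := fun i j v => by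
    rw [coeffDeriv_apply]; ring
  simp only [hd, Fin.sum_univ_two, map_add, map_sub, map_mul, hs, hs']
  ring

end Smooth

end TwoMetrics

/-! ### Change of frame -/

section

/-- A (1,0) form vanishes on the conjugate frame. -/
theorem evalOne_neg_I {V : Type*} {α : V → ℂ} {v v' : V} (h : α v' = Complex.I * α v) :
    evalOne (-Complex.I) α v v' = 0 := by
  rw [evalOne, h]
  linear_combination (1 / 2 * α v) * Complex.I_mul_I

theorem evalOne_I {V : Type*} {α : V → ℂ} {v v' : V} (h : α v' = Complex.I * α v) :
    evalOne Complex.I α v v' = α v := by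
  rw [evalOne, h]
  linear_combination (-1 / 2 * α v) * Complex.I_mul_I

theorem eq_I_mul_of_evalOne {V : Type*} {α : V → ℂ} {v v' : V} (h : evalOne (-Complex.I) α v v' = 0) :
    α v' = Complex.I * α v := by
  rw [evalOne] at h
  linear_combination (-2 * Complex.I) * h + α v' * Complex.I_mul_I

theorem evalTwo_eq_evalOne {V : Type*} (s t : ℂ) (β : V → V → ℂ) (v v' w w' : V) :
    evalTwo s t β v v' w w' = evalOne s (fun a => evalOne t (β a) w w') v v' := by
  simp only [evalTwo, evalOne]; ring

end

section Pair

variable {E : Type*} [NormedAddCommGroup E] [NormedSpace ℝ E]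

variable {p : E} {θ θ' : Fin 2 → E → E →L[ℝ] ℂ} {X Y X' Y' : Fin 2 → E → E}

namespace UnitaryPair

theorem symm (P : UnitaryPair p θ X Y θ' X' Y') : UnitaryPair p θ' X' Y' θ X Y :=
  ⟨P.snd, P.fst, P.type_fst, P.type_snd⟩

theorem contDiffAt_coeff (P : UnitaryPair p θ X Y θ' X' Y') (i j : Fin 2) :
    ContDiffAt ℝ ∞ (coeff θ' X i j) p :=
  (P.snd.smooth i).clm_apply (P.fst.smooth_X j)

theorem coframe_eq (P : UnitaryPair p θ X Y θ' X' Y') :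
    ∀ᶠ z in 𝓝 p, ∀ i v, θ' i z v = ∑ j, coeff θ' X i j z * θ j z v := by
  filter_upwards [P.fst.complete, P.type_snd] with z hc ht i v
  exact oneForm_eq_sum hc (ht i) v

/-- The matrices that express each coframe in terms of the other are inverse to each other. -/
theorem coeff_mul_coeff (P : UnitaryPair p θ X Y θ' X' Y') (i j : Fin 2) :
    ∑ k, coeff θ' X i k p * coeff θ X' k j p = if i = j then 1 else 0 := by
  have h := P.coframe_eq.self_of_nhds i (X' j p)
  rw [P.snd.dual_X.self_of_nhds i j] at h
  exact h.symm

/-- A (1,0) form is of type (1,0) for both frames. -/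
theorem type_change (P : UnitaryPair p θ X Y θ' X' Y') {η : E → E →L[ℝ] ℂ}
    (hη : ∀ᶠ z in 𝓝 p, ∀ k, η z (Y k z) = Complex.I * η z (X k z)) :
    ∀ᶠ z in 𝓝 p, ∀ k, η z (Y' k z) = Complex.I * η z (X' k z) := by
  filter_upwards [hη, P.fst.complete, P.type_fst] with z h1 hc h2 k
  rw [oneForm_eq_sum hc h1, oneForm_eq_sum hc h1 (X' k z), Finset.mul_sum]
  exact Finset.sum_congr rfl fun i _ => by rw [h2]; ring

/-- The difference of the structure equations of the two coframes: `β_ij ∧ θ^j` is of type (0,2),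
because the torsions of both connections are. -/
theorem coeffDeriv_wedge (P : UnitaryPair p θ X Y θ' X' Y') : ∀ᶠ z in 𝓝 p, ∀ i v w,
    ∑ j, (coeffDeriv (coeff θ' X) (germConn θ X Y) (germConn θ' X' Y') i j z v * θ j z w
      - coeffDeriv (coeff θ' X) (germConn θ X Y) (germConn θ' X' Y') i j z w * θ j z v) =
    (germN θ' X' Y' i z * conj (coeffDet (coeff θ' X) z)
        - ∑ j, coeff θ' X i j z * germN θ X Y j z) *
      (conj (θ 0 z v) * conj (θ 1 z w) - conj (θ 0 z w) * conj (θ 1 z v)) := by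
  have hd : ∀ᶠ z in 𝓝 p, ∀ i j, DifferentiableAt ℝ (coeff θ' X i j) z :=
    eventually_all.2 fun i => eventually_all.2 fun j => (P.contDiffAt_coeff i j).eventually_infty
  have hθ : ∀ᶠ z in 𝓝 p, ∀ j, DifferentiableAt ℝ (θ j) z :=
    eventually_all.2 fun j => (P.fst.smooth j).eventually_infty
  filter_upwards [P.coframe_eq.eventually_nhds, P.fst.torsion, P.snd.torsion, hd, hθ]
    with z hc hT hT' hd hθ i v w
  have e1 : θ' i =ᶠ[𝓝 z] fun y => coeff θ' X i 0 y • θ 0 y + coeff θ' X i 1 y • θ 1 y := by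
    filter_upwards [hc] with y hy
    ext v
    rw [hy]
    simp [Fin.sum_univ_two]
  have e2 := extOne_congr e1 v w
  rw [extOne_add ((hd i 0).fun_smul (hθ 0)) ((hd i 1).fun_smul (hθ 1)), extOne_smul (hd i 0) (hθ 0),
    extOne_smul (hd i 1) (hθ 1)] at e2
  have t0 := hT 0 v w
  have t1 := hT 1 v w
  have t' := hT' i v w
  have hz := hc.self_of_nhds
  simp only [germTorsion] at t0 t1 t'
  simp only [hz, Fin.sum_univ_two, coeffDeriv_apply, coeffDet, map_add, map_mul, map_sub]
    at t0 t1 t' ⊢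
  linear_combination t' - e2 - coeff θ' X i 0 z * t0 - coeff θ' X i 1 z * t1

/-- The covariant derivative of the transition matrix is of type (1,0). -/
theorem coeffDeriv_type (P : UnitaryPair p θ X Y θ' X' Y') : ∀ᶠ z in 𝓝 p, ∀ i j k,
    coeffDeriv (coeff θ' X) (germConn θ X Y) (germConn θ' X' Y') i j z (Y k z) = Complex.I *
      coeffDeriv (coeff θ' X) (germConn θ X Y) (germConn θ' X' Y') i j z (X k z) := by
  filter_upwards [P.coeffDeriv_wedge, P.fst.dual_X, P.fst.dual_Y] with z h hX hY i j k
  have h1 := fun a b => (evalOne_coframe (X := fun k => X k z) (Y := fun k => Y k z) hX hY a b).1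
  have h2 := fun a b => (evalOne_coframe (X := fun k => X k z) (Y := fun k => Y k z) hX hY a b).2
  apply eq_I_mul_of_evalOne
  have key := congrArg (fun T => evalTwo (-Complex.I) Complex.I T (X k z) (Y k z) (X j z) (Y j z))
    (funext fun v => funext fun w => h i v w)
  simp only [evalTwo_sum, evalTwo_mul, evalTwo_wedge] at key
  simp only [evalOne_conj, map_neg, Complex.conj_I, neg_neg, h1, h2] at key
  simpa [Fin.sum_univ_two] using key

/-- The transformation of the Nijenhuis tensor under a change of coframe. -/
theorem germN_change (P : UnitaryPair p θ X Y θ' X' Y') (i : Fin 2) :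
    germN θ' X' Y' i p * conj (coeffDet (coeff θ' X) p) =
      ∑ j, coeff θ' X i j p * germN θ X Y j p := by
  have h := P.coeffDeriv_wedge.self_of_nhds
  have hX := P.fst.dual_X.self_of_nhds
  have hY := P.fst.dual_Y.self_of_nhds
  have h1 := fun a b => (evalOne_coframe (X := fun k => X k p) (Y := fun k => Y k p) hX hY a b).1
  have h2 := fun a b => (evalOne_coframe (X := fun k => X k p) (Y := fun k => Y k p) hX hY a b).2
  have key := congrArg (fun T => evalTwo (-Complex.I) (-Complex.I) T (X 0 p) (Y 0 p) (X 1 p) (Y 1 p))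
    (funext fun v => funext fun w => h i v w)
  simp only [evalTwo_sum, evalTwo_mul, evalTwo_wedge] at key
  simp only [evalOne_conj, map_neg, Complex.conj_I, neg_neg, h1, h2] at key
  simp [Fin.sum_univ_two] at key ⊢
  linear_combination -key

theorem coeffDet_ne_zero (P : UnitaryPair p θ X Y θ' X' Y') : coeffDet (coeff θ' X) p ≠ 0 := by
  intro h
  have h1 := P.coeff_mul_coeff 0 0
  have h2 := P.coeff_mul_coeff 0 1
  have h3 := P.coeff_mul_coeff 1 0
  have h4 := P.coeff_mul_coeff 1 1
  simp [Fin.sum_univ_two] at h1 h2 h3 h4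
  rw [coeffDet] at h
  have : (1 : ℂ) = 0 := by
    linear_combination (coeff θ X' 0 0 p * coeff θ X' 1 1 p - coeff θ X' 0 1 p * coeff θ X' 1 0 p) * h
      - (coeff θ' X 1 0 p * coeff θ X' 0 1 p + coeff θ' X 1 1 p * coeff θ X' 1 1 p) * h1 - h4
      + (coeff θ' X 1 0 p * coeff θ X' 0 0 p + coeff θ' X 1 1 p * coeff θ X' 1 0 p) * h2
  exact one_ne_zero this

/-- Change of frame: `e'_q = Σ b_kq e_k`. -/
theorem evalOne_change (P : UnitaryPair p θ X Y θ' X' Y') {α : E → ℂ}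
    (hα : ∀ v w, α (v + w) = α v + α w) (hα' : ∀ (c : ℝ) v, α (c • v) = c * α v) (q : Fin 2) :
    evalOne Complex.I α (X' q p) (Y' q p) =
        ∑ k, coeff θ X' k q p * evalOne Complex.I α (X k p) (Y k p) ∧
      evalOne (-Complex.I) α (X' q p) (Y' q p) =
        ∑ k, conj (coeff θ X' k q p) * evalOne (-Complex.I) α (X k p) (Y k p) := by
  have hc := P.fst.complete.self_of_nhds
  have hX : X' q p = ∑ k, ((coeff θ X' k q p).re • X k p + (coeff θ X' k q p).im • Y k p) :=
    hc (X' q p)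
  have hY : Y' q p = ∑ k, ((-(coeff θ X' k q p).im) • X k p + (coeff θ X' k q p).re • Y k p) := by
    have h := hc (Y' q p)
    simp only [P.type_fst.self_of_nhds] at h
    refine h.trans (Finset.sum_congr rfl fun k _ => ?_)
    simp [coeff]
  have hr : ∀ c : ℂ, c = c.re + c.im * Complex.I := fun c => (Complex.re_add_im _).symm
  have hr' : ∀ c : ℂ, conj c = c.re - c.im * Complex.I := by
    intro c
    conv_lhs => rw [hr c]
    simp only [map_add, map_mul, Complex.conj_ofReal, Complex.conj_I]
    ring
  rw [hX, hY]
  generalize hc' : (fun k => coeff θ X' k q p) = c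
  have hck : ∀ k, coeff θ X' k q p = c k := fun k => congrFun hc' k
  simp only [hck]
  constructor
  · rw [show (∑ k, c k * evalOne Complex.I α (X k p) (Y k p)) = ∑ k, ((c k).re + (c k).im * Complex.I)
      * evalOne Complex.I α (X k p) (Y k p) from Finset.sum_congr rfl fun k _ => by rw [← hr]]
    simp only [evalOne, Fin.sum_univ_two, hα, hα', Complex.ofReal_neg]
    linear_combination (1 / 2 * (c 0).im * α (Y 0 p) + 1 / 2 * (c 1).im * α (Y 1 p)) * Complex.I_mul_I
  · simp only [evalOne, Fin.sum_univ_two, hα, hα', Complex.ofReal_neg, hr']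
    linear_combination (1 / 2 * (c 0).im * α (Y 0 p) + 1 / 2 * (c 1).im * α (Y 1 p)) * Complex.I_mul_I

/-- Change of frame for the (1,1) components of a two-form. -/
theorem eval11_change (P : UnitaryPair p θ X Y θ' X' Y') {β : E → E → ℂ} (hβ : IsAltForm β)
    (q r : Fin 2) : eval11 (fun k => X' k p) (fun k => Y' k p) β q r =
      ∑ k, ∑ l, coeff θ X' k q p * conj (coeff θ X' l r p) *
        eval11 (fun k => X k p) (fun k => Y k p) β k l := by
  simp only [eval11, evalTwo_eq_evalOne]
  rw [(P.evalOne_change _ _ q).1]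
  · simp only [(P.evalOne_change (hβ.add_right · · _) (hβ.smul_right · · _) r).2]
    simp only [evalOne, Fin.sum_univ_two]
    ring
  · intro v w
    simp only [evalOne, hβ.add_left]; ring
  · intro c v
    simp only [evalOne, hβ.smul_left]; ring

end UnitaryPair

end Pair

/-! ### The Nijenhuis terms and the curvature terms -/

section QuadraticIdentity

/-- The quadratic terms in the Nijenhuis tensors of the two metrics agree; by
`n'_i conj (det a) = Σ a_ij n_j` this is the Cayley-Hamilton identity for `conj a * aᵀ`. -/
theorem nijenhuis_quadratic {a b : Fin 2 → Fin 2 → ℂ} {n n' : Fin 2 → ℂ}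
    {N : Fin 2 → Fin 2 → Fin 2 → ℂ}
    (hab : ∀ i j, ∑ k, a i k * b k j = if i = j then 1 else 0)
    (hn : ∀ i, n' i * conj (a 0 0 * a 1 1 - a 0 1 * a 1 0) = ∑ j, a i j * n j)
    (hD : a 0 0 * a 1 1 - a 0 1 * a 1 0 ≠ 0)
    (hN : ∀ i j k, N i j k = 1 / 2 * (n i * if j = k then 0 else if k = 1 then 1 else -1)) :
    -4 * ∑ i, ∑ j, ∑ k, conj (a i j) * a k j * (n' i * conj (n' k))
      + 2 * (∑ i, ∑ j, conj (a i j) * a i j) * ∑ r, n' r * conj (n' r) =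
    8 * ∑ l, ∑ p, ∑ i, N l p i * conj (N p l i)
      + 8 * ∑ i, ∑ j, ∑ k, ∑ l, ∑ p, ∑ q, conj (a p i) * a p j * b k q * conj (b l q) *
        ∑ r, N r l j * conj (N i r k) := by
  set d := (a 0 0 * a 1 1 - a 0 1 * a 1 0)⁻¹ with hd
  have hDd : (a 0 0 * a 1 1 - a 0 1 * a 1 0) * d = 1 := mul_inv_cancel₀ hD
  have hDd' : conj (a 0 0 * a 1 1 - a 0 1 * a 1 0) * conj d = 1 := by
    rw [← map_mul, hDd, map_one]
  have hn' : ∀ i, n' i = (∑ j, a i j * n j) * conj d := fun i => by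
    rw [← hn i, mul_assoc, hDd', mul_one]
  have c00 := hab 0 0
  have c01 := hab 0 1
  have c10 := hab 1 0
  have c11 := hab 1 1
  simp [Fin.sum_univ_two] at c00 c01 c10 c11
  have b00 : b 0 0 = a 1 1 * d := by
    linear_combination (a 1 1 * d) * c00 - (a 0 1 * d) * c10 - b 0 0 * hDd
  have b01 : b 0 1 = -a 0 1 * d := by
    linear_combination (a 1 1 * d) * c01 - (a 0 1 * d) * c11 - b 0 1 * hDd
  have b10 : b 1 0 = -a 1 0 * d := by
    linear_combination -(a 1 0 * d) * c00 + (a 0 0 * d) * c10 - b 1 0 * hDd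
  have b11 : b 1 1 = a 0 0 * d := by
    linear_combination -(a 1 0 * d) * c01 + (a 0 0 * d) * c11 - b 1 1 * hDd
  simp only [map_sub, map_mul] at hDd'
  clear_value d
  simp [hn', hN, Fin.sum_univ_two, b00, b01, b10, b11, Complex.conj_ofNat]
  linear_combination (2 * (n 0 * conj (n 0) + n 1 * conj (n 1))) *
    ((conj (a 0 0) * conj (a 1 1) - conj (a 0 1) * conj (a 1 0)) * conj d * hDd + hDd')

end QuadraticIdentity

section PairLaplacian

variable {E : Type*} [NormedAddCommGroup E] [NormedSpace ℝ E]

variable {p : E} {θ θ' : Fin 2 → E → E →L[ℝ] ℂ} {X Y X' Y' : Fin 2 → E → E}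

/-- The components of the Nijenhuis tensor are skew in the lower indices. -/
theorem eval02_germTorsion (i j k : Fin 2) (z : E) :
    eval02 (fun k => X k z) (fun k => Y k z) (germTorsion θ X Y i z) j k =
      germN θ X Y i z * if j = k then 0 else if k = 1 then 1 else -1 := by
  have h := isAltForm_germTorsion (θ := θ) (X := X) (Y := Y) i z
  have hs := fun v v' w w' => h.evalTwo_swap (-Complex.I) (-Complex.I) v v' w w'
  have h0 := fun v v' => self_eq_neg.1 (hs v v' v v')
  simp only [eval02, germN]
  fin_cases j <;> fin_cases k <;> simp [h0]
  exact hs _ _ _ _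

namespace UnitaryPair

theorem extOne_delLogDet_eq (P : UnitaryPair p θ X Y θ' X' Y') :
    ∑ q, eval11 (fun k => X k p) (fun k => Y k p)
      (extOne (delLogDet (coeff θ' X) (coeffDeriv (coeff θ' X) (germConn θ X Y) (germConn θ' X' Y'))) p)
      q q =
    ∑ q, ∑ k, ∑ l, coeff θ' X k q p * conj (coeff θ' X l q p) * ∑ i,
      eval11 (fun k => X' k p) (fun k => Y' k p) (germCurv (germConn θ' X' Y') i i p) k l
    - ∑ q, ∑ i, eval11 (fun k => X k p) (fun k => Y k p) (germCurv (germConn θ X Y) i i p) q q := by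
  have h : extOne (delLogDet (coeff θ' X)
      (coeffDeriv (coeff θ' X) (germConn θ X Y) (germConn θ' X' Y'))) p = fun v w =>
      ∑ i, germCurv (germConn θ' X' Y') i i p v w - ∑ i, germCurv (germConn θ X Y) i i p v w :=
    funext fun v => funext fun w => extOne_delLogDet P.contDiffAt_coeff P.fst.smooth_germConn
      P.snd.smooth_germConn P.coeffDet_ne_zero v w
  rw [h]
  have h2 := fun i q => P.symm.eval11_change (isAltForm_germCurv (germConn θ' X' Y') i i p) q q
  simp only [eval11] at h2 ⊢
  simp only [evalTwo_sub, evalTwo_sum, h2]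
  simp only [Fin.sum_univ_two]
  ring

theorem extOne_delNorm_eq (P : UnitaryPair p θ X Y θ' X' Y') :
    ∑ q, eval11 (fun k => X' k p) (fun k => Y' k p)
      (extOne (delNorm (coeff θ' X) (coeffDeriv (coeff θ' X) (germConn θ X Y) (germConn θ' X' Y'))) p)
      q q =
    -∑ q, ∑ i, ∑ j,
      conj (coeffDeriv (coeff θ' X) (germConn θ X Y) (germConn θ' X' Y') i j p (X' q p)) *
        coeffDeriv (coeff θ' X) (germConn θ X Y) (germConn θ' X' Y') i j p (X' q p)
    + ∑ i, ∑ j, ∑ k, conj (coeff θ' X i j p) * coeff θ' X k j p * ∑ q,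
      eval11 (fun k => X' k p) (fun k => Y' k p) (germCurv (germConn θ' X' Y') i k p) q q
    - ∑ q, ∑ i, ∑ j, ∑ k, conj (coeff θ' X i j p) * coeff θ' X i k p * ∑ l, ∑ m,
      coeff θ X' l q p * conj (coeff θ X' m q p) *
      eval11 (fun k => X k p) (fun k => Y k p) (germCurv (germConn θ X Y) k j p) l m := by
  have h : extOne (delNorm (coeff θ' X)
      (coeffDeriv (coeff θ' X) (germConn θ X Y) (germConn θ' X' Y'))) p = fun v w => _ :=
    funext fun v => funext fun w => extOne_delNorm P.contDiffAt_coeff P.fst.smooth_germConn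
      P.snd.smooth_germConn (fun i j v => germConn_skew i j p v) (fun i j v => germConn_skew i j p v) v w
  rw [h]
  have hβ := fun i j => (P.type_change (P.coeffDeriv_type.mono fun z hz => hz i j)).self_of_nhds
  have h2 := fun i k q => P.eval11_change (isAltForm_germCurv (germConn θ X Y) i k p) q q
  simp only [← h2]
  simp only [eval11]
  have h3 : ∀ i j q, evalTwo Complex.I (-Complex.I) (fun v w =>
      conj (coeffDeriv (coeff θ' X) (germConn θ X Y) (germConn θ' X' Y') i j p v) *
        coeffDeriv (coeff θ' X) (germConn θ X Y) (germConn θ' X' Y') i j p w -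
      conj (coeffDeriv (coeff θ' X) (germConn θ X Y) (germConn θ' X' Y') i j p w) *
        coeffDeriv (coeff θ' X) (germConn θ X Y) (germConn θ' X' Y') i j p v)
      (X' q p) (Y' q p) (X' q p) (Y' q p) = _ := fun i j q =>
    evalTwo_wedge _ _ (fun a => conj (coeffDeriv _ _ _ i j p a)) _ _ _ _ _
  simp only [evalOne_conj, evalOne_neg_I (hβ _ _ _), evalOne_I (hβ _ _ _), map_neg, Complex.conj_I,
    neg_neg, map_zero, mul_zero, zero_sub] at h3
  have h4 : ∀ q, evalTwo Complex.I (-Complex.I) (fun v w => ∑ i, ∑ j,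
      (conj (coeffDeriv (coeff θ' X) (germConn θ X Y) (germConn θ' X' Y') i j p v) *
        coeffDeriv (coeff θ' X) (germConn θ X Y) (germConn θ' X' Y') i j p w -
      conj (coeffDeriv (coeff θ' X) (germConn θ X Y) (germConn θ' X' Y') i j p w) *
        coeffDeriv (coeff θ' X) (germConn θ X Y) (germConn θ' X' Y') i j p v))
      (X' q p) (Y' q p) (X' q p) (Y' q p) = _ := fun q =>
    (evalTwo_sum _ _ _ _ _ _ _ _).trans (Finset.sum_congr rfl fun i _ =>
      (evalTwo_sum _ _ _ _ _ _ _ _).trans (Finset.sum_congr rfl fun j _ => h3 i j q))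
  rw [Finset.sum_congr rfl fun q _ => (evalTwo_sub _ _ _ _ _ _ _ _).trans
    (congrArg₂ (· - ·) ((evalTwo_add _ _ _ _ _ _ _ _).trans (congrArg₂ (· + ·) (h4 q) rfl)) rfl)]
  simp only [evalTwo_sum, evalTwo_mul]
  simp only [Fin.sum_univ_two]
  ring

end UnitaryPair

end PairLaplacian

/-! ### The Bochner formula -/

section Bochner

set_option maxHeartbeats 1000000 in
/-- The index bookkeeping of the Bochner formula: the curvature of the second metric is eliminated with
the relation between its two traces, and `n'` with the quadratic identity. -/
theorem bochner_algebra {a b : Fin 2 → Fin 2 → ℂ} {n' : Fin 2 → ℂ}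
    {N : Fin 2 → Fin 2 → Fin 2 → ℂ} {R R' : Fin 2 → Fin 2 → Fin 2 → Fin 2 → ℂ}
    (hT : ∀ i j, ∑ q, R' j i q q = ∑ q, R' q q i j + 2 * n' j * conj (n' i)
      - if i = j then ∑ r, n' r * conj (n' r) else 0)
    (hN : -4 * ∑ i, ∑ j, ∑ k, conj (a i j) * a k j * (n' i * conj (n' k))
      + 2 * (∑ i, ∑ j, conj (a i j) * a i j) * ∑ r, n' r * conj (n' r) =
      8 * ∑ l, ∑ p, ∑ i, N l p i * conj (N p l i)
      + 8 * ∑ i, ∑ j, ∑ k, ∑ l, ∑ p, ∑ q, conj (a p i) * a p j * b k q * conj (b l q) *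
        ∑ r, N r l j * conj (N i r k)) :
    -2 * (∑ q, ∑ k, ∑ l, a k q * conj (a l q) * ∑ i, R' i i k l - ∑ q, ∑ i, R i i q q)
      - 2 * ∑ k, ∑ i, R i i k k + 8 * ∑ l, ∑ p, ∑ i, N l p i * conj (N p l i)
      + 2 * ∑ i, ∑ j, ∑ k, ∑ l, ∑ p, ∑ q, conj (a p i) * a p j * b k q * conj (b l q) *
        (R j i k l + 4 * ∑ r, N r l j * conj (N i r k)) =
    -2 * (∑ i, ∑ j, ∑ k, conj (a i j) * a k j * ∑ q, R' i k q q
      - ∑ q, ∑ i, ∑ j, ∑ k, conj (a i j) * a i k * ∑ l, ∑ m, b l q * conj (b m q) * R k j l m) := by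
  have hsplit : ∀ M : Fin 2 → Fin 2 → Fin 2 → Fin 2 → ℂ,
      ∑ i, ∑ j, ∑ k, ∑ l, ∑ p, ∑ q, conj (a p i) * a p j * b k q * conj (b l q) *
        (R j i k l + 4 * M i j k l) =
      ∑ i, ∑ j, ∑ k, ∑ l, ∑ p, ∑ q, conj (a p i) * a p j * b k q * conj (b l q) * R j i k l
      + 4 * ∑ i, ∑ j, ∑ k, ∑ l, ∑ p, ∑ q, conj (a p i) * a p j * b k q * conj (b l q) *
        M i j k l := by
    intro M
    iterate 6
      rw [Finset.mul_sum, ← Finset.sum_add_distrib]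
      refine Finset.sum_congr rfl fun _ _ => ?_
    ring
  have hR : ∑ i, ∑ j, ∑ k, ∑ l, ∑ p, ∑ q, conj (a p i) * a p j * b k q * conj (b l q) * R j i k l =
      ∑ q, ∑ i, ∑ j, ∑ k, conj (a i j) * a i k * ∑ l, ∑ m, b l q * conj (b m q) * R k j l m := by
    simp only [Fin.sum_univ_two]
    ring
  have hT' : ∑ i, ∑ j, ∑ k, conj (a i j) * a k j * ∑ q, R' i k q q =
      ∑ q, ∑ k, ∑ l, a k q * conj (a l q) * ∑ i, R' i i k l
      + 2 * ∑ i, ∑ j, ∑ k, conj (a i j) * a k j * (n' i * conj (n' k))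
      - (∑ i, ∑ j, conj (a i j) * a i j) * ∑ r, n' r * conj (n' r) := by
    simp only [hT]
    simp [Fin.sum_univ_two]
    ring
  rw [hsplit fun i j k l => ∑ r, N r l j * conj (N i r k), hR, hT']
  linear_combination -hN

variable {E : Type*} [NormedAddCommGroup E] [NormedSpace ℝ E]
variable {p : E} {θ θ' : Fin 2 → E → E →L[ℝ] ℂ} {X Y X' Y' : Fin 2 → E → E}

/-- The Bochner formula: with the form of `laplacian_eq` for `Δ_g f` and `Δ_{g'} u`, it says that the
expression built from `Δ_g f`, the curvature and the Nijenhuis tensor is `Δ_{g'} u - 2 |β|²`. -/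
theorem UnitaryPair.bochner (P : UnitaryPair p θ X Y θ' X' Y')
    {a b : Fin 2 → Fin 2 → ℂ} (ha : ∀ i j, a i j = coeff θ' X i j p)
    (hb : ∀ i j, b i j = coeff θ X' i j p)
    {N : Fin 2 → Fin 2 → Fin 2 → ℂ} {R : Fin 2 → Fin 2 → Fin 2 → Fin 2 → ℂ}
    (hN : ∀ i j k, N i j k =
      1 / 2 * eval02 (fun k => X k p) (fun k => Y k p) (germTorsion θ X Y i p) j k)
    (hR : ∀ i j k l, R i j k l =
      eval11 (fun k => X k p) (fun k => Y k p) (germCurv (germConn θ X Y) i j p) k l) :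
    -2 * (∑ q, eval11 (fun k => X k p) (fun k => Y k p) (extOne (delLogDet (coeff θ' X)
        (coeffDeriv (coeff θ' X) (germConn θ X Y) (germConn θ' X' Y'))) p) q q)
      - 2 * ∑ k, ∑ i, R i i k k + 8 * ∑ l, ∑ p, ∑ i, N l p i * conj (N p l i)
      + 2 * ∑ i, ∑ j, ∑ k, ∑ l, ∑ p, ∑ q, conj (a p i) * a p j * b k q * conj (b l q) *
        (R j i k l + 4 * ∑ r, N r l j * conj (N i r k)) =
    -2 * (∑ q, eval11 (fun k => X' k p) (fun k => Y' k p) (extOne (delNorm (coeff θ' X)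
        (coeffDeriv (coeff θ' X) (germConn θ X Y) (germConn θ' X' Y'))) p) q q)
      - 2 * ∑ q, ∑ i, ∑ j,
      conj (coeffDeriv (coeff θ' X) (germConn θ X Y) (germConn θ' X' Y') i j p (X' q p)) *
        coeffDeriv (coeff θ' X) (germConn θ X Y) (germConn θ' X' Y') i j p (X' q p) := by
  have h1 : ∀ i j, ∑ k, a i k * b k j = if i = j then 1 else 0 := fun i j => by
    simp only [ha, hb]
    exact P.coeff_mul_coeff i j
  have h2 : ∀ i, germN θ' X' Y' i p * conj (a 0 0 * a 1 1 - a 0 1 * a 1 0) =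
      ∑ j, a i j * germN θ X Y j p := fun i => by
    simp only [ha]
    exact P.germN_change i
  have h3 : a 0 0 * a 1 1 - a 0 1 * a 1 0 ≠ 0 := by
    simp only [ha]
    exact P.coeffDet_ne_zero
  have hq := nijenhuis_quadratic (N := N) h1 h2 h3 (fun i j k => by rw [hN i j k, eval02_germTorsion])
  have hT := P.snd.trace_curv
  have key := bochner_algebra (R := R) hT hq
  rw [P.extOne_delLogDet_eq, P.extOne_delNorm_eq]
  simp only [← ha, ← hb, ← hR]
  linear_combination key

/-- The (1,0) part of the differential of `log H`. -/
theorem extOne_log {H : E → ℝ} {η : E → E →L[ℝ] ℂ} (hH : ContDiffAt ℝ ∞ H p)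
    (hη : ContDiffAt ℝ ∞ η p) (hpos : 0 < H p)
    (hdec : ∀ᶠ z in 𝓝 p, ∀ v, (fderiv ℝ H z v : ℂ) = η z v + conj (η z v))
    (hty : ∀ᶠ z in 𝓝 p, ∀ k, η z (Y k z) = Complex.I * η z (X k z)) :
    ContDiffAt ℝ ∞ (fun z => ((H z)⁻¹ : ℝ) • η z) p ∧
    (∀ᶠ z in 𝓝 p, ∀ v, (fderiv ℝ (fun y => Real.log (H y)) z v : ℂ) =
      (((H z)⁻¹ : ℝ) • η z) v + conj ((((H z)⁻¹ : ℝ) • η z) v)) ∧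
    ∀ k, eval11 (fun k => X k p) (fun k => Y k p) (extOne (fun z => ((H z)⁻¹ : ℝ) • η z) p) k k =
      (H p : ℂ)⁻¹ * eval11 (fun k => X k p) (fun k => Y k p) (extOne η p) k k
        + (H p : ℂ)⁻¹ ^ 2 * (conj (η p (X k p)) * η p (X k p)) := by
  have hne := hpos.ne'
  have hs : ContDiffAt ℝ ∞ (fun z => ((H z)⁻¹ : ℝ) • η z) p := (hH.inv hne).smul hη
  refine ⟨hs, ?_, fun k => ?_⟩
  · filter_upwards [hdec, hH.eventually_infty, hH.continuousAt.eventually_ne hne] with z hz hd h0 v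
    rw [fderiv.log hd h0]
    simp only [smul_apply, smul_eq_mul, Complex.ofReal_mul, hz, Complex.real_smul, map_mul,
      Complex.conj_ofReal]
    ring
  · have hHc : DifferentiableAt ℝ (fun z => (H z : ℂ)) p :=
      Complex.ofRealCLM.differentiableAt.comp p hH.diffAt
    have e1 : (fun z => (H z : ℂ) • ((H z)⁻¹ : ℝ) • η z) =ᶠ[𝓝 p] η := by
      filter_upwards [hH.continuousAt.eventually_ne hne] with z h0
      ext v
      have : (H z : ℂ) ≠ 0 := by exact_mod_cast h0
      simp [mul_inv_cancel_left₀ this]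
    have hd : ∀ v, fderiv ℝ (fun z => (H z : ℂ)) p v = η p v + conj (η p v) := fun v => by
      have h := (Complex.ofRealCLM.hasFDerivAt.comp p hH.diffAt.hasFDerivAt).fderiv
      refine Eq.trans ?_ (hdec.self_of_nhds v)
      refine (congrArg (fun L => L v) h).trans ?_
      simp
    have e2 : ∀ v w, extOne η p v w = (H p : ℂ)⁻¹ * (conj (η p v) * η p w - conj (η p w) * η p v)
        + (H p : ℂ) * extOne (fun z => ((H z)⁻¹ : ℝ) • η z) p v w := fun v w => by
      rw [← extOne_congr e1 v w, extOne_smul hHc hs.diffAt, hd, hd]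
      simp only [smul_apply, Complex.real_smul, Complex.ofReal_inv]
      ring
    have hc : (H p : ℂ) ≠ 0 := by exact_mod_cast hne
    have e3 : eval11 (fun k => X k p) (fun k => Y k p) (extOne η p) k k =
        (H p : ℂ)⁻¹ * -(conj (η p (X k p)) * η p (X k p)) + (H p : ℂ) *
          eval11 (fun k => X k p) (fun k => Y k p) (extOne (fun z => ((H z)⁻¹ : ℝ) • η z) p) k k := by
      rw [funext fun v => funext fun w => e2 v w, eval11, evalTwo_add, evalTwo_mul, evalTwo_mul,
        evalTwo_wedge _ _ (fun v => conj (η p v))]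
      have hk := hty.self_of_nhds k
      simp only [evalOne_conj, evalOne_neg_I hk, evalOne_I hk, map_neg, Complex.conj_I, neg_neg,
        map_zero, zero_mul, zero_sub]
      rfl
    rw [e3]
    field_simp
    ring

/-- The Cauchy-Schwarz inequality `|∂u|² ≤ u |β|²`. -/
theorem normSq_delNorm_le (a : Fin 2 → Fin 2 → E → ℂ) (β : Fin 2 → Fin 2 → E → E →L[ℝ] ℂ)
    (z v : E) : Complex.normSq (delNorm a β z v) ≤
      (∑ i, ∑ j, Complex.normSq (a i j z)) * ∑ i, ∑ j, Complex.normSq (β i j z v) := by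
  have h1 : ‖delNorm a β z v‖ ≤ ∑ q : Fin 2 × Fin 2, ‖a q.1 q.2 z‖ * ‖β q.1 q.2 z v‖ := by
    rw [delNorm_apply, ← Fintype.sum_prod_type' fun i j => conj (a i j z) * β i j z v]
    exact (norm_sum_le _ _).trans (Finset.sum_le_sum fun q _ => by simp)
  have h2 := Finset.sum_mul_sq_le_sq_mul_sq Finset.univ
    (fun q : Fin 2 × Fin 2 => ‖a q.1 q.2 z‖) (fun q => ‖β q.1 q.2 z v‖)
  simp only [Complex.normSq_eq_norm_sq]
  rw [← Fintype.sum_prod_type' fun i j => ‖a i j z‖ ^ 2,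
    ← Fintype.sum_prod_type' fun i j => ‖β i j z v‖ ^ 2]
  exact (pow_le_pow_left₀ (norm_nonneg _) h1 2).trans h2

/-- The passage from `Δ u` to `Δ log u`: here `Lu = Δ u`, `Ll = Δ log u`, and `B q`, `G q` are the squared
lengths of `β` and of `∂u` in the direction `e'_q`. -/
theorem laplacian_log_le {S : ℂ} {Lu Ll u : ℝ} {B G : Fin 2 → ℝ} {c : ℂ}
    (hu : 0 < u) (hLu : (Lu : ℂ) = -2 * c) (hS : S = -2 * c - 2 * ∑ q, (B q : ℂ))
    (hLl : (Ll : ℂ) = -2 * ((u : ℂ)⁻¹ * c + (u : ℂ)⁻¹ ^ 2 * ∑ q, (G q : ℂ)))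
    (hG : ∀ q, G q ≤ u * B q) : S.im = 0 ∧ 1 / u * S.re ≤ Ll := by
  have hS' : S = ((Lu - 2 * ∑ q, B q : ℝ) : ℂ) := by
    rw [hS, ← hLu]; push_cast; ring
  have hLl' : Ll = u⁻¹ * Lu - 2 * u⁻¹ ^ 2 * ∑ q, G q := by
    have : (Ll : ℂ) = ((u⁻¹ * Lu - 2 * u⁻¹ ^ 2 * ∑ q, G q : ℝ) : ℂ) := by
      push_cast
      rw [hLl, hLu]; ring
    exact_mod_cast this
  have hsum : ∑ q, G q ≤ u * ∑ q, B q := by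
    rw [Finset.mul_sum]; exact Finset.sum_le_sum fun q _ => hG q
  rw [hS']
  refine ⟨Complex.ofReal_im _, ?_⟩
  rw [Complex.ofReal_re, hLl']
  have h1 : u⁻¹ ^ 2 * ∑ q, G q ≤ u⁻¹ * ∑ q, B q := by
    calc u⁻¹ ^ 2 * ∑ q, G q ≤ u⁻¹ ^ 2 * (u * ∑ q, B q) :=
          mul_le_mul_of_nonneg_left hsum (by positivity)
      _ = u⁻¹ * ∑ q, B q := by field_simp
  rw [one_div, mul_sub]
  linarith

end Bochner

/-! ### Connection, curvature and transition matrix in a chart -/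

section HalfTrace

/-- Half the trace of one Hermitian metric with respect to another is the squared norm of the
matrix that expresses a unitary coframe of the first in terms of one of the second. -/
theorem half_trace_eq {θ θ' : Fin 2 → E4 →L[ℝ] ℂ} {X Y : Fin 2 → E4}
    (hX : ∀ i j, θ i (X j) = if i = j then 1 else 0)
    (hY : ∀ i j, θ i (Y j) = if i = j then Complex.I else 0)
    (hc : ∀ v, v = ∑ k, ((θ k v).re • X k + (θ k v).im • Y k))
    (ht : ∀ i k, θ' i (Y k) = Complex.I * θ' i (X k)) {G G' : Matrix (Fin 4) (Fin 4) ℝ}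
    (hG : ∀ i j, G i j = ∑ k, 2 * ((θ k (stdVec i)).re * (θ k (stdVec j)).re
        + (θ k (stdVec i)).im * (θ k (stdVec j)).im))
    (hG' : ∀ i j, G' i j = ∑ k, 2 * ((θ' k (stdVec i)).re * (θ' k (stdVec j)).re
        + (θ' k (stdVec i)).im * (θ' k (stdVec j)).im)) :
    1 / 2 * (G⁻¹ * G').trace = ∑ i, ∑ j, Complex.normSq (θ' i (X j)) := by
  have hinv := inv_of_frame (ι := Fin 4) (G := G)
    (φ := ![Complex.reCLM.comp (θ 0), Complex.imCLM.comp (θ 0),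
      Complex.reCLM.comp (θ 1), Complex.imCLM.comp (θ 1)])
    (F := ![X 0, Y 0, X 1, Y 1]) ?_ ?_ ?_
  · set T : E4 → E4 → ℝ := fun v w =>
      ∑ k, 2 * ((θ' k v).re * (θ' k w).re + (θ' k v).im * (θ' k w).im) with hT
    have hs := sum_sum_contraction (T := T)
      (fun w => ⟨fun u v => by simp [hT, Fin.sum_univ_two]; ring,
        fun c v => by simp [hT, Fin.sum_univ_two]; ring⟩)
      (fun w => ⟨fun u v => by simp [hT, Fin.sum_univ_two]; ring,
        fun c v => by simp [hT, Fin.sum_univ_two]; ring⟩) ![X 0, Y 0, X 1, Y 1]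
    have h1 : (G⁻¹ * G').trace = ∑ i, ∑ j, G⁻¹ i j * T (stdVec i) (stdVec j) := by
      rw [Matrix.trace]
      refine Finset.sum_congr rfl fun i _ => ?_
      rw [Matrix.diag_apply, Matrix.mul_apply]
      refine Finset.sum_congr rfl fun j _ => ?_
      rw [hG']
      exact congrArg _ (Finset.sum_congr rfl fun k _ => by ring)
    rw [h1, hinv]
    refine (congrArg _ hs).trans ?_
    simp [hT, Fin.sum_univ_four, ht, Fin.sum_univ_two, Complex.normSq_apply]
    ring
  · intro i j
    rw [hG]
    simp [Fin.sum_univ_four, Fin.sum_univ_two]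
    ring
  · intro i j
    fin_cases i <;> fin_cases j <;> simp [hX, hY]
  · intro v
    conv_rhs => rw [hc v]
    simp [Fin.sum_univ_four, Fin.sum_univ_two]
    abel

end HalfTrace

section Charts

variable {M : Type*} [TopologicalSpace M] [ChartedSpace E4 M] [IsManifold (𝓡 4) ∞ M]
variable {J : AlmostComplexStructure M} {K K₁ : AlmostKahlerMetric J} {U : Set M}

namespace LocalUnitaryFrame

variable (e : LocalUnitaryFrame K U) (e₁ : LocalUnitaryFrame K₁ U)

theorem chartInvDeriv_chartX (x : M) (k : Fin 2) {z : E4} (hz : z ∈ (extChartAt (𝓡 4) x).target) :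
    chartInvDeriv x z (e.chartX x k z) = e.X k ((extChartAt (𝓡 4) x).symm z) :=
  chartInvDeriv_chartVec x _ hz

theorem chartInvDeriv_chartY (x : M) (k : Fin 2) {z : E4} (hz : z ∈ (extChartAt (𝓡 4) x).target) :
    chartInvDeriv x z (e.chartY x k z) =
      J.toFun _ (e.X k ((extChartAt (𝓡 4) x).symm z)) :=
  chartInvDeriv_chartVec x (fun y => J.toFun y (e.X k y)) hz

theorem unitaryPair (hU : IsOpen U) {x : M} (hx : x ∈ U) :
    UnitaryPair (extChartAt (𝓡 4) x x) (e.chartθ x) (e.chartX x) (e.chartY x)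
      (e₁.chartθ x) (e₁.chartX x) (e₁.chartY x) := by
  refine ⟨e.unitaryGerm hU hx, e₁.unitaryGerm hU hx, ?_, ?_⟩
  · filter_upwards [chart_eventually_mem x hU hx] with z hz i k
    rw [chartθ_apply, chartθ_apply, e.chartInvDeriv_chartX x k hz.1, e.chartInvDeriv_chartY x k hz.1,
      e₁.type_one_zero i _ hz.2]
  · filter_upwards [chart_eventually_mem x hU hx] with z hz i k
    rw [chartθ_apply, chartθ_apply, e₁.chartInvDeriv_chartX x k hz.1,
      e₁.chartInvDeriv_chartY x k hz.1, e.type_one_zero i _ hz.2]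

theorem coeff_chart (x : M) (i j : Fin 2) {z : E4} (hz : z ∈ (extChartAt (𝓡 4) x).target) :
    coeff (e₁.chartθ x) (e.chartX x) i j z = e.transition e₁ i j ((extChartAt (𝓡 4) x).symm z) := by
  rw [coeff, chartθ_apply, e.chartInvDeriv_chartX x j hz]
  rfl

theorem coeff_chart_self (x : M) (i j : Fin 2) :
    coeff (e₁.chartθ x) (e.chartX x) i j (extChartAt (𝓡 4) x x) = e.transition e₁ i j x := by
  rw [e.coeff_chart e₁ x i j (mem_extChartAt_target x), extChartAt_to_inv]

theorem comp11_chart (x : M) {z : E4} (hz : z ∈ (extChartAt (𝓡 4) x).target)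
    (β : TangentSpace (𝓡 4) ((extChartAt (𝓡 4) x).symm z) →
      TangentSpace (𝓡 4) ((extChartAt (𝓡 4) x).symm z) → ℂ) (k l : Fin 2) :
    e.comp11 ((extChartAt (𝓡 4) x).symm z) β k l =
      eval11 (fun k => e.chartX x k z) (fun k => e.chartY x k z)
        (fun v w => β (chartInvDeriv x z v) (chartInvDeriv x z w)) k l := by
  simp only [comp11, evalType, eval11, evalTwo, e.chartInvDeriv_chartX x _ hz,
    e.chartInvDeriv_chartY x _ hz]

theorem comp11_self (x : M) (β : E4 → E4 → ℂ) (k l : Fin 2) :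
    e.comp11 x β k l = eval11 (fun k => e.chartX x k (extChartAt (𝓡 4) x x))
      (fun k => e.chartY x k (extChartAt (𝓡 4) x x)) β k l := by
  simp only [chartX, chartY, chartVec_self]
  rfl

theorem comp02_self (x : M) (β : E4 → E4 → ℂ) (k l : Fin 2) :
    e.comp02 x β k l = eval02 (fun k => e.chartX x k (extChartAt (𝓡 4) x x))
      (fun k => e.chartY x k (extChartAt (𝓡 4) x x)) β k l := by
  simp only [chartX, chartY, chartVec_self]
  rfl

/-- The connection forms of the second canonical connection in the preferred chart at `x`. -/
theorem chartOneForm_connForm (hU : IsOpen U) {x : M} (hx : x ∈ U) (i j : Fin 2) :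
    chartOneForm (e.connForm i j) x =ᶠ[𝓝 (extChartAt (𝓡 4) x x)]
      germConn (e.chartθ x) (e.chartX x) (e.chartY x) i j := by
  have hd : ∀ᶠ z in 𝓝 (extChartAt (𝓡 4) x x), ∀ i, DifferentiableAt ℝ (e.chartθ x i) z :=
    eventually_all.2 fun i => (e.contDiffAt_chartθ hU hx i).eventually_infty
  filter_upwards [chart_eventually_mem x hU hx, hd] with z hz hdz
  have hc : ∀ i k l, e.comp11 ((extChartAt (𝓡 4) x).symm z)
      (extD₁ (e.θ i) ((extChartAt (𝓡 4) x).symm z)) k l =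
      eval11 (fun k => e.chartX x k z) (fun k => e.chartY x k z) (extOne (e.chartθ x i) z) k l := by
    intro i k l
    rw [e.comp11_chart x hz.1]
    congr 1
    ext v w
    exact extD₁_chart hz.1 (e.contDiffAt_chartθ hU hz.2 i).diffAt (hdz i) v w
  ext v
  rw [germConn_apply]
  refine (e.connForm_apply i j _ (chartInvDeriv x z v)).trans ?_
  simp only [hc, chartθ_apply]

theorem connForm_eq (hU : IsOpen U) {x : M} (hx : x ∈ U) (i j : Fin 2) :
    e.connForm i j x =
      germConn (e.chartθ x) (e.chartX x) (e.chartY x) i j (extChartAt (𝓡 4) x x) :=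
  (chartOneForm_self (e.connForm i j) x).symm.trans (e.chartOneForm_connForm hU hx i j).self_of_nhds

theorem curv_eq (hU : IsOpen U) {x : M} (hx : x ∈ U) (i j k l : Fin 2) :
    e.curv i j k l x = eval11 (fun k => e.chartX x k (extChartAt (𝓡 4) x x))
      (fun k => e.chartY x k (extChartAt (𝓡 4) x x))
      (germCurv (germConn (e.chartθ x) (e.chartX x) (e.chartY x)) i j (extChartAt (𝓡 4) x x)) k l := by
  have hE := e.chartOneForm_connForm hU hx i j
  have h1 : ∀ v w : E4, extD₁ (e.connForm i j) x v w =
      extOne (germConn (e.chartθ x) (e.chartX x) (e.chartY x) i j) (extChartAt (𝓡 4) x x) v w := by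
    intro v w
    rw [← extOne_congr hE]
    exact extD₁_self ((((e.unitaryGerm hU hx).smooth_germConn i j).diffAt).congr_of_eventuallyEq hE)
      v w
  rw [curv]
  refine (e.comp11_self x _ k l).trans ?_
  congr 1
  ext v w
  refine congrArg₂ (· + ·) (h1 v w) (Finset.sum_congr rfl fun k _ => ?_)
  simp only [wedge₁, e.connForm_eq hU hx]
  rfl

theorem torsion_eq (hU : IsOpen U) {x : M} (hx : x ∈ U) (i : Fin 2) (v w : E4) :
    e.torsion e.connForm i x v w =
      germTorsion (e.chartθ x) (e.chartX x) (e.chartY x) i (extChartAt (𝓡 4) x x) v w := by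
  have h1 : extD₁ (e.θ i) x v w = extOne (e.chartθ x i) (extChartAt (𝓡 4) x x) v w :=
    extD₁_self (e.contDiffAt_chartθ hU hx i).diffAt v w
  have h2 : ∀ j, e.θ j x = e.chartθ x j (extChartAt (𝓡 4) x x) :=
    fun j => (chartOneForm_self (e.θ j) x).symm
  refine congrArg₂ (· + ·) h1 (Finset.sum_congr rfl fun j _ => ?_)
  simp only [wedge₁, e.connForm_eq hU hx, h2]
  rfl

theorem nijenhuis_eq (hU : IsOpen U) {x : M} (hx : x ∈ U) (i j k : Fin 2) :
    e.nijenhuis i j k x = 1 / 2 * eval02 (fun k => e.chartX x k (extChartAt (𝓡 4) x x))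
      (fun k => e.chartY x k (extChartAt (𝓡 4) x x))
      (germTorsion (e.chartθ x) (e.chartX x) (e.chartY x) i (extChartAt (𝓡 4) x x)) j k := by
  rw [nijenhuis]
  refine congrArg _ ((e.comp02_self x _ j k).trans ?_)
  congr 1
  ext v w
  exact e.torsion_eq hU hx i v w

/-- Half the trace of one metric with respect to another is the squared norm of the transition
matrix. -/
theorem half_metricTrace {y : M} (hy : y ∈ U) : 1 / 2 * metricTrace K.g K₁.g y =
    ∑ i, ∑ j, Complex.normSq (e.transition e₁ i j y) := by
  have h1 := fun j m => e.type_one_zero j y hy (e.X m y)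
  have h2 := fun j m => e.dual j m y hy
  have hg : ∀ {K' : AlmostKahlerMetric J} (e' : LocalUnitaryFrame K' U) (v w : TangentSpace (𝓡 4) y),
      K'.g.inner y v w = ∑ k, 2 * ((e'.θ k y v).re * (e'.θ k y w).re
        + (e'.θ k y v).im * (e'.θ k y w).im) := by
    intro K' e' v w
    have h := congrArg Complex.re (e'.unitary y hy v w)
    rw [Complex.ofReal_re] at h
    refine h.trans ?_
    simp only [Fin.sum_univ_two, Complex.add_re, Complex.mul_re, Complex.conj_re, Complex.conj_im]
    ring
  have h4 : ∀ i k, e.θ i y (J.toFun y (e.X k y)) = if i = k then Complex.I else 0 := fun i k => by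
    rw [h1, h2]; simp
  exact half_trace_eq (θ := fun i => e.θ i y) (θ' := fun i => e₁.θ i y) (X := fun k => e.X k y)
    (Y := fun k => J.toFun y (e.X k y)) h2 h4 (e.eq_sum_frame y hy)
    (fun i k => e₁.type_one_zero i y hy (e.X k y))
    (fun i j => hg e (stdVec i : E4) (stdVec j : E4)) fun i j => hg e₁ (stdVec i : E4) (stdVec j : E4)

/-- The ratio of the volume forms is the squared modulus of the determinant of the transition
matrix. -/
theorem exp_eq_normSq_det {y : M} (hy : y ∈ U) {c : ℝ}
    (hvol : ∀ v : Fin 4 → TangentSpace (𝓡 4) y, wedgeSq K₁.form y v = c * wedgeSq K.form y v) :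
    c = Complex.normSq (e.transition e₁ 0 0 y * e.transition e₁ 1 1 y
      - e.transition e₁ 0 1 y * e.transition e₁ 1 0 y) := by
  have h1 := fun j m => e.type_one_zero j y hy (e.X m y)
  have h2 := fun j m => e.dual j m y hy
  have h3 := fun j m => e₁.type_one_zero j y hy (e.X m y)
  have h := hvol ![e.X 0 y, J.toFun y (e.X 0 y), e.X 1 y, J.toFun y (e.X 1 y)]
  simp only [wedgeSq, e.form_apply_eq hy, e₁.form_apply_eq hy, Matrix.cons_val_zero,
    Matrix.cons_val_one, Matrix.cons_val, h1, h2, h3, Fin.sum_univ_two] at h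
  simp at h
  simp only [transition, Complex.normSq_apply, Complex.sub_re, Complex.sub_im, Complex.mul_re,
    Complex.mul_im]
  linear_combination -(1 / 8) * h

end LocalUnitaryFrame

end Charts

/-! ### The differential inequality -/

section Final

variable {M : Type*} [TopologicalSpace M] [ChartedSpace E4 M] [IsManifold (𝓡 4) ∞ M]

omit [IsManifold (𝓡 4) ∞ M] in
theorem contDiffAt_chart_of_contMDiff {f : M → ℝ} (hf : ContMDiff (𝓡 4) 𝓘(ℝ, ℝ) ∞ f) (x : M) :
    ContDiffAt ℝ ∞ (fun z => f ((extChartAt (𝓡 4) x).symm z)) (extChartAt (𝓡 4) x x) := by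
  have h1 := (contMDiffAt_iff.1 (hf x)).2
  rw [ModelWithCorners.range_eq_univ, contDiffWithinAt_univ] at h1
  exact h1

end Final

theorem lemma6 {M : Type*} [TopologicalSpace M] [ChartedSpace E4 M] [IsManifold (𝓡 4) ∞ M]
    (J : AlmostComplexStructure M) (K K₁ : AlmostKahlerMetric J)
    (f : M → ℝ) (hf : ContMDiff (𝓡 4) 𝓘(ℝ, ℝ) ∞ f)
    (hvol : ∀ (x : M) (v : Fin 4 → TangentSpace (𝓡 4) x),
      wedgeSq K₁.form x v = Real.exp (f x) * wedgeSq K.form x v)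
    (u : M → ℝ) (hu : ∀ x, u x = (1 / 2) * metricTrace K.g K₁.g x)
    (U : Set M) (hU : IsOpen U)
    (e : LocalUnitaryFrame K U) (e₁ : LocalUnitaryFrame K₁ U)
    (a b : Fin 2 → Fin 2 → M → ℂ)
    (ha : ∀ i j x, a i j x = e.transition e₁ i j x)
    (hb : ∀ i j x, b i j x = e₁.transition e i j x)
    (x : M) (hx : x ∈ U) (S : ℂ)
    (hS : S = (laplacian K.g f x : ℂ) - 2 * e.scalarCurv x
      + 8 * ∑ l, ∑ p, ∑ i, e.nijenhuis l p i x * (starRingEnd ℂ) (e.nijenhuis p l i x)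
      + 2 * ∑ i, ∑ j, ∑ k, ∑ l, ∑ p, ∑ q,
          (starRingEnd ℂ) (a p i x) * a p j x * b k q x * (starRingEnd ℂ) (b l q x)
            * e.curvTerm i j k l x) :
    0 < u x ∧ S.im = 0 ∧
      1 / u x * S.re ≤ laplacian K₁.g (fun y => Real.log (u y)) x := by
  have P := e.unitaryPair e₁ hU hx
  have hmem := chart_eventually_mem x hU hx
  have hA := e.coeff_chart_self e₁ x
  have hB := e₁.coeff_chart_self e x
  have hcurv := e.curv_eq hU hx
  have hnij := e.nijenhuis_eq hU hx
  have hLf := fun η => e.laplacian_eq hU hx (h := f) (η := η) rfl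
    (contDiffAt_chart_of_contMDiff hf x)
  have hLu := fun η => e₁.laplacian_eq hU hx (h := u) (η := η) rfl
  have hLl := fun η => e₁.laplacian_eq hU hx (h := fun y => Real.log (u y)) (η := η) rfl
  have hcoeff := fun i j z hz => e.coeff_chart e₁ x i j (z := z) hz
  have hfs := contDiffAt_chart_of_contMDiff hf x
  set p := extChartAt (𝓡 4) x x with hp
  set A := coeff (e₁.chartθ x) (e.chartX x) with hAdef
  set ϑ := germConn (e.chartθ x) (e.chartX x) (e.chartY x) with hϑ
  set ϑ' := germConn (e₁.chartθ x) (e₁.chartX x) (e₁.chartY x) with hϑ'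
  set β := coeffDeriv A ϑ ϑ' with hβ
  have hAs : ∀ i j, ContDiffAt ℝ ∞ (A i j) p := P.contDiffAt_coeff
  have hβs : ∀ i j, ContDiffAt ℝ ∞ (β i j) p :=
    contDiffAt_coeffDeriv hAs P.fst.smooth_germConn P.snd.smooth_germConn
  have hAd : ∀ᶠ z in 𝓝 p, ∀ i j, DifferentiableAt ℝ (A i j) z :=
    eventually_all.2 fun i => eventually_all.2 fun j => (hAs i j).eventually_infty
  have hD : coeffDet A p ≠ 0 := P.coeffDet_ne_zero
  have hs : ∀ (i j : Fin 2) (z v : E4), conj (ϑ i j z v) = -ϑ j i z v := germConn_skew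
  have hs' : ∀ (i j : Fin 2) (z v : E4), conj (ϑ' i j z v) = -ϑ' j i z v := germConn_skew
  -- the functions `u` and `f` in the chart
  have hH : ∀ᶠ z in 𝓝 p, u ((extChartAt (𝓡 4) x).symm z) = ∑ i, ∑ j, Complex.normSq (A i j z) := by
    filter_upwards [hmem] with z hz
    rw [hu, e.half_metricTrace e₁ hz.2]
    simp only [hcoeff _ _ _ hz.1]
  have hF : ∀ᶠ z in 𝓝 p, Real.exp (f ((extChartAt (𝓡 4) x).symm z)) =
      Complex.normSq (coeffDet A z) := by
    filter_upwards [hmem] with z hz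
    rw [e.exp_eq_normSq_det e₁ hz.2 (hvol _)]
    simp only [coeffDet, hcoeff _ _ _ hz.1]
  have hHs : ContDiffAt ℝ ∞ (fun z => u ((extChartAt (𝓡 4) x).symm z)) p := by
    have h1 : ContDiffAt ℝ ∞ (fun z => ∑ i, ∑ j, Complex.normSq (A i j z)) p := by
      refine ContDiffAt.sum fun i _ => ContDiffAt.sum fun j _ => ?_
      have hr := Complex.reCLM.contDiff.contDiffAt.comp p (hAs i j)
      have hi := Complex.imCLM.contDiff.contDiffAt.comp p (hAs i j)
      exact ((hr.mul hr).add (hi.mul hi)).congr_of_eventuallyEq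
        (Eventually.of_forall fun z => Complex.normSq_apply _)
    exact h1.congr_of_eventuallyEq hH
  -- the type decompositions of `du` and `df`
  have hηs : ContDiffAt ℝ ∞ (delNorm A β) p := contDiffAt_delNorm hAs hβs
  have hφs : ContDiffAt ℝ ∞ (delLogDet A β) p := contDiffAt_delLogDet hAs hβs hD
  have hβt : ∀ᶠ z in 𝓝 p, ∀ i j k,
      β i j z (e.chartY x k z) = Complex.I * β i j z (e.chartX x k z) := P.coeffDeriv_type
  have hηt : ∀ᶠ z in 𝓝 p, ∀ k, delNorm A β z (e.chartY x k z) =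
      Complex.I * delNorm A β z (e.chartX x k z) := by
    filter_upwards [hβt] with z hz k
    simp only [delNorm_apply, hz, Fin.sum_univ_two]
    ring
  have hφt : ∀ᶠ z in 𝓝 p, ∀ k, delLogDet A β z (e.chartY x k z) =
      Complex.I * delLogDet A β z (e.chartX x k z) := by
    filter_upwards [hβt] with z hz k
    simp only [delLogDet_apply, hz]
    ring
  have hηt' := P.type_change hηt
  have hηd : ∀ᶠ z in 𝓝 p, ∀ v, (fderiv ℝ (fun z => u ((extChartAt (𝓡 4) x).symm z)) z v : ℂ) =
      delNorm A β z v + conj (delNorm A β z v) := by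
    filter_upwards [hAd, hHs.eventually_infty, hH.eventually_nhds] with z h1 h2 h3 v
    refine fderiv_norm h1 (fun i j v => hs i j z v) (fun i j v => hs' i j z v) h2 ?_ v
    filter_upwards [h3] with y hy
    rw [hy]
    push_cast
    simp only [Complex.normSq_eq_conj_mul_self]
  have hφd : ∀ᶠ z in 𝓝 p, ∀ v, (fderiv ℝ (fun z => f ((extChartAt (𝓡 4) x).symm z)) z v : ℂ) =
      delLogDet A β z v + conj (delLogDet A β z v) := by
    filter_upwards [hAd, hfs.eventually_infty, hF.eventually_nhds] with z h1 h2 h3 v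
    refine fderiv_log_det h1 (fun i j v => hs i j z v) (fun i j v => hs' i j z v) h2 ?_ v
    filter_upwards [h3] with y hy
    rw [hy, Complex.mul_conj]
  have hux : u x = ∑ i, ∑ j, Complex.normSq (A i j p) := by
    have h := hH.self_of_nhds
    rwa [hp, extChartAt_to_inv] at h
  have hpos : 0 < u x := by
    have h0 : ∀ i j, 0 ≤ Complex.normSq (A i j p) := fun i j => Complex.normSq_nonneg _
    refine lt_of_le_of_ne (hux ▸ Finset.sum_nonneg fun i _ => Finset.sum_nonneg fun j _ => h0 i j)
      fun h => hD ?_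
    rw [hux, Fin.sum_univ_two, Fin.sum_univ_two, Fin.sum_univ_two] at h
    have h1 : A 0 0 p = 0 := Complex.normSq_eq_zero.1 (by linarith [h0 0 0, h0 0 1, h0 1 0, h0 1 1])
    have h2 : A 0 1 p = 0 := Complex.normSq_eq_zero.1 (by linarith [h0 0 0, h0 0 1, h0 1 0, h0 1 1])
    rw [coeffDet, h1, h2, zero_mul, zero_mul, sub_zero]
  have hpos' : 0 < u ((extChartAt (𝓡 4) x).symm p) := by rwa [hp, extChartAt_to_inv]
  obtain ⟨l1, l2, l3⟩ := extOne_log (X := e₁.chartX x) (Y := e₁.chartY x) hHs hηs hpos' hηd hηt'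
  have hlt : ∀ᶠ z in 𝓝 p, ∀ k,
      ((u ((extChartAt (𝓡 4) x).symm z))⁻¹ • delNorm A β z) (e₁.chartY x k z) =
      Complex.I * ((u ((extChartAt (𝓡 4) x).symm z))⁻¹ • delNorm A β z) (e₁.chartX x k z) := by
    filter_upwards [hηt'] with z hz k
    rw [smul_apply, smul_apply, hz, Complex.real_smul, Complex.real_smul]
    ring
  have hLf' := hLf _ hφs hφt hφd
  have hLu' := hLu _ hHs hηs hηt' hηd
  have hLl' := hLl _ (hHs.log hpos'.ne') l1 hlt l2
  have hboch := P.bochner (a := fun i j => a i j x) (b := fun i j => b i j x)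
    (N := fun i j k => e.nijenhuis i j k x) (R := fun i j k l => e.curv i j k l x)
    (fun i j => (ha i j x).trans (hA i j).symm) (fun i j => (hb i j x).trans (hB i j).symm)
    hnij hcurv
  have hS' : S = (laplacian K.g f x : ℂ) - 2 * ∑ k, ∑ i, e.curv i i k k x
      + 8 * ∑ l, ∑ p, ∑ i, e.nijenhuis l p i x * conj (e.nijenhuis p l i x)
      + 2 * ∑ i, ∑ j, ∑ k, ∑ l, ∑ p, ∑ q, conj (a p i x) * a p j x * b k q x * conj (b l q x) *
        (e.curv j i k l x + 4 * ∑ r, e.nijenhuis r l j x * conj (e.nijenhuis i r k x)) := hS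
  rw [← hLf', ← hS'] at hboch
  have hxx : u ((extChartAt (𝓡 4) x).symm p) = u x := by rw [hp, extChartAt_to_inv]
  refine ⟨hpos, laplacian_log_le (Lu := laplacian K₁.g u x)
    (B := fun q => ∑ i, ∑ j, Complex.normSq (β i j p (e₁.chartX x q p)))
    (G := fun q => Complex.normSq (delNorm A β p (e₁.chartX x q p))) hpos hLu' ?_ ?_ fun q => ?_⟩
  · rw [hboch]
    push_cast
    simp only [Complex.normSq_eq_conj_mul_self]
    rfl
  · rw [hLl']
    simp only [l3, hxx, Finset.sum_add_distrib, ← Finset.mul_sum, Complex.normSq_eq_conj_mul_self]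
  · rw [hux]
    exact normSq_delNorm_le A β p _

end
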